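/- Let $k$ be an algebraically closed field of characteristic $p\ge 5$, let $x,y$ be the images of $X,Y$ in $k[X,Y]/(X^p,Y^p)$, and write $v^{(i)}=v^i/i!$ for $0\le i\le p-1$ and $v^{(-1)}=0$. Let $W=\operatorname{Der}\bigl(k[X,Y]/(X^p,Y^p)\bigr)$ with $p$-map $D^{[p]}=D^p$, let $H=H(2;(1,1);\Phi(1))\subset W$ be the Hamiltonian Lie algebra with basis $$y^{(j-1)}\partial_x-x^{(p-1)}y^{(j)}\partial_y,\qquad x^{(i-1)}y^{(j)}\partial_y-x^{(i)}y^{(j-1)}\partial_x\qquad(1\le i\le p-1,\ 0\le j\le p-1),$$ and let $\widehat H$ be its minimal $p$-envelope, the smallest Lie subalgebra of $W$ that contains $H$ and is closed under the $p$-map. For $n\ge 0$ let $\widehat H_{(n)}$ be the set of $f\partial_x+g\partial_y\in\widehat H$ with $f,g\in(x,y)^{n+1}$; then $\widehat H_{(0)}/\widehat H_{(1)}\cong\mathfrak{gl}_2$. For $(a,b)\in\mathbb F_p^2$ let $L_0(a,b)$ be the simple restricted $\widehat H_{(0)}/\widehat H_{(1)}$-module of highest weight $(a,b)$, i.e. containing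 a nonzero vector annihilated by $x\partial_y$ on which $x\partial_x$ and $y\partial_y$ act as $a$ and $b$; inflate it to $\widehat H_{(0)}$. Let $$Z(a,b)=\mathfrak u(\widehat H)\otimes_{\mathfrak u(\widehat H_{(0)})}L_0(a,b),$$ where $\mathfrak u$ denotes the restricted universal enveloping algebra, and let $L(a,b)$ be the quotient of $Z(a,b)$ by the sum of its proper submodules. Suppose that $a-b=1$ in $\mathbb F_p$. Then $Z(a,b)$ has a composition series, it is not simple, and its composition factors, counted with multiplicity, are as follows. 1. If $(a,b)=(p-1,p-2)$ or $(a,b)=(1,0)$, there are three composition factors, of dimensions $1$, $p^2-1$ and $p^2$. 2. If $(a,b)=(0,-1)$, there are four composition factors: two of them are the trivial one-dimensional module, and the other two are isomorphic to $L(0,-1)$ and $L(-1,-1)$, each of dimension $p^2-1$. 3. In all other cases there are two composition factors, both of dimension $p^2$. -/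

import Mathlib

open scoped TensorProduct

namespace HamiltonianLie

noncomputable section

/-! ### The truncated polynomial ring and its derivations -/

/-- The ideal `(X^p, Y^p)` of `k[X,Y]`. -/
def truncIdeal (k : Type*) [Field k] (p : ℕ) : Ideal (MvPolynomial (Fin 2) k) :=
  Ideal.span (Set.range fun i : Fin 2 => MvPolynomial.X i ^ p)

/-- The truncated polynomial ring `O(2;(1,1)) = k[X,Y]/(X^p, Y^p)`. -/
def TruncPoly (k : Type*) [Field k] (p : ℕ) : Type _ :=
  MvPolynomial (Fin 2) k ⧸ truncIdeal k p

instance (k : Type*) [Field k] (p : ℕ) : CommRing (TruncPoly k p) :=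
  inferInstanceAs (CommRing (MvPolynomial (Fin 2) k ⧸ truncIdeal k p))

instance (k : Type*) [Field k] (p : ℕ) : Algebra k (TruncPoly k p) :=
  inferInstanceAs (Algebra k (MvPolynomial (Fin 2) k ⧸ truncIdeal k p))

/-- The quotient map `k[X,Y] → k[X,Y]/(X^p, Y^p)`. -/
def truncMk (k : Type*) [Field k] (p : ℕ) : MvPolynomial (Fin 2) k →ₐ[k] TruncPoly k p :=
  Ideal.Quotient.mkₐ k (truncIdeal k p)

theorem truncMk_surjective (k : Type*) [Field k] (p : ℕ) : Function.Surjective (truncMk k p) :=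
  Ideal.Quotient.mkₐ_surjective k (truncIdeal k p)

theorem truncMk_eq_zero_iff (k : Type*) [Field k] (p : ℕ) (f : MvPolynomial (Fin 2) k) :
    truncMk k p f = 0 ↔ f ∈ truncIdeal k p :=
  Ideal.Quotient.eq_zero_iff_mem

/-- The Witt algebra `W(2;(1,1)) = Der O(2;(1,1))`, with the commutator bracket. -/
abbrev Witt (k : Type*) [Field k] (p : ℕ) : Type _ :=
  Derivation k (TruncPoly k p) (TruncPoly k p)

variable (k : Type*) [Field k] (p : ℕ)

/-- The image of the `i`-th variable: `x = coord 0` and `y = coord 1`. -/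
def coord (i : Fin 2) : TruncPoly k p :=
  truncMk k p (MvPolynomial.X i)

theorem coord_pow (i : Fin 2) : coord k p i ^ p = 0 := by
  rw [coord, ← map_pow, truncMk_eq_zero_iff]
  exact Ideal.subset_span ⟨i, rfl⟩

theorem adjoin_coord : Algebra.adjoin k (Set.range (coord k p)) = ⊤ := by
  have h := congrArg (Subalgebra.map (truncMk k p)) (MvPolynomial.adjoin_range_X (R := k)
      (σ := Fin 2))
  rw [AlgHom.map_adjoin, ← Set.range_comp, Algebra.map_top,
    (AlgHom.range_eq_top _).2 (truncMk_surjective k p)] at h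
  exact h

/-- A derivation of the truncated polynomial ring is determined by its values at `x` and `y`. -/
theorem witt_ext {D E : Witt k p} (h : ∀ i, D (coord k p i) = E (coord k p i)) : D = E :=
  Derivation.ext_of_adjoin_eq_top _ (adjoin_coord k p) (by rintro _ ⟨i, rfl⟩; exact h i)

theorem pderiv_mem [CharP k p] (i : Fin 2) (f : MvPolynomial (Fin 2) k)
    (hf : truncMk k p f = 0) : truncMk k p (MvPolynomial.pderiv i f) = 0 := by
  rw [truncMk_eq_zero_iff] at hf ⊢
  induction hf using Submodule.span_induction with
  | mem x hx =>
    obtain ⟨j, rfl⟩ := hx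
    simp [Derivation.leibniz_pow, CharP.cast_eq_zero]
  | zero => simp
  | add x y _ _ hx hy => rw [map_add]; exact Ideal.add_mem _ hx hy
  | smul a x hx ih =>
    rw [smul_eq_mul, Derivation.leibniz]
    exact Ideal.add_mem _ (Ideal.mul_mem_left _ _ ih) (Ideal.mul_mem_right _ _ hx)

/-- The partial derivatives `∂_x = del 0` and `∂_y = del 1` of the truncated polynomial ring. -/
def del [CharP k p] (i : Fin 2) : Witt k p :=
  Derivation.liftOfSurjective (d := MvPolynomial.pderiv i) (truncMk_surjective k p)
    (pderiv_mem k p i)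

theorem del_coord [CharP k p] (i j : Fin 2) :
    del k p i (coord k p j) = if i = j then 1 else 0 := by
  refine (Derivation.liftOfSurjective_apply (truncMk_surjective k p)
    (pderiv_mem k p i) (MvPolynomial.X j)).trans ?_
  rw [MvPolynomial.pderiv_X]
  by_cases hij : i = j
  · subst hij; simp
  · simp [hij]

theorem leibniz_iterate {k A : Type*} [Field k] [CommRing A] [Algebra k A] (D : Derivation k A A)
    (n : ℕ) (f : A ⊗[k] A) :
    LinearMap.mul' k A (((LinearMap.rTensor A D.toLinearMap + LinearMap.lTensor A D.toLinearMap :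
      Module.End k (A ⊗[k] A)) ^ n) f) = (D.toLinearMap ^ n) (LinearMap.mul' k A f) := by
  induction n generalizing f with
  | zero => simp
  | succ n ih =>
    rw [pow_succ, Module.End.mul_apply, ih, pow_succ, Module.End.mul_apply]
    congr 1
    induction f with
    | zero => simp
    | add a b ha hb => rw [map_add, map_add, ha, hb, map_add, map_add]
    | tmul a b =>
      simp [mul_comm, add_comm]

theorem leibniz_pow_char {k A : Type*} [Field k] [CommRing A] [Algebra k A] (p : ℕ)
    [Fact p.Prime] [CharP k p] (D : Derivation k A A) (f g : A) :
    (D.toLinearMap ^ p) (f * g) = f * (D.toLinearMap ^ p) g + g * (D.toLinearMap ^ p) f := by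
  have h := leibniz_iterate D p (f ⊗ₜ g)
  have hc : Commute (LinearMap.rTensor A D.toLinearMap : Module.End k (A ⊗[k] A))
      (LinearMap.lTensor A D.toLinearMap) := by
    refine LinearMap.ext fun t => ?_
    induction t with
    | zero => simp
    | add a b ha hb => rw [map_add, ha, hb, map_add]
    | tmul a b => simp
  obtain ⟨r, hr⟩ := hc.exists_add_pow_prime_eq (Fact.out : p.Prime)
  have hp : ((p : ℕ) : Module.End k (A ⊗[k] A)) = 0 := by
    rw [← map_natCast (algebraMap k (Module.End k (A ⊗[k] A))), CharP.cast_eq_zero, map_zero]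
  rw [hr, hp, LinearMap.mul'_apply] at h
  rw [← h, LinearMap.rTensor_pow, LinearMap.lTensor_pow]
  simp [mul_comm, add_comm]

variable {k p}

/-- The `p`-map `D^[p] = D^p` of `W(2;(1,1))`: the `p`-th iterate of a derivation is a
derivation in characteristic `p`. -/
def pMap [Fact p.Prime] [CharP k p] (D : Witt k p) : Witt k p :=
  Derivation.mk' (D.toLinearMap ^ p) fun f g => leibniz_pow_char p D f g

theorem pMap_apply [Fact p.Prime] [CharP k p] (D : Witt k p) (f : TruncPoly k p) :
    pMap D f = D^[p] f :=
  Module.End.pow_apply _ _ _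

variable (k p)

/-! ### The Hamiltonian algebra and its minimal `p`-envelope -/

/-- The divided powers `v^(i) = v^i / i!`, where `v^(i) = 0` for negative `i`. They are used for
`i ≤ p - 1` only. -/
def dpow {k : Type*} [Field k] {p : ℕ} (v : TruncPoly k p) : ℤ → TruncPoly k p
  | Int.ofNat i => ((i.factorial : k)⁻¹) • v ^ i
  | Int.negSucc _ => 0

/-- `x^(i) y^(j)`. -/
def mono (i j : ℤ) : TruncPoly k p :=
  dpow (coord k p 0) i * dpow (coord k p 1) j

theorem dpow_natCast {k : Type*} [Field k] {p : ℕ} (v : TruncPoly k p) (n : ℕ) :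
    dpow v (n : ℤ) = ((n.factorial : k)⁻¹) • v ^ n := rfl

theorem mono_zero_left (j : ℤ) : mono k p 0 j = dpow (coord k p 1) j := by
  have h := dpow_natCast (coord k p 0) 0
  simp only [Nat.cast_zero, Nat.factorial_zero, Nat.cast_one, inv_one, pow_zero, one_smul] at h
  rw [mono, h, one_mul]

theorem mono_zero_right (i : ℤ) : mono k p i 0 = dpow (coord k p 0) i := by
  have h := dpow_natCast (coord k p 1) 0
  simp only [Nat.cast_zero, Nat.factorial_zero, Nat.cast_one, inv_one, pow_zero, one_smul] at h
  rw [mono, h, mul_one]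

theorem dpow_one {k : Type*} [Field k] {p : ℕ} (v : TruncPoly k p) : dpow v 1 = v := by
  have h := dpow_natCast v 1
  simpa using h

theorem dpow_zero {k : Type*} [Field k] {p : ℕ} (v : TruncPoly k p) : dpow v 0 = 1 := by
  have h := dpow_natCast v 0
  simpa using h

theorem dpow_neg_one {k : Type*} [Field k] {p : ℕ} (v : TruncPoly k p) : dpow v (-1) = 0 := rfl

variable [CharP k p]

/-- `y^(j-1) ∂_x - x^(p-1) y^(j) ∂_y`. -/
def hamA (j : ℕ) : Witt k p :=
  mono k p 0 (j - 1) • del k p 0 - mono k p (p - 1) j • del k p 1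

/-- `x^(i-1) y^(j) ∂_y - x^(i) y^(j-1) ∂_x`. -/
def hamB (i j : ℕ) : Witt k p :=
  mono k p (i - 1) j • del k p 1 - mono k p i (j - 1) • del k p 0

/-- The Hamiltonian algebra `H = H(2;(1,1);Φ(1))`, the Lie subalgebra of `W(2;(1,1))` with
basis `y^(j-1) ∂_x - x^(p-1) y^(j) ∂_y`, `x^(i-1) y^(j) ∂_y - x^(i) y^(j-1) ∂_x`
(`1 ≤ i ≤ p - 1`, `0 ≤ j ≤ p - 1`). -/
def ham : LieSubalgebra k (Witt k p) :=
  LieSubalgebra.lieSpan k (Witt k p)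
    ({D | ∃ j : ℕ, j ≤ p - 1 ∧ D = hamA k p j} ∪
      {D | ∃ i j : ℕ, 1 ≤ i ∧ i ≤ p - 1 ∧ j ≤ p - 1 ∧ D = hamB k p i j})

theorem hamA_one : hamA k p 1 = del k p 0 - mono k p (p - 1) 1 • del k p 1 := by
  simp [hamA, mono_zero_left, dpow_zero]

/-- The maximal ideal `(x, y)` of the truncated polynomial ring. -/
def maxIdeal (k : Type*) [Field k] (p : ℕ) : Ideal (TruncPoly k p) :=
  Ideal.span (Set.range (coord k p))

theorem derivation_mem {k : Type*} [Field k] {p : ℕ} (D : Witt k p) (I : Ideal (TruncPoly k p))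
    (h : ∀ i, D (coord k p i) ∈ I) (f : TruncPoly k p) : D f ∈ I := by
  have hf : f ∈ Algebra.adjoin k (Set.range (coord k p)) := by
    rw [adjoin_coord]; exact Algebra.mem_top
  induction hf using Algebra.adjoin_induction with
  | mem x hx => obtain ⟨i, rfl⟩ := hx; exact h i
  | algebraMap r => rw [Derivation.map_algebraMap]; exact I.zero_mem
  | add a b _ _ ha hb => rw [map_add]; exact I.add_mem ha hb
  | mul a b _ _ ha hb =>
    rw [Derivation.leibniz]
    exact I.add_mem (I.mul_mem_left _ hb) (I.mul_mem_left _ ha)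

/-- The standard filtration `W(2;(1,1))_(n) = ⨁_{d ≥ n} W(2;(1,1))_d` for `n ≥ 0`: the
derivations `f ∂_x + g ∂_y` for which `f` and `g` have no terms of degree less than `n + 1`,
that is, `f, g ∈ (x, y)^(n+1)`. -/
def wittFil (k : Type*) [Field k] (p : ℕ) (n : ℕ) : LieSubalgebra k (Witt k p) where
  carrier := {D | ∀ i, D (coord k p i) ∈ maxIdeal k p ^ (n + 1)}
  add_mem' hD hE i := Ideal.add_mem _ (hD i) (hE i)
  zero_mem' _ := Ideal.zero_mem _
  smul_mem' c D hD i := by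
    rw [Derivation.smul_apply, Algebra.smul_def]
    exact Ideal.mul_mem_left _ _ (hD i)
  lie_mem' {D E} hD hE i := by
    rw [Derivation.commutator_apply]
    exact Ideal.sub_mem _ (derivation_mem D _ hD _) (derivation_mem E _ hE _)

theorem coord_smul_del_mem_wittFil (i j : Fin 2) : coord k p i • del k p j ∈ wittFil k p 0 := by
  intro l
  rw [show (0 + 1 : ℕ) = 1 from rfl, pow_one, Derivation.smul_apply, smul_eq_mul]
  exact Ideal.mul_mem_right _ _ (Ideal.subset_span ⟨i, rfl⟩)

theorem hamA_one_step (m : ℕ) (hm : m + 1 < p) :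
    hamA k p 1 (mono k p ((m + 1 : ℕ) : ℤ) 1) = mono k p (m : ℤ) 1 := by
  have hp1 : ((p : ℤ) - 1) = ((p - 1 : ℕ) : ℤ) := by omega
  have hx : hamA k p 1 (coord k p 0) = 1 := by
    simp [hamA_one, del_coord]
  have hy : hamA k p 1 (coord k p 1) = - mono k p (p - 1) 1 := by
    simp [hamA_one, del_coord]
  have hpow : coord k p 0 ^ (m + 1) * coord k p 0 ^ (p - 1) = 0 := by
    rw [← pow_add, show m + 1 + (p - 1) = p + m by omega, pow_add, coord_pow, zero_mul]
  have hne : ((m + 1 : ℕ) : k) ≠ 0 := by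
    rw [Ne, CharP.cast_eq_zero_iff k p]
    exact Nat.not_dvd_of_pos_of_lt (Nat.succ_pos m) hm
  have hsecond : mono k p ((m + 1 : ℕ) : ℤ) 0 * mono k p (p - 1) 1 = 0 := by
    rw [mono_zero_right, mono, hp1, dpow_natCast, dpow_natCast, smul_mul_assoc, smul_mul_assoc,
      mul_smul_comm, ← mul_assoc, hpow]
    simp
  have hfirst : hamA k p 1 (dpow (coord k p 0) ((m + 1 : ℕ) : ℤ)) = dpow (coord k p 0) (m : ℤ) := by
    rw [dpow_natCast, dpow_natCast, Derivation.map_smul, Derivation.leibniz_pow, hx,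
      Nat.factorial_succ, Nat.add_sub_cancel, smul_eq_mul, mul_one, ← Nat.cast_smul_eq_nsmul k,
      smul_smul, Nat.cast_mul, mul_inv_rev, mul_assoc, inv_mul_cancel₀ hne, mul_one]
  rw [mono_zero_right] at hsecond
  have hL : mono k p ((m + 1 : ℕ) : ℤ) 1 = dpow (coord k p 0) ((m + 1 : ℕ) : ℤ) * coord k p 1 := by
    rw [mono, dpow_one]
  have hR : mono k p (m : ℤ) 1 = dpow (coord k p 0) (m : ℤ) * coord k p 1 := by
    rw [mono, dpow_one]
  rw [hL, hR, Derivation.leibniz, hfirst, hy, smul_neg, smul_eq_mul, hsecond, neg_zero, zero_add,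
    smul_eq_mul, mul_comm]

theorem hamA_one_iterate (j : ℕ) (hj : j < p) :
    (hamA k p 1)^[j + 1] (coord k p 1) = - mono k p ((p - 1 - j : ℕ) : ℤ) 1 := by
  induction j with
  | zero =>
    have hp1 : ((p : ℤ) - 1) = ((p - 1 : ℕ) : ℤ) := by omega
    simp [hamA_one, del_coord, hp1]
  | succ j ih =>
    rw [Function.iterate_succ_apply', ih (by omega), map_neg,
      show p - 1 - j = (p - 1 - (j + 1)) + 1 by omega, hamA_one_step k p _ (by omega)]

variable [Fact p.Prime]

/-- The minimal `p`-envelope `Ĥ = H_[p]`: the smallest Lie subalgebra of `W(2;(1,1))` that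
contains `H` and is closed under the `p`-map. -/
def hamHat : LieSubalgebra k (Witt k p) :=
  sInf {L | ham k p ≤ L ∧ ∀ D ∈ L, pMap D ∈ L}

/-- `Ĥ_(n) = Ĥ ∩ W(2;(1,1))_(n)`. -/
def hamFil (n : ℕ) : LieSubalgebra k (Witt k p) :=
  hamHat k p ⊓ wittFil k p n

theorem ham_le_hamHat : ham k p ≤ hamHat k p :=
  le_sInf fun _ hL => hL.1

theorem pMap_mem_hamHat {D : Witt k p} (hD : D ∈ hamHat k p) : pMap D ∈ hamHat k p := by
  rw [← SetLike.mem_coe, hamHat, LieSubalgebra.coe_sInf, Set.mem_iInter₂] at hD ⊢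
  exact fun L hL => hL.2 D (hD L hL)

theorem hamA_mem (j : ℕ) (hj : j ≤ p - 1) : hamA k p j ∈ hamHat k p :=
  ham_le_hamHat k p (LieSubalgebra.subset_lieSpan (Or.inl ⟨j, hj, rfl⟩))

theorem hamB_mem (i j : ℕ) (hi : 1 ≤ i) (hi' : i ≤ p - 1) (hj : j ≤ p - 1) :
    hamB k p i j ∈ hamHat k p :=
  ham_le_hamHat k p (LieSubalgebra.subset_lieSpan (Or.inr ⟨i, j, hi, hi', hj, rfl⟩))

/-- `(∂_x - x^(p-1) y ∂_y)^[p] = - y ∂_y`. -/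
theorem pMap_hamA_one : pMap (hamA k p 1) = - (coord k p 1 • del k p 1) := by
  have hp := (Fact.out : p.Prime).two_le
  refine witt_ext k p fun i => ?_
  rw [pMap_apply]
  fin_cases i
  · have hx : hamA k p 1 (coord k p 0) = 1 := by simp [hamA_one, del_coord]
    have h0 : ∀ q : ℕ, (hamA k p 1)^[q] 0 = 0 := fun q => Function.iterate_fixed (map_zero _) q
    have h := congrArg (fun n => (hamA k p 1)^[n] (coord k p 0)) (show p = (p - 2) + 1 + 1 by omega)
    refine h.trans ?_
    simp [Function.iterate_succ_apply, hx, h0, del_coord]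
  · have h := congrArg (fun n => (hamA k p 1)^[n] (coord k p 1)) (show p = (p - 1) + 1 by omega)
    refine h.trans ?_
    refine (hamA_one_iterate k p (p - 1) (by omega)).trans ?_
    simp [mono_zero_left, dpow_one, del_coord]

theorem ydy_mem_hamHat : coord k p 1 • del k p 1 ∈ hamHat k p := by
  have hp := (Fact.out : p.Prime).two_le
  have h := pMap_mem_hamHat k p (hamA_mem k p 1 (by omega))
  rw [pMap_hamA_one] at h
  have h2 := (hamHat k p).neg_mem h
  have h3 : - -(coord k p 1 • del k p 1) = coord k p 1 • del k p 1 := neg_neg _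
  rwa [h3] at h2

theorem xdx_mem_hamHat : coord k p 0 • del k p 0 ∈ hamHat k p := by
  have hp := (Fact.out : p.Prime).two_le
  have h := (hamHat k p).sub_mem (ydy_mem_hamHat k p)
    (hamB_mem k p 1 1 le_rfl (by omega) (by omega))
  have h2 : hamB k p 1 1 = coord k p 1 • del k p 1 - coord k p 0 • del k p 0 := by
    simp [hamB, mono_zero_left, mono_zero_right, dpow_one]
  have h3 : coord k p 1 • del k p 1 - (coord k p 1 • del k p 1 - coord k p 0 • del k p 0) =
    coord k p 0 • del k p 0 := sub_sub_cancel _ _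
  rwa [h2, h3] at h

theorem xdy_mem_hamHat (hp : 3 ≤ p) : coord k p 0 • del k p 1 ∈ hamHat k p := by
  have h := hamB_mem k p 2 0 (by omega) (by omega) (by omega)
  have h2 : mono k p 2 (-1) = 0 := by rw [mono, dpow_neg_one, mul_zero]
  have h3 : hamB k p 2 0 = coord k p 0 • del k p 1 - (0 : TruncPoly k p) • del k p 0 := by
    simp [hamB, mono_zero_right, dpow_one, h2]
  have h4 : coord k p 0 • del k p 1 - (0 : TruncPoly k p) • del k p 0 =
    coord k p 0 • del k p 1 := (congrArg _ (zero_smul _ _)).trans (sub_zero _)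
  rwa [h3, h4] at h

/-- `x ∂_x` as an element of `Ĥ_(0)`. -/
def xdx : hamFil k p 0 :=
  ⟨coord k p 0 • del k p 0, xdx_mem_hamHat k p, coord_smul_del_mem_wittFil k p 0 0⟩

/-- `y ∂_y` as an element of `Ĥ_(0)`. -/
def ydy : hamFil k p 0 :=
  ⟨coord k p 1 • del k p 1, ydy_mem_hamHat k p, coord_smul_del_mem_wittFil k p 1 1⟩

/-! ### Restricted modules and restricted enveloping algebras -/

section Restricted

variable {k p}

/-- A module `M` over a Lie subalgebra `L` of `W(2;(1,1))` is restricted if `x^[p]` acts as the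
`p`-th power of the action of `x`, for all `x` in `L` (with `x^[p]` in `L`). -/
def IsRestricted (L : LieSubalgebra k (Witt k p)) (M : Type*) [AddCommGroup M] [Module k M]
    [LieRingModule L M] [LieModule k L M] : Prop :=
  ∀ D E : L, (E : Witt k p) = pMap (D : Witt k p) →
    LieModule.toEnd k L M E = LieModule.toEnd k L M D ^ p

/-- The relations `D^p = D^[p]` in the universal enveloping algebra. -/
inductive RestrictedRel (L : LieSubalgebra k (Witt k p)) :
    UniversalEnvelopingAlgebra k L → UniversalEnvelopingAlgebra k L → Prop
  | pow_eq (D E : L) (h : (E : Witt k p) = pMap (D : Witt k p)) :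
      RestrictedRel L (UniversalEnvelopingAlgebra.ι k D ^ p) (UniversalEnvelopingAlgebra.ι k E)

end Restricted

/-- The restricted universal enveloping algebra `u(Ĥ)`, the quotient of the universal enveloping
algebra `U(Ĥ)` by the two-sided ideal generated by all `D^p - D^[p]`. -/
abbrev RestrictedEnv : Type _ :=
  RingQuot (RestrictedRel (hamHat k p))

/-- The canonical map `Ĥ → u(Ĥ)`. -/
def envι (D : hamHat k p) : RestrictedEnv k p :=
  RingQuot.mkAlgHom k (RestrictedRel (hamHat k p)) (UniversalEnvelopingAlgebra.ι k D)

/-- `M` is isomorphic to the simple restricted `gl_2`-module `L_0(a,b)` of highest weight `(a,b)`,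
where `Ĥ_(0) / Ĥ_(1) ≅ gl_2`, seen as an `Ĥ_(0)`-module by inflation: `M` is a simple restricted
`Ĥ_(0)`-module on which `Ĥ_(1)` acts by zero, with a nonzero vector that is annihilated by `x ∂_y`
and on which `x ∂_x` and `y ∂_y` act as the scalars `a` and `b` of the prime field. -/
structure IsSimpleOfHighestWeight (a b : ZMod p) (M : Type*) [AddCommGroup M] [Module k M]
    [LieRingModule (hamFil k p 0) M] [LieModule k (hamFil k p 0) M] : Prop where
  restricted : IsRestricted (hamFil k p 0) M
  inflated : ∀ D : hamFil k p 0, (D : Witt k p) ∈ hamFil k p 1 → ∀ m : M, ⁅D, m⁆ = 0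
  simple : LieModule.IsIrreducible k (hamFil k p 0) M
  highestWeight : ∃ m : M, m ≠ 0 ∧
    ⁅xdx k p, m⁆ = ZMod.castHom (dvd_refl p) k a • m ∧
    ⁅ydy k p, m⁆ = ZMod.castHom (dvd_refl p) k b • m ∧
    ∃ D : hamFil k p 0, (D : Witt k p) = coord k p 0 • del k p 1 ∧ ⁅D, m⁆ = 0

/-! ### Induced modules -/

section Induced

variable (M : Type*) [AddCommGroup M] [Module k M]
    [LieRingModule (hamFil k p 0) M] [LieModule k (hamFil k p 0) M]

/-- The `u(Ĥ)`-submodule of `u(Ĥ) ⊗_k M` generated by the elements `D ⊗ m - 1 ⊗ D m` with `D` in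
`Ĥ_(0)`. -/
def balancedRel : Submodule (RestrictedEnv k p) (RestrictedEnv k p ⊗[k] M) :=
  Submodule.span _ {t | ∃ (D : hamFil k p 0) (m : M),
    t = envι k p ⟨D, D.2.1⟩ ⊗ₜ[k] m - 1 ⊗ₜ[k] ⁅D, m⁆}

/-- The induced module `Z(M) = u(Ĥ) ⊗_{u(Ĥ_(0))} M`, a left `u(Ĥ)`-module. Since the algebra
`u(Ĥ_(0))` is generated by `Ĥ_(0)`, the tensor product over it is the quotient of `u(Ĥ) ⊗_k M` by
all `u D ⊗ m - u ⊗ D m` with `D` in `Ĥ_(0)`. -/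
abbrev Induced : Type _ :=
  (RestrictedEnv k p ⊗[k] M) ⧸ balancedRel k p M

/-- The quotient of `Z(M)` by the sum of its proper submodules. If `Z(M)` has a unique maximal
submodule, this is its unique simple quotient; for `M = L_0(a,b)` it is denoted by `L(a,b)`. -/
abbrev SimpleHead : Type _ :=
  Induced k p M ⧸ sSup {N : Submodule (RestrictedEnv k p) (Induced k p M) | N ≠ ⊤}

variable {M}

/-- The `i`-th factor `N_{i+1} / N_i` of a composition series `N_0 < N_1 < ⋯ < N_l`
of submodules of `Z(M)`. -/
abbrev compFactor (s : CompositionSeries (Submodule (RestrictedEnv k p) (Induced k p M)))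
    (i : Fin s.length) : Type _ :=
  ↥(s i.succ) ⧸ (s i.castSucc).submoduleOf (s i.succ)

/-- The multiset of the dimensions over `k` of the factors of a composition series. -/
def factorDims (s : CompositionSeries (Submodule (RestrictedEnv k p) (Induced k p M))) :
    Multiset ℕ :=
  Finset.univ.val.map fun i : Fin s.length => Module.finrank k (compFactor k p s i)

end Induced

/-- A `u(Ĥ)`-module is trivial one-dimensional if it is one-dimensional over `k` and `Ĥ` acts
on it by zero. -/
def IsTrivialOneDim (V : Type*) [AddCommGroup V] [Module k V] [Module (RestrictedEnv k p) V] :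
    Prop :=
  Module.finrank k V = 1 ∧ ∀ (D : hamHat k p) (v : V), envι k p D • v = 0

end

end HamiltonianLie

open HamiltonianLie

/-! For `a - b = 1` the module `Z(a,b)` is a space of differential forms, and its structure is read
off from a twisted de Rham complex. Let `F_c` denote the truncated polynomials with `D` acting as `D
+ c div D`, and `Ω_c` the one-forms with the Lie derivative plus `c div D`. For `c` in the prime
field these are restricted modules over `W(2;(1,1))`, hence over `u(Ĥ)`.

Realization. Vector fields with coefficients in `(x,y)^2` kill `x^(p-1) y^(p-1)`, and also its
products with `dx` and `dy`. The last two span a copy of `L_0(a,a-1)` in `Ω_a`, and the monomial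
alone spans `L_0(a,a)` in `F_(a+1)`. These subspaces generate, and `Z(M)` is spanned by `p^2 dim M`
ordered monomials, so comparing dimensions gives `Z(a,a-1) ≅ Ω_a` and `Z(a,a) ≅ F_(a+1)`
(`nonempty_equiv_formRep`, `nonempty_equiv_funRep`).

The complex. The generators `D` of `H` satisfy `div D = x^(p-1) D(x)`: formally, they preserve
`exp(x^(p)) dx ∧ dy`, where the parenthesised exponent is a divided power. Hence `d - θ dx ∧` with
`θ = -c x^(p-1)` commutes with `Ĥ` and gives a complex `F_c → Ω_c → F_(c+1)` (`diffFun_funAct`,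
`diffForm_formAct`).

Functions. A submodule of `F_c` is spanned by monomials, because `x ∂_x` and `y ∂_y` separate them.
Moving between monomials shows that `F_c` is simple for `c ≠ 0, 1`, that the constants are the
largest proper submodule of `F_0`, and that the elements without a term `x^(p-1) y^(p-1)` form the
smallest nonzero submodule of `F_1`.

Conclusion for `a ≠ 0`. The first map is injective and the second surjective, so the complex is
exact by dimension count. The factors of `Ω_a` are those of `F_a` and `F_(a+1)`, and an extra
trivial factor appears exactly when `a = 1` or `a = -1`.

Conclusion for `a = 0`. This is the ordinary truncated de Rham complex. The exact forms are `F_0`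
modulo constants, which is `L(-1,-1)`. The first cohomology has dimension two and is killed by `Ĥ`,
by Cartan's formula. Finally, the closed forms are the largest proper submodule
(`formRep_zero_eq_top`), so the remaining factor is the head `L(0,-1)`. -/

namespace HamiltonianLie

noncomputable section

/-! ### The monomial basis of the truncated polynomial ring -/

section Monomials

variable (k : Type*) [Field k] (p : ℕ)

/-- The monomial `x^i y^j`. -/
def monom (i j : ℕ) : TruncPoly k p := coord k p 0 ^ i * coord k p 1 ^ j

variable {k p}

theorem monom_eq_zero_of_left_le {i : ℕ} (h : p ≤ i) (j : ℕ) : monom k p i j = 0 := by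
  rw [monom, ← Nat.add_sub_cancel' h, pow_add, coord_pow]
  simp

theorem monom_eq_zero_of_right_le (i : ℕ) {j : ℕ} (h : p ≤ j) : monom k p i j = 0 := by
  rw [monom, ← Nat.add_sub_cancel' h, pow_add, coord_pow]
  simp

theorem monom_mul_monom (i j i' j' : ℕ) :
    monom k p i j * monom k p i' j' = monom k p (i + i') (j + j') := by
  simp only [monom, pow_add]; ring

theorem monom_zero_zero : monom k p 0 0 = 1 := by simp [monom]

theorem monom_one_zero : monom k p 1 0 = coord k p 0 := by simp [monom]

theorem monom_zero_one : monom k p 0 1 = coord k p 1 := by simp [monom]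

theorem truncMk_monomial (m : Fin 2 →₀ ℕ) (c : k) :
    truncMk k p (MvPolynomial.monomial m c) = c • monom k p (m 0) (m 1) := by
  rw [MvPolynomial.monomial_eq, Finsupp.prod_fintype _ _ (by simp), map_mul,
    Fin.prod_univ_two, map_mul, map_pow, map_pow, ← MvPolynomial.algebraMap_eq, AlgHom.commutes,
    ← Algebra.smul_def]
  rfl

theorem span_monom : Submodule.span k
    (Set.range fun ij : Fin p × Fin p => monom k p ij.1 ij.2) = ⊤ := by
  rw [eq_top_iff]
  rintro f -
  obtain ⟨f, rfl⟩ := truncMk_surjective k p f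
  induction f using MvPolynomial.induction_on' with
  | monomial m c =>
    rw [truncMk_monomial]
    refine Submodule.smul_mem _ _ ?_
    by_cases h0 : m 0 < p
    · by_cases h1 : m 1 < p
      · exact Submodule.subset_span ⟨(⟨m 0, h0⟩, ⟨m 1, h1⟩), rfl⟩
      · rw [monom_eq_zero_of_right_le _ (by omega)]; exact zero_mem _
    · rw [monom_eq_zero_of_left_le (by omega)]; exact zero_mem _
  | add f g hf hg => rw [map_add]; exact add_mem hf hg

theorem coeff_eq_zero_of_mem_truncIdeal {f : MvPolynomial (Fin 2) k} (hf : f ∈ truncIdeal k p)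
    (m : Fin 2 →₀ ℕ) (hm : ∀ i, m i < p) : f.coeff m = 0 := by
  induction hf using Submodule.span_induction generalizing m with
  | mem f hf =>
    obtain ⟨i, rfl⟩ := hf
    dsimp only
    rw [MvPolynomial.coeff_X_pow, if_neg]
    rintro rfl
    simpa using hm i
  | zero => simp
  | add f g _ _ hf hg => rw [MvPolynomial.coeff_add, hf m hm, hg m hm, add_zero]
  | smul a f _ ih =>
    rw [smul_eq_mul, MvPolynomial.coeff_mul]
    refine Finset.sum_eq_zero fun x hx => ?_
    rw [ih x.2 fun i => lt_of_le_of_lt ?_ (hm i), mul_zero]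
    rw [← Finset.HasAntidiagonal.mem_antidiagonal.1 hx]
    simp

/-- A coefficient with both exponents below `p` vanishes on the ideal, so it descends to the
quotient. These functionals separate the monomials and give their linear independence. -/
theorem exists_coeff (i j : Fin p) : ∃ φ : TruncPoly k p →ₗ[k] k, ∀ i' j' : Fin p,
    φ (monom k p i' j') = if i' = i ∧ j' = j then 1 else 0 := by
  let m : Fin 2 →₀ ℕ := Finsupp.equivFunOnFinite.symm ![i, j]
  have hm : ∀ l, m l < p := by intro l; fin_cases l <;> simp [m]
  let π := (truncMk k p).toLinearMap
  have hπ : Function.Surjective π := truncMk_surjective k p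
  refine ⟨(LinearMap.ker π).liftQ (MvPolynomial.lcoeff k m) ?_ ∘ₗ
    (π.quotKerEquivOfSurjective hπ).symm, fun i' j' => ?_⟩
  · intro f hf
    exact coeff_eq_zero_of_mem_truncIdeal ((truncMk_eq_zero_iff k p f).1 hf) m hm
  · let m' : Fin 2 →₀ ℕ := Finsupp.equivFunOnFinite.symm ![i', j']
    have h : monom k p i' j' = π (MvPolynomial.monomial m' 1) := by
      refine Eq.trans ?_ (truncMk_monomial m' 1).symm
      simp [m']
    have h2 : (π.quotKerEquivOfSurjective hπ).symm (monom k p i' j') =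
        Submodule.Quotient.mk (MvPolynomial.monomial m' 1) := by
      rw [LinearEquiv.symm_apply_eq, h]; rfl
    rw [LinearMap.comp_apply, LinearEquiv.coe_coe, h2]
    refine (Submodule.liftQ_apply _ _ _).trans ?_
    rw [MvPolynomial.lcoeff_apply, MvPolynomial.coeff_monomial]
    congr 1
    simp [m, m', Fin.ext_iff]

theorem linearIndependent_monom :
    LinearIndependent k fun ij : Fin p × Fin p => monom k p ij.1 ij.2 := by
  rw [Fintype.linearIndependent_iff]
  intro g hg ij
  obtain ⟨φ, hφ⟩ := exists_coeff (k := k) ij.1 ij.2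
  have h := congrArg φ hg
  simpa [map_sum, hφ, ← Prod.ext_iff] using h

variable (k p)

/-- The basis of the monomials `x^i y^j` with `i, j < p`. -/
def monomBasis : Module.Basis (Fin p × Fin p) k (TruncPoly k p) :=
  Module.Basis.mk linearIndependent_monom span_monom.ge

variable {k p}

theorem monomBasis_apply (ij : Fin p × Fin p) : monomBasis k p ij = monom k p ij.1 ij.2 :=
  Module.Basis.mk_apply _ _ _

instance : FiniteDimensional k (TruncPoly k p) := (monomBasis k p).finiteDimensional_of_finite

theorem finrank_truncPoly : Module.finrank k (TruncPoly k p) = p ^ 2 := by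
  rw [Module.finrank_eq_card_basis (monomBasis k p)]
  simp [sq]

theorem monom_ne_zero {i j : ℕ} (hi : i < p) (hj : j < p) : monom k p i j ≠ 0 := by
  rw [← monomBasis_apply (⟨i, hi⟩, ⟨j, hj⟩)]
  exact (monomBasis k p).ne_zero _

/-- A submodule containing all monomials with exponents less than `p` is everything. -/
theorem eq_top_of_monom_mem {N : Submodule k (TruncPoly k p)}
    (h : ∀ i j, i < p → j < p → monom k p i j ∈ N) : N = ⊤ := by
  rw [eq_top_iff, ← span_monom, Submodule.span_le]
  rintro _ ⟨ij, rfl⟩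
  exact h _ _ ij.1.2 ij.2.2

/-! ### Partial derivatives -/

variable [CharP k p]

theorem del_pow_coord (i : Fin 2) (n : ℕ) :
    del k p i (coord k p i ^ n) = (n : k) • coord k p i ^ (n - 1) := by
  rw [Derivation.leibniz_pow, del_coord, if_pos rfl, smul_eq_mul, mul_one,
    ← Nat.cast_smul_eq_nsmul k]

theorem del_pow_coord_of_ne {i j : Fin 2} (h : i ≠ j) (n : ℕ) :
    del k p i (coord k p j ^ n) = 0 := by
  rw [Derivation.leibniz_pow, del_coord, if_neg h, smul_zero, smul_zero]

theorem del_zero_monom (i j : ℕ) : del k p 0 (monom k p i j) = (i : k) • monom k p (i - 1) j := by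
  rw [monom, Derivation.leibniz, del_pow_coord, del_pow_coord_of_ne (by decide), smul_zero,
    zero_add, smul_eq_mul, monom, mul_smul_comm, mul_comm]

theorem del_one_monom (i j : ℕ) : del k p 1 (monom k p i j) = (j : k) • monom k p i (j - 1) := by
  rw [monom, Derivation.leibniz, del_pow_coord, del_pow_coord_of_ne (by decide), smul_zero,
    add_zero, smul_eq_mul, monom, mul_smul_comm]

theorem del_one_del_zero (f : TruncPoly k p) :
    del k p 1 (del k p 0 f) = del k p 0 (del k p 1 f) := by
  have h : ⁅del k p 1, del k p 0⁆ = 0 := by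
    refine witt_ext k p fun i => ?_
    rw [Derivation.commutator_apply, del_coord, del_coord]
    fin_cases i <;> simp
  have h2 := congrArg (fun D : Witt k p => D f) h
  rwa [Derivation.commutator_apply, Derivation.zero_apply, sub_eq_zero] at h2

theorem witt_eq (D : Witt k p) :
    D = D (coord k p 0) • del k p 0 + D (coord k p 1) • del k p 1 := by
  refine witt_ext k p fun i => ?_
  rw [Derivation.add_apply, Derivation.smul_apply, Derivation.smul_apply, del_coord, del_coord]
  fin_cases i <;> simp

end Monomials

/-! ### Modules over the restricted enveloping algebra -/

section Env

variable {k : Type*} [Field k] {p : ℕ} [CharP k p] [Fact p.Prime]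

/-- The restricted enveloping algebra is generated by `Ĥ`. -/
theorem eq_top_of_envι_mem (S : Subalgebra k (RestrictedEnv k p))
    (h : ∀ D : hamHat k p, envι k p D ∈ S) : S = ⊤ := by
  rw [eq_top_iff]
  rintro u -
  obtain ⟨u, rfl⟩ := RingQuot.mkAlgHom_surjective k (RestrictedRel (hamHat k p)) u
  let _ : LieRing S := LieRing.ofAssociativeRing
  let f : hamHat k p →ₗ⁅k⁆ S :=
    { toFun := fun D => ⟨envι k p D, h D⟩
      map_add' := fun D E => Subtype.ext (by simp [envι])
      map_smul' := fun c D => Subtype.ext (by simp [envι])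
      map_lie' := fun {D E} => Subtype.ext (by
        simp only [envι, LieHom.map_lie]
        let _ : LieRing (UniversalEnvelopingAlgebra k (hamHat k p)) := LieRing.ofAssociativeRing
        rw [LieRing.of_associative_ring_bracket, LieRing.of_associative_ring_bracket]
        simp) }
  -- By the universal property the quotient map from the enveloping algebra factors through `S`;
  -- being surjective, it forces `S` to be everything.
  have hf : (S.val.comp (UniversalEnvelopingAlgebra.lift k f)) =
      RingQuot.mkAlgHom k (RestrictedRel (hamHat k p)) := by
    let _ : LieRing (RestrictedEnv k p) := LieRing.ofAssociativeRing
    refine UniversalEnvelopingAlgebra.hom_ext (R := k) (L := hamHat k p) (A := RestrictedEnv k p) ?_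
    refine LieHom.ext fun D => ?_
    simp [f, envι]
  rw [← hf]
  exact Subtype.property _

section Modules

variable {X : Type*} [AddCommGroup X] [Module k X] [Module (RestrictedEnv k p) X]
  [IsScalarTower k (RestrictedEnv k p) X]
  {Y : Type*} [AddCommGroup Y] [Module k Y] [Module (RestrictedEnv k p) Y]
  [IsScalarTower k (RestrictedEnv k p) Y]

theorem smul_mem_of_envι_smul_mem {P : Submodule k X}
    (h : ∀ D : hamHat k p, ∀ v ∈ P, envι k p D • v ∈ P) (u : RestrictedEnv k p) {v : X}
    (hv : v ∈ P) : u • v ∈ P := by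
  let S : Subalgebra k (RestrictedEnv k p) :=
    { carrier := {u | ∀ v ∈ P, u • v ∈ P}
      mul_mem' := fun {a b} ha hb v hv => by rw [mul_smul]; exact ha _ (hb _ hv)
      add_mem' := fun {a b} ha hb v hv => by rw [add_smul]; exact add_mem (ha _ hv) (hb _ hv)
      algebraMap_mem' := fun c v hv => by rw [algebraMap_smul]; exact P.smul_mem _ hv }
  have hu : u ∈ S := by rw [eq_top_of_envι_mem S h]; trivial
  exact hu v hv

/-- A subspace that is stable under `Ĥ` is a submodule. -/
def submoduleOfStable (P : Submodule k X)
    (h : ∀ D : hamHat k p, ∀ v ∈ P, envι k p D • v ∈ P) :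
    Submodule (RestrictedEnv k p) X where
  __ := P
  smul_mem' u _ hv := smul_mem_of_envι_smul_mem h u hv

/-- A linear map that commutes with `Ĥ` is a homomorphism of modules. -/
def linearMapOfCommute (f : X →ₗ[k] Y)
    (h : ∀ (D : hamHat k p) (v : X), f (envι k p D • v) = envι k p D • f v) :
    X →ₗ[RestrictedEnv k p] Y where
  __ := f
  map_smul' u v := by
    let S : Subalgebra k (RestrictedEnv k p) :=
      { carrier := {u | ∀ v, f (u • v) = u • f v}
        mul_mem' := fun {a b} ha hb v => by rw [mul_smul, mul_smul, ha, hb]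
        add_mem' := fun {a b} ha hb v => by rw [add_smul, add_smul, map_add, ha, hb]
        algebraMap_mem' := fun c v => by rw [algebraMap_smul, algebraMap_smul, map_smul] }
    have hu : u ∈ S := by rw [eq_top_of_envι_mem S h]; trivial
    exact hu v

end Modules

theorem envι_add (D E : hamHat k p) : envι k p (D + E) = envι k p D + envι k p E := by
  simp [envι]

theorem envι_smul (c : k) (D : hamHat k p) : envι k p (c • D) = c • envι k p D := by
  simp [envι]

theorem envι_lie (D E : hamHat k p) :
    envι k p ⁅D, E⁆ = envι k p D * envι k p E - envι k p E * envι k p D := by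
  let _ : LieRing (UniversalEnvelopingAlgebra k (hamHat k p)) := LieRing.ofAssociativeRing
  simp only [envι, LieHom.map_lie]
  rw [LieRing.of_associative_ring_bracket]
  simp

theorem envι_pow (D E : hamHat k p) (h : (E : Witt k p) = pMap (D : Witt k p)) :
    envι k p D ^ p = envι k p E := by
  rw [envι, envι, ← map_pow]
  exact RingQuot.mkAlgHom_rel k (RestrictedRel.pow_eq D E h)

/-! ### Restricted representations of the Witt algebra -/

variable (k p)

/-- A restricted representation of `W(2;(1,1))` on a vector space. -/
structure RestrictedRep (V : Type*) [AddCommGroup V] [Module k V] where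
  act : Witt k p →ₗ[k] Module.End k V
  act_lie : ∀ D E, act ⁅D, E⁆ = act D * act E - act E * act D
  act_pMap : ∀ D, act (pMap D) = act D ^ p

namespace RestrictedRep

variable {k p} {V : Type*} [AddCommGroup V] [Module k V]

/-- The space of a representation, as a module over the restricted enveloping algebra of `Ĥ`. -/
def Space (_ρ : RestrictedRep k p V) : Type _ := V

variable (ρ : RestrictedRep k p V)

instance : AddCommGroup ρ.Space := inferInstanceAs (AddCommGroup V)

instance : Module k ρ.Space := inferInstanceAs (Module k V)

instance [FiniteDimensional k V] : FiniteDimensional k ρ.Space :=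
  inferInstanceAs (FiniteDimensional k V)

/-- The homomorphism from the restricted enveloping algebra of `Ĥ` given by a representation. -/
def envHom : RestrictedEnv k p →ₐ[k] Module.End k ρ.Space :=
  letI : LieRing (Module.End k ρ.Space) := LieRing.ofAssociativeRing
  let f : hamHat k p →ₗ⁅k⁆ Module.End k ρ.Space :=
    { toFun := fun D => ρ.act D
      map_add' := fun D E => map_add ρ.act _ _
      map_smul' := fun c D => map_smul ρ.act _ _
      map_lie' := fun {D E} => ρ.act_lie D E }
  RingQuot.liftAlgHom k ⟨UniversalEnvelopingAlgebra.lift k f, fun a b hab => by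
    obtain ⟨D, E, h⟩ := hab
    rw [map_pow, UniversalEnvelopingAlgebra.lift_ι_apply, UniversalEnvelopingAlgebra.lift_ι_apply]
    change ρ.act D ^ p = ρ.act E
    rw [h, ρ.act_pMap]⟩

instance : Module (RestrictedEnv k p) ρ.Space := Module.compHom ρ.Space (envHom ρ).toRingHom

theorem smul_def (u : RestrictedEnv k p) (v : ρ.Space) : u • v = envHom ρ u v := rfl

instance : IsScalarTower k (RestrictedEnv k p) ρ.Space where
  smul_assoc c u v := by rw [smul_def, map_smul]; rfl

theorem envι_smul_eq (D : hamHat k p) (v : ρ.Space) : envι k p D • v = ρ.act D v := by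
  rw [smul_def, envι, envHom, RingQuot.liftAlgHom_mkAlgHom_apply,
    UniversalEnvelopingAlgebra.lift_ι_apply]
  rfl

theorem act_mem (N : Submodule (RestrictedEnv k p) ρ.Space) {D : Witt k p} (hD : D ∈ hamHat k p)
    {v : ρ.Space} (hv : v ∈ N) : (ρ.act D v : ρ.Space) ∈ N := by
  have h := N.smul_mem (envι k p ⟨D, hD⟩) hv
  rwa [envι_smul_eq] at h

end RestrictedRep

end Env

/-! ### Twisted functions and differential forms -/

section Forms

/-- On `U ⊗ V` the operators `A ⊗ 1` and `1 ⊗ B` commute, so the `p`-th power of their sum is the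
sum of their `p`-th powers, and the pairing `m` carries this sum to `C`. This is the device by which
restrictedness passes from two factors to a product. -/
theorem pow_char_of_leibniz {k : Type*} [Field k] (p : ℕ) [Fact p.Prime] [CharP k p]
    {U V W : Type*} [AddCommGroup U] [Module k U] [AddCommGroup V] [Module k V]
    [AddCommGroup W] [Module k W] (m : U →ₗ[k] V →ₗ[k] W) (A : Module.End k U)
    (B : Module.End k V) (C : Module.End k W)
    (h : ∀ u v, C (m u v) = m (A u) v + m u (B v)) (u : U) (v : V) :
    (C ^ p) (m u v) = m ((A ^ p) u) v + m u ((B ^ p) v) := by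
  let T : Module.End k (U ⊗[k] V) := LinearMap.rTensor V A + LinearMap.lTensor U B
  have hT : ∀ n : ℕ, ∀ t, TensorProduct.lift m ((T ^ n) t) = (C ^ n) (TensorProduct.lift m t) := by
    intro n
    induction n with
    | zero => simp
    | succ n ih =>
      intro t
      rw [pow_succ, pow_succ, Module.End.mul_apply, Module.End.mul_apply, ih]
      congr 1
      induction t with
      | zero => simp
      | add a b ha hb => rw [map_add, map_add, ha, hb, map_add, map_add]
      | tmul a b => simp [T, h]
  have hc : Commute (LinearMap.rTensor V A : Module.End k (U ⊗[k] V))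
      (LinearMap.lTensor U B) := by
    refine LinearMap.ext fun t => ?_
    induction t with
    | zero => simp
    | add a b ha hb => rw [map_add, ha, hb, map_add]
    | tmul a b => simp
  obtain ⟨r, hr⟩ := hc.exists_add_pow_prime_eq (Fact.out : p.Prime)
  have hp : ((p : ℕ) : Module.End k (U ⊗[k] V)) = 0 := by
    rw [← map_natCast (algebraMap k (Module.End k (U ⊗[k] V))), CharP.cast_eq_zero, map_zero]
  have h2 := hT p (u ⊗ₜ v)
  rw [show T ^ p = _ from hr, hp, TensorProduct.lift.tmul] at h2
  rw [← h2, LinearMap.rTensor_pow, LinearMap.lTensor_pow]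
  simp

variable {k : Type*} [Field k] {p : ℕ} [CharP k p]

/-- The divergence of a derivation. -/
def divg : Witt k p →ₗ[k] TruncPoly k p where
  toFun D := del k p 0 (D (coord k p 0)) + del k p 1 (D (coord k p 1))
  map_add' D E := by simp only [Derivation.add_apply, map_add]; ring
  map_smul' c D := by simp only [Derivation.smul_apply, Derivation.map_smul, smul_add, RingHom.id_apply]

theorem divg_apply (D : Witt k p) :
    divg D = del k p 0 (D (coord k p 0)) + del k p 1 (D (coord k p 1)) := rfl

/-- The vector field with given coefficients. -/
def vf (f g : TruncPoly k p) : Witt k p := f • del k p 0 + g • del k p 1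

theorem vf_apply (f g h : TruncPoly k p) :
    vf f g h = f * del k p 0 h + g * del k p 1 h := rfl

theorem vf_coord_zero (f g : TruncPoly k p) : vf f g (coord k p 0) = f := by
  simp [vf_apply, del_coord]

theorem vf_coord_one (f g : TruncPoly k p) : vf f g (coord k p 1) = g := by
  simp [vf_apply, del_coord]

theorem eq_vf (D : Witt k p) : D = vf (D (coord k p 0)) (D (coord k p 1)) := witt_eq D

theorem divg_vf (f g : TruncPoly k p) : divg (vf f g) = del k p 0 f + del k p 1 g := by
  rw [divg_apply, vf_coord_zero, vf_coord_one]

/-- The action of derivations on functions twisted by the `c`-th power of the divergence. -/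
def funAct (c : k) : Witt k p →ₗ[k] Module.End k (TruncPoly k p) where
  toFun D := D.toLinearMap + c • LinearMap.mulLeft k (divg D)
  map_add' D E := by
    ext h
    simp only [LinearMap.add_apply, LinearMap.smul_apply, LinearMap.mulLeft_apply, map_add,
      Derivation.coeFn_coe, Derivation.add_apply, add_mul, smul_add]
    ring
  map_smul' a D := by
    ext h
    simp only [LinearMap.add_apply, LinearMap.smul_apply, LinearMap.mulLeft_apply, map_smul,
      Derivation.coeFn_coe, Derivation.smul_apply, smul_add, smul_mul_assoc, RingHom.id_apply,
      smul_comm c a]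

theorem funAct_apply (c : k) (D : Witt k p) (h : TruncPoly k p) :
    funAct c D h = D h + c • (divg D * h) := rfl

/-- The action of derivations on differential forms `u dx + v dy`, twisted by the `c`-th power of
the divergence. -/
def formAct (c : k) : Witt k p →ₗ[k] Module.End k (TruncPoly k p × TruncPoly k p) where
  toFun D :=
    { toFun := fun w =>
        (D w.1 + del k p 0 (D (coord k p 0)) * w.1 + del k p 0 (D (coord k p 1)) * w.2
            + c • (divg D * w.1),
          D w.2 + del k p 1 (D (coord k p 0)) * w.1 + del k p 1 (D (coord k p 1)) * w.2
            + c • (divg D * w.2))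
      map_add' := fun w w' => by
        ext <;> simp only [Prod.fst_add, Prod.snd_add, map_add, mul_add, smul_add] <;> ring
      map_smul' := fun a w => by
        ext <;> simp only [Prod.smul_fst, Prod.smul_snd, Derivation.map_smul, mul_smul_comm, smul_add,
          RingHom.id_apply, smul_comm c a] }
  map_add' D E := by
    refine LinearMap.ext fun w => ?_
    ext <;> simp only [Derivation.add_apply, map_add, add_mul, smul_add, LinearMap.coe_mk,
      AddHom.coe_mk, LinearMap.add_apply, Prod.fst_add, Prod.snd_add] <;> ring
  map_smul' a D := by
    refine LinearMap.ext fun w => ?_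
    ext <;> simp only [Derivation.smul_apply, map_smul, Derivation.map_smul, smul_mul_assoc, smul_add, LinearMap.coe_mk,
      AddHom.coe_mk, LinearMap.smul_apply, Prod.smul_fst, Prod.smul_snd, RingHom.id_apply,
      smul_comm c a]

theorem formAct_apply (c : k) (D : Witt k p) (u v : TruncPoly k p) :
    formAct c D (u, v) =
      (D u + del k p 0 (D (coord k p 0)) * u + del k p 0 (D (coord k p 1)) * v
        + c • (divg D * u),
       D v + del k p 1 (D (coord k p 0)) * u + del k p 1 (D (coord k p 1)) * v
        + c • (divg D * v)) := rfl

theorem vf_lie (f g f' g' : TruncPoly k p) :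
    ⁅vf f g, vf f' g'⁆ = vf (vf f g f' - vf f' g' f) (vf f g g' - vf f' g' g) := by
  refine witt_ext k p fun i => ?_
  rw [Derivation.commutator_apply]
  fin_cases i
  · exact (congrArg₂ _ (congrArg _ (vf_coord_zero _ _)) (congrArg _ (vf_coord_zero _ _))).trans
      (vf_coord_zero _ _).symm
  · exact (congrArg₂ _ (congrArg _ (vf_coord_one _ _)) (congrArg _ (vf_coord_one _ _))).trans
      (vf_coord_one _ _).symm

theorem funAct_vf (c : k) (f g h : TruncPoly k p) :
    funAct c (vf f g) h = f * del k p 0 h + g * del k p 1 h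
      + algebraMap k _ c * ((del k p 0 f + del k p 1 g) * h) := by
  rw [funAct_apply, divg_vf, vf_apply, Algebra.smul_def]

theorem formAct_vf (c : k) (f g u v : TruncPoly k p) :
    formAct c (vf f g) (u, v) =
      (f * del k p 0 u + g * del k p 1 u + del k p 0 f * u + del k p 0 g * v
        + algebraMap k _ c * ((del k p 0 f + del k p 1 g) * u),
       f * del k p 0 v + g * del k p 1 v + del k p 1 f * u + del k p 1 g * v
        + algebraMap k _ c * ((del k p 0 f + del k p 1 g) * v)) := by
  rw [formAct_apply, divg_vf, vf_coord_zero, vf_coord_one, vf_apply, vf_apply, Algebra.smul_def,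
    Algebra.smul_def]

theorem funAct_lie (c : k) (D E : Witt k p) :
    funAct c ⁅D, E⁆ = funAct c D * funAct c E - funAct c E * funAct c D := by
  rw [eq_vf D, eq_vf E]
  generalize D (coord k p 0) = f, D (coord k p 1) = g, E (coord k p 0) = f',
    E (coord k p 1) = g'
  ext1 h
  rw [vf_lie, LinearMap.sub_apply, Module.End.mul_apply, Module.End.mul_apply]
  simp only [funAct_vf, vf_apply, map_add, map_sub, Derivation.leibniz, smul_eq_mul,
    Derivation.map_algebraMap, del_one_del_zero]
  ring

theorem formAct_lie (c : k) (D E : Witt k p) :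
    formAct c ⁅D, E⁆ = formAct c D * formAct c E - formAct c E * formAct c D := by
  rw [eq_vf D, eq_vf E]
  generalize D (coord k p 0) = f, D (coord k p 1) = g, E (coord k p 0) = f',
    E (coord k p 1) = g'
  refine LinearMap.ext fun ⟨u, v⟩ => ?_
  rw [vf_lie, LinearMap.sub_apply, Module.End.mul_apply, Module.End.mul_apply]
  simp only [formAct_vf, vf_apply, map_add, map_sub, Derivation.leibniz, smul_eq_mul,
    Derivation.map_algebraMap, del_one_del_zero, Prod.mk_sub_mk, Prod.mk.injEq]
  constructor <;> ring

/-- The differential of functions twisted by `c`, with the closed form `c θ dx` subtracted. -/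
def diffFun (θ : TruncPoly k p) :
    TruncPoly k p →ₗ[k] TruncPoly k p × TruncPoly k p :=
  LinearMap.prod ((del k p 0).toLinearMap - LinearMap.mulLeft k θ) (del k p 1).toLinearMap

theorem diffFun_apply (θ h : TruncPoly k p) :
    diffFun θ h = (del k p 0 h - θ * h, del k p 1 h) := rfl

/-- The differential of forms `u dx + v dy`, with the wedge product with `θ dx` subtracted. -/
def diffForm (θ : TruncPoly k p) :
    TruncPoly k p × TruncPoly k p →ₗ[k] TruncPoly k p :=
  LinearMap.coprod (-(del k p 1).toLinearMap)
    ((del k p 0).toLinearMap - LinearMap.mulLeft k θ)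

theorem diffForm_apply (θ u v : TruncPoly k p) :
    diffForm θ (u, v) = del k p 0 v - θ * v - del k p 1 u := by
  change -(del k p 1 u) + (del k p 0 v - θ * v) = _
  ring

/-- The hypothesis says that `θ dx` is closed, and then `d - θ dx ∧` squares to zero. -/
theorem diffForm_diffFun {θ : TruncPoly k p} (hθ : del k p 1 θ = 0) (h : TruncPoly k p) :
    diffForm θ (diffFun θ h) = 0 := by
  rw [diffFun_apply, diffForm_apply, map_sub, Derivation.leibniz, hθ, del_one_del_zero]
  simp only [smul_eq_mul]
  ring

theorem funAct_zero (D : Witt k p) : funAct (0 : k) D = D.toLinearMap := by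
  ext h
  rw [funAct_apply, zero_smul, add_zero]
  rfl

/-- Twists add under multiplication. With `pow_char_of_leibniz` this reduces restrictedness for an
integral twist to the twists `0` and `1`. -/
theorem funAct_add_mul (c c' : k) (D : Witt k p) (g h : TruncPoly k p) :
    funAct (c + c') D (g * h) = funAct c D g * h + g * funAct c' D h := by
  simp only [funAct_apply, Derivation.leibniz, add_smul, Algebra.smul_def c, Algebra.smul_def c',
    smul_eq_mul]
  ring

theorem formAct_add_smul (c c' : k) (D : Witt k p) (h : TruncPoly k p)
    (w : TruncPoly k p × TruncPoly k p) :
    formAct (c + c') D (h • w) = funAct c D h • w + h • formAct c' D w := by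
  obtain ⟨u, v⟩ := w
  simp only [formAct_apply, funAct_apply, Prod.smul_mk, smul_eq_mul, Prod.mk_add_mk,
    Derivation.leibniz, add_smul c c', Algebra.smul_def c, Algebra.smul_def c', Prod.mk.injEq]
  constructor <;> ring

theorem formAct_diffFun_zero (D : Witt k p) (h : TruncPoly k p) :
    formAct (0 : k) D (diffFun 0 h) = diffFun 0 (D h) := by
  rw [eq_vf D]
  simp only [diffFun_apply, formAct_vf, vf_apply, Derivation.leibniz, map_add, del_one_del_zero,
    map_zero, smul_eq_mul, zero_mul, sub_zero, add_zero, Prod.mk_add_mk, Prod.mk.injEq]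
  constructor <;> ring

/-- The wedge product of differential forms. -/
def wedge : TruncPoly k p × TruncPoly k p →ₗ[k]
    TruncPoly k p × TruncPoly k p →ₗ[k] TruncPoly k p :=
  LinearMap.mk₂ k (fun w w' => w.1 * w'.2 - w.2 * w'.1)
    (fun a b c => by simp only [Prod.fst_add, Prod.snd_add]; ring)
    (fun a b c => by simp only [Prod.smul_fst, Prod.smul_snd, smul_mul_assoc, smul_sub])
    (fun a b c => by simp only [Prod.fst_add, Prod.snd_add]; ring)
    (fun a b c => by simp only [Prod.smul_fst, Prod.smul_snd, mul_smul_comm, smul_sub])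

/-- A function of twist one is the coefficient of a two-form, since `D` multiplies `dx ∧ dy` by its
divergence. Restrictedness of twist one thus follows from that of one-forms, without a formula for
the divergence of `D^p`. -/
theorem funAct_wedge (D : Witt k p) (w w' : TruncPoly k p × TruncPoly k p) :
    funAct (1 : k) D (wedge w w') =
      wedge (formAct (0 : k) D w) w' + wedge w (formAct (0 : k) D w') := by
  obtain ⟨u, v⟩ := w
  obtain ⟨u', v'⟩ := w'
  rw [eq_vf D]
  simp only [wedge, LinearMap.mk₂_apply, formAct_vf, funAct_vf, map_sub, Derivation.leibniz,
    map_zero, map_one, smul_eq_mul]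
  ring

variable [Fact p.Prime]

/-- One-forms are sums of products `h dg`. The Lie derivative commutes with `d`, which settles `dg`,
and the product rule in characteristic `p` brings in the factor `h`. -/
theorem formAct_zero_pMap (D : Witt k p) : formAct (0 : k) (pMap D) = formAct (0 : k) D ^ p := by
  have hd (n : ℕ) (h : TruncPoly k p) :
      (formAct (0 : k) D ^ n) (diffFun 0 h) = diffFun 0 ((D.toLinearMap ^ n) h) := by
    induction n with
    | zero => rfl
    | succ n ih =>
      rw [pow_succ', pow_succ', Module.End.mul_apply, Module.End.mul_apply, ih,
        formAct_diffFun_zero]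
      rfl
  have hw (h g : TruncPoly k p) : formAct (0 : k) (pMap D) (h • diffFun 0 g) =
      (formAct (0 : k) D ^ p) (h • diffFun 0 g) := by
    have h1 := pow_char_of_leibniz p
      (Algebra.lsmul k k (TruncPoly k p × TruncPoly k p)).toLinearMap D.toLinearMap
      (formAct (0 : k) D) (formAct (0 : k) D) (fun u v => by
        have := formAct_add_smul 0 0 D u v
        rwa [add_zero, funAct_zero] at this) h (diffFun 0 g)
    refine Eq.trans ?_ h1.symm
    have h2 := formAct_add_smul 0 0 (pMap D) h (diffFun 0 g)
    rw [add_zero, funAct_zero, formAct_diffFun_zero] at h2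
    rw [hd]
    exact h2
  refine LinearMap.ext fun ⟨u, v⟩ => ?_
  have huv : (u, v) = u • diffFun (0 : TruncPoly k p) (coord k p 0) +
      v • diffFun (0 : TruncPoly k p) (coord k p 1) := by
    simp [diffFun_apply, del_coord]
  rw [huv, map_add, map_add, hw, hw]

theorem funAct_one_pMap (D : Witt k p) : funAct (1 : k) (pMap D) = funAct (1 : k) D ^ p := by
  ext h
  have hh : h = wedge (h, 0) (0, 1) := by simp [wedge]
  rw [hh, funAct_wedge, pow_char_of_leibniz p wedge _ _ _ (funAct_wedge D), formAct_zero_pMap]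

theorem funAct_pMap (n : ℕ) (D : Witt k p) : funAct (n : k) (pMap D) = funAct (n : k) D ^ p := by
  induction n with
  | zero => rw [Nat.cast_zero, funAct_zero, funAct_zero]; rfl
  | succ n ih =>
    ext h
    rw [← one_mul h, Nat.cast_succ, funAct_add_mul]
    refine Eq.trans ?_ (pow_char_of_leibniz p (LinearMap.mul k (TruncPoly k p)) _ _ _
      (funAct_add_mul (n : k) 1 D) 1 h).symm
    rw [ih, funAct_one_pMap]
    rfl

theorem formAct_pMap (n : ℕ) (D : Witt k p) :
    formAct (n : k) (pMap D) = formAct (n : k) D ^ p := by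
  refine LinearMap.ext fun w => ?_
  rw [← one_smul (TruncPoly k p) w, ← add_zero (n : k), formAct_add_smul]
  refine Eq.trans ?_ (pow_char_of_leibniz p
    (Algebra.lsmul k k (TruncPoly k p × TruncPoly k p)).toLinearMap _ _ _
    (formAct_add_smul (n : k) 0 D) (1 : TruncPoly k p) w).symm
  rw [funAct_pMap, formAct_zero_pMap]
  rfl

variable (k p) in
/-- Functions twisted by the `c`-th power of the divergence. -/
def funRep (c : ZMod p) : RestrictedRep k p (TruncPoly k p) where
  act := funAct (ZMod.castHom (dvd_refl p) k c)
  act_lie := funAct_lie _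
  act_pMap D := by
    -- A twist in the prime field is represented by a natural number, which makes the induction on
    -- the twist in `funAct_pMap` available.
    obtain ⟨n, rfl⟩ := ZMod.natCast_zmod_surjective c
    rw [map_natCast]
    exact funAct_pMap n D

variable (k p) in
/-- Differential forms twisted by the `c`-th power of the divergence. -/
def formRep (c : ZMod p) : RestrictedRep k p (TruncPoly k p × TruncPoly k p) where
  act := formAct (ZMod.castHom (dvd_refl p) k c)
  act_lie := formAct_lie _
  act_pMap D := by
    obtain ⟨n, rfl⟩ := ZMod.natCast_zmod_surjective c
    rw [map_natCast]
    exact formAct_pMap n D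

end Forms

/-! ### The generators of `Ĥ` and the twisted de Rham complex -/

section Equivariance

variable {k : Type*} [Field k] {p : ℕ} [CharP k p]

theorem del_one_pow_coord_zero (n : ℕ) : del k p 1 (coord k p 0 ^ n) = 0 :=
  del_pow_coord_of_ne (by decide) n

theorem del_dpow_of_ne {i j : Fin 2} (h : i ≠ j) (n : ℤ) : del k p i (dpow (coord k p j) n) = 0 := by
  cases n with
  | ofNat n =>
    rw [Int.ofNat_eq_natCast, dpow_natCast, Derivation.map_smul, del_pow_coord_of_ne h, smul_zero]
  | negSucc n => exact map_zero _

theorem natCast_ne_zero_of_lt {n : ℕ} (h0 : n ≠ 0) (h : n < p) : (n : k) ≠ 0 := by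
  rw [Ne, CharP.cast_eq_zero_iff k p]
  exact Nat.not_dvd_of_pos_of_lt (Nat.pos_of_ne_zero h0) h

variable [Fact p.Prime]

theorem factorial_ne_zero_of_lt {n : ℕ} (h : n < p) : (n.factorial : k) ≠ 0 := by
  rw [Ne, CharP.cast_eq_zero_iff k p, (Fact.out : p.Prime).dvd_factorial]
  omega

omit [Fact p.Prime] in
theorem del_dpow (i : Fin 2) {n : ℕ} (h : n < p) :
    del k p i (dpow (coord k p i) n) = dpow (coord k p i) (n - 1) := by
  cases n with
  | zero =>
    rw [Nat.cast_zero, dpow_zero]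
    exact Derivation.map_one_eq_zero _
  | succ n =>
    rw [dpow_natCast, Derivation.map_smul, del_pow_coord, smul_smul, 
      show ((n + 1 : ℕ) : ℤ) - 1 = n by omega, dpow_natCast, Nat.factorial_succ, Nat.add_sub_cancel]
    have := natCast_ne_zero_of_lt (k := k) (Nat.succ_ne_zero n) h
    congr 1
    push_cast at this ⊢
    rw [mul_inv, mul_comm, ← mul_assoc, mul_inv_cancel₀ this, one_mul]

/-- Wilson's theorem. It turns the minus sign in the definition of `hamA` into a plus sign. -/
theorem dpow_pred (i : Fin 2) : dpow (coord k p i) (p - 1) = -coord k p i ^ (p - 1) := by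
  have hp := (Fact.out : p.Prime).one_le
  have h : ((p : ℤ) - 1) = ((p - 1 : ℕ) : ℤ) := by omega
  have hw := congrArg (ZMod.castHom (dvd_refl p) k) (ZMod.wilsons_lemma p)
  rw [map_natCast, map_neg, map_one] at hw
  rw [h, dpow_natCast, hw, inv_neg, inv_one, neg_smul, one_smul]

theorem hamA_eq (j : ℕ) : hamA k p j =
    vf (dpow (coord k p 1) (j - 1)) (coord k p 0 ^ (p - 1) * dpow (coord k p 1) j) := by
  rw [hamA, mono_zero_left, mono, dpow_pred, neg_mul, vf, sub_eq_add_neg]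
  congr 1
  exact (congrArg _ (neg_smul _ _)).trans (neg_neg _)

omit [Fact p.Prime] in
theorem hamB_eq (i j : ℕ) : hamB k p i j =
    vf (-(dpow (coord k p 0) i * dpow (coord k p 1) (j - 1)))
      (dpow (coord k p 0) (i - 1) * dpow (coord k p 1) j) := by
  rw [hamB, mono, mono, vf, sub_eq_add_neg, add_comm]
  congr 1
  exact (neg_smul _ _).symm

/-- To check a property for `Ĥ`, it suffices to check that it holds for `H` and is stable. -/
theorem hamHat_le {S : LieSubalgebra k (Witt k p)}
    (hA : ∀ j, j ≤ p - 1 → hamA k p j ∈ S)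
    (hB : ∀ i j, 1 ≤ i → i ≤ p - 1 → j ≤ p - 1 → hamB k p i j ∈ S)
    (hS : ∀ D ∈ S, pMap D ∈ S) : hamHat k p ≤ S := by
  refine sInf_le ⟨?_, hS⟩
  rw [ham, LieSubalgebra.lieSpan_le]
  rintro D (⟨j, hj, rfl⟩ | ⟨i, j, hi, hi', hj, rfl⟩)
  · exact hA j hj
  · exact hB i j hi hi' hj

namespace RestrictedRep

variable {V V' : Type*} [AddCommGroup V] [Module k V] [AddCommGroup V'] [Module k V']

/-- A linear map that commutes with the generators of `H` commutes with `Ĥ`. -/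
def homOfCommute (ρ : RestrictedRep k p V) (ρ' : RestrictedRep k p V') (f : V →ₗ[k] V')
    (hA : ∀ j, j ≤ p - 1 → ∀ v, f (ρ.act (hamA k p j) v) = ρ'.act (hamA k p j) (f v))
    (hB : ∀ i j, 1 ≤ i → i ≤ p - 1 → j ≤ p - 1 →
      ∀ v, f (ρ.act (hamB k p i j) v) = ρ'.act (hamB k p i j) (f v)) :
    ρ.Space →ₗ[RestrictedEnv k p] ρ'.Space :=
  linearMapOfCommute (show ρ.Space →ₗ[k] ρ'.Space from f) fun D v => by
    -- The derivations intertwined by `f` form a Lie subalgebra. It is closed under the `p`-map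
    -- because both representations are restricted, so it contains `Ĥ` as soon as it contains the
    -- generators of `H`.
    let S : LieSubalgebra k (Witt k p) :=
      { carrier := {D | f ∘ₗ ρ.act D = ρ'.act D ∘ₗ f}
        zero_mem' := by simp
        add_mem' := fun {D E} hD hE => by
          rw [Set.mem_ofPred_eq] at hD hE ⊢
          rw [map_add, map_add, LinearMap.comp_add, LinearMap.add_comp, hD, hE]
        smul_mem' := fun c D hD => by
          rw [Set.mem_ofPred_eq] at hD ⊢
          rw [map_smul, map_smul, LinearMap.comp_smul, LinearMap.smul_comp, hD]
        lie_mem' := fun {D E} hD hE => by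
          refine LinearMap.ext fun v => ?_
          have hD' := LinearMap.congr_fun (show _ = _ from hD)
          have hE' := LinearMap.congr_fun (show _ = _ from hE)
          simp only [LinearMap.comp_apply] at hD' hE'
          simp only [act_lie, LinearMap.comp_apply, LinearMap.sub_apply, Module.End.mul_apply,
            map_sub, hD', hE'] }
    have hS : hamHat k p ≤ S := by
      refine hamHat_le (fun j hj => LinearMap.ext (hA j hj))
        (fun i j hi hi' hj => LinearMap.ext (hB i j hi hi' hj)) fun D hD => ?_
      have hn (n : ℕ) : f ∘ₗ (ρ.act D ^ n) = (ρ'.act D ^ n) ∘ₗ f := by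
        induction n with
        | zero => rfl
        | succ n ih =>
          rw [pow_succ, pow_succ', Module.End.mul_eq_comp, Module.End.mul_eq_comp,
            ← LinearMap.comp_assoc, ih, LinearMap.comp_assoc, show f ∘ₗ ρ.act D = _ from hD,
            ← LinearMap.comp_assoc, ← Module.End.mul_eq_comp, ← Module.End.mul_eq_comp, ← pow_succ,
            pow_succ']
      change f ∘ₗ ρ.act (pMap D) = ρ'.act (pMap D) ∘ₗ f
      rw [act_pMap, act_pMap, hn]
    rw [envι_smul_eq, envι_smul_eq]
    exact LinearMap.congr_fun (hS D.2) v

end RestrictedRep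

variable (k p) in
/-- The coefficient of the closed form by which the de Rham complex is twisted. -/
def twist (c : ZMod p) : TruncPoly k p :=
  -(algebraMap k _ (ZMod.castHom (dvd_refl p) k c) * coord k p 0 ^ (p - 1))

omit [Fact p.Prime] in
theorem del_one_twist (c : ZMod p) : del k p 1 (twist k p c) = 0 := by
  rw [twist, map_neg, Derivation.leibniz, del_one_pow_coord_zero, Derivation.map_algebraMap]
  simp

omit [Fact p.Prime] in
-- The twist makes `d` fail to commute with `D` by the term `c d(div D)`. The Lie derivative of the
-- closed form `θ dx` with `θ = -c x^(p-1)` is `d(θ f) = -c d(x^(p-1) f)`, and by the hypothesis on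
-- the divergence this cancels the defect.
theorem diffFun_funAct (c : ZMod p) (f g h : TruncPoly k p)
    (hfg : del k p 0 f + del k p 1 g = coord k p 0 ^ (p - 1) * f) :
    diffFun (twist k p c) (funAct (ZMod.castHom (dvd_refl p) k c) (vf f g) h) =
      formAct (ZMod.castHom (dvd_refl p) k c) (vf f g) (diffFun (twist k p c) h) := by
  have h0 := congrArg (del k p 0) hfg
  have h1 := congrArg (del k p 1) hfg
  have ht := del_one_pow_coord_zero (k := k) (p := p) (p - 1)
  simp only [diffFun_apply, formAct_vf, funAct_vf, twist]
  simp only [Derivation.leibniz, map_add, map_sub, map_neg,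
    smul_eq_mul, Derivation.map_algebraMap, ht, del_one_del_zero, mul_zero, add_zero,
    Prod.mk.injEq] at h0 h1 ⊢
  generalize coord k p 0 ^ (p - 1) = t at *
  generalize algebraMap k (TruncPoly k p) (ZMod.castHom (dvd_refl p) k c) = a at *
  constructor
  · linear_combination (a * h) * h0
  · linear_combination (a * h) * h1

/-- The cancellation is the one for functions. The twist of the target is larger by one because
two-forms are written through their coefficient of `dx ∧ dy`. -/
theorem diffForm_formAct (c : ZMod p) (f g u v : TruncPoly k p)
    (hfg : del k p 0 f + del k p 1 g = coord k p 0 ^ (p - 1) * f) :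
    diffForm (twist k p c) (formAct (ZMod.castHom (dvd_refl p) k c) (vf f g) (u, v)) =
      funAct (ZMod.castHom (dvd_refl p) k (c + 1)) (vf f g) (diffForm (twist k p c) (u, v)) := by
  have h0 := congrArg (del k p 0) hfg
  have h1 := congrArg (del k p 1) hfg
  have ht := del_one_pow_coord_zero (k := k) (p := p) (p - 1)
  simp only [diffForm_apply, formAct_vf, funAct_vf, twist]
  simp only [Derivation.leibniz, map_add, map_sub, map_neg, map_one,
    smul_eq_mul, Derivation.map_algebraMap, ht, del_one_del_zero, mul_zero, add_zero]
    at h0 h1 ⊢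
  generalize coord k p 0 ^ (p - 1) = t at *
  generalize algebraMap k (TruncPoly k p) (ZMod.castHom (dvd_refl p) k c) = a at *
  linear_combination (a * v) * h0 - (a * u) * h1

/-- The identity `div D = x^(p-1) D(x)` is needed for the generators only. It does not extend to
`Ĥ`: the field `y ∂_y` has divergence `1` and kills `x`. Compatibility with all of `Ĥ` comes from
`homOfCommute`. -/
theorem divg_hamA {j : ℕ} (hj : j ≤ p - 1) :
    del k p 0 (dpow (coord k p 1) (j - 1)) +
      del k p 1 (coord k p 0 ^ (p - 1) * dpow (coord k p 1) j) =
    coord k p 0 ^ (p - 1) * dpow (coord k p 1) (j - 1) := by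
  have hp := (Fact.out : p.Prime).one_le
  rw [del_dpow_of_ne (by decide), Derivation.leibniz, del_one_pow_coord_zero,
    del_dpow 1 (by omega)]
  simp

/-- Both sides vanish: the field is Hamiltonian in the ordinary sense, and `x^(p-1) x^i = 0` because
`i ≥ 1`. -/
theorem divg_hamB {i j : ℕ} (hi : 1 ≤ i) (hi' : i ≤ p - 1) (hj : j ≤ p - 1) :
    del k p 0 (-(dpow (coord k p 0) i * dpow (coord k p 1) (j - 1))) +
      del k p 1 (dpow (coord k p 0) (i - 1) * dpow (coord k p 1) j) =
    coord k p 0 ^ (p - 1) * -(dpow (coord k p 0) i * dpow (coord k p 1) (j - 1)) := by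
  have hp := (Fact.out : p.Prime).one_le
  have h0 : coord k p 0 ^ (p - 1) * dpow (coord k p 0) i = 0 := by
    rw [dpow_natCast, mul_smul_comm, ← pow_add, show p - 1 + i = p + (i - 1) by omega, pow_add,
      coord_pow, zero_mul, smul_zero]
  rw [map_neg, Derivation.leibniz, Derivation.leibniz,
    del_dpow_of_ne (show (0 : Fin 2) ≠ 1 by decide),
    del_dpow_of_ne (show (1 : Fin 2) ≠ 0 by decide), del_dpow 0 (by omega), del_dpow 1 (by omega), mul_neg, ← mul_assoc,
    h0]
  simp only [smul_eq_mul]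
  ring

/-- The twisted differential of functions. -/
def dFun (c : ZMod p) : (funRep k p c).Space →ₗ[RestrictedEnv k p] (formRep k p c).Space :=
  RestrictedRep.homOfCommute _ _ (diffFun (twist k p c))
    (fun j hj h => by
      rw [hamA_eq]
      exact diffFun_funAct c _ _ _ (divg_hamA hj))
    (fun i j hi hi' hj h => by
      rw [hamB_eq]
      exact diffFun_funAct c _ _ _ (divg_hamB hi hi' hj))

/-- The twisted differential of forms of degree one. -/
def dForm (c : ZMod p) : (formRep k p c).Space →ₗ[RestrictedEnv k p] (funRep k p (c + 1)).Space :=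
  RestrictedRep.homOfCommute _ _ (diffForm (twist k p c))
    (fun j hj h => by
      rw [hamA_eq]
      exact diffForm_formAct c _ _ _ _ (divg_hamA hj))
    (fun i j hi hi' hj h => by
      rw [hamB_eq]
      exact diffForm_formAct c _ _ _ _ (divg_hamB hi hi' hj))

end Equivariance

/-! ### Submodules of the modules of twisted functions -/

section Functions

/-- The operator `f - μ a` removes the summand at `a` and multiplies the others by nonzero scalars,
so induction on the number of summands applies. It is used to isolate single monomials as weight
vectors. -/
theorem mem_of_sum_eigenvectors_mem {k V ι : Type*} [Field k] [AddCommGroup V] [Module k V]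
    {N : Submodule k V} {f : Module.End k V} (hf : ∀ v ∈ N, f v ∈ N) (s : Finset ι) {μ : ι → k}
    (hμ : Set.InjOn μ s) {v : ι → V} (hv : ∀ i ∈ s, f (v i) = μ i • v i)
    (h : ∑ i ∈ s, v i ∈ N) : ∀ i ∈ s, v i ∈ N := by
  classical
  induction s using Finset.induction_on generalizing v with
  | empty => simp
  | insert a s ha ih =>
    have hs : ∀ i ∈ s, v i ∈ N := by
      have h1 : ∑ i ∈ s, (μ i - μ a) • v i ∈ N := by
        have h2 := N.sub_mem (hf _ h) (N.smul_mem (μ a) h)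
        rw [Finset.sum_insert ha, map_add, smul_add, hv a (Finset.mem_insert_self a s),
          add_sub_add_left_eq_sub, map_sum, Finset.smul_sum, ← Finset.sum_sub_distrib] at h2
        convert h2 using 2 with i hi
        rw [hv i (Finset.mem_insert_of_mem hi), sub_smul]
      intro i hi
      have h2 := ih (hμ.mono (by simp)) (v := fun i => (μ i - μ a) • v i)
        (fun i hi => by rw [map_smul, hv i (Finset.mem_insert_of_mem hi), smul_comm]) h1 i hi
      refine (N.smul_mem_iff (sub_ne_zero.2 fun hia => ha ?_)).1 h2
      rwa [← hμ (Finset.mem_insert_of_mem hi) (Finset.mem_insert_self a s) hia]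
    intro i hi
    rcases Finset.mem_insert.1 hi with rfl | hi
    · rw [Finset.sum_insert ha] at h
      exact (N.add_mem_iff_left (N.sum_mem hs)).1 h
    · exact hs i hi

variable {k : Type*} [Field k] {p : ℕ} [CharP k p]

theorem natCast_injOn : Set.InjOn (fun i : Fin p => ((i : ℕ) : k)) (Finset.univ : Finset (Fin p)) :=
  fun i _ j _ h => Fin.ext ((CharP.natCast_injOn_Iio k p) i.2 j.2 h)

theorem xdx_apply_monom (i j : ℕ) :
    coord k p 0 * del k p 0 (monom k p i j) = (i : k) • monom k p i j := by
  rw [del_zero_monom, mul_smul_comm, ← monom_one_zero, monom_mul_monom]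
  rcases i with _ | i
  · simp
  · congr 2 <;> omega

theorem ydy_apply_monom (i j : ℕ) :
    coord k p 1 * del k p 1 (monom k p i j) = (j : k) • monom k p i j := by
  rw [del_one_monom, mul_smul_comm, ← monom_zero_one, monom_mul_monom]
  rcases j with _ | j
  · simp
  · congr 2 <;> omega

theorem funAct_xdx_monom (c : k) (i j : ℕ) :
    funAct c (vf (coord k p 0) 0) (monom k p i j) = ((i : k) + c) • monom k p i j := by
  rw [funAct_apply, divg_vf, vf_apply, xdx_apply_monom, del_coord]
  simp [add_smul]

theorem funAct_ydy_monom (c : k) (i j : ℕ) :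
    funAct c (vf 0 (coord k p 1)) (monom k p i j) = ((j : k) + c) • monom k p i j := by
  rw [funAct_apply, divg_vf, vf_apply, ydy_apply_monom, del_coord]
  simp [add_smul]

theorem dy_eq : vf (0 : TruncPoly k p) 1 = hamB k p 1 0 := by
  rw [hamB_eq, Nat.cast_one, Nat.cast_zero, zero_sub, dpow_neg_one, mul_zero, neg_zero, sub_self,
    dpow_zero, dpow_zero, one_mul]

variable [Fact p.Prime]

theorem hamA_one_eq : hamA k p 1 = vf 1 (coord k p 0 ^ (p - 1) * coord k p 1) := by
  rw [hamA_eq, Nat.cast_one, sub_self, dpow_zero, dpow_one]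

theorem xdx_mem : vf (coord k p 0) 0 ∈ hamHat k p := by
  have h := xdx_mem_hamHat k p
  have h2 : vf (coord k p 0) 0 = coord k p 0 • del k p 0 :=
    (congrArg _ (zero_smul _ _)).trans (add_zero _)
  rwa [h2]

theorem ydy_mem : vf 0 (coord k p 1) ∈ hamHat k p := by
  have h := ydy_mem_hamHat k p
  have h2 : vf 0 (coord k p 1) = coord k p 1 • del k p 1 :=
    (congrArg (· + _) (zero_smul _ _)).trans (zero_add _)
  rwa [h2]

variable {c : k} {N : Submodule k (TruncPoly k p)}

/-- At most one of the two terms survives when `i < p`. For `i ≥ 1` the operator lowers the exponent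
of `x`; for `i = 0` it wraps around to `x^(p-1)` with the factor `j + c`, and this factor is where
the value of the twist matters. -/
theorem hamA_one_monom (c : k) (i j : ℕ) : funAct c (hamA k p 1) (monom k p i j) =
    (i : k) • monom k p (i - 1) j + ((j : k) + c) • monom k p (i + (p - 1)) j := by
  have hd := divg_hamA (k := k) (p := p) (j := 1) (by have := (Fact.out : p.Prime).two_le; omega)
  rw [Nat.cast_one, sub_self, dpow_zero, dpow_one, mul_one] at hd
  have hm : coord k p 0 ^ (p - 1) * monom k p i j = monom k p (i + (p - 1)) j := by
    rw [monom, monom, pow_add]; ring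
  rw [hamA_one_eq, funAct_vf, hd, hm, del_zero_monom, mul_assoc, ydy_apply_monom,
    mul_smul_comm (j : k), hm, ← Algebra.smul_def, one_mul, add_smul, add_assoc]

theorem monom_mem_of_le (hA : ∀ h ∈ N, funAct c (hamA k p 1) h ∈ N)
    (hY : ∀ h ∈ N, funAct c (hamB k p 1 0) h ∈ N) {i j i' j' : ℕ} (hi : i < p) (hj : j < p)
    (hi' : i' ≤ i) (hj' : j' ≤ j) (h : monom k p i j ∈ N) : monom k p i' j' ∈ N := by
  induction i, hi' using Nat.le_induction with
  | base =>
    induction j, hj' using Nat.le_induction with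
    | base => exact h
    | succ j _ ih =>
      refine ih (by omega) ?_
      have h1 := hY _ h
      rw [← dy_eq, funAct_vf, del_one_monom, Derivation.map_one_eq_zero, map_zero] at h1
      simp only [zero_mul, one_mul, zero_add, mul_zero, add_zero, Nat.add_sub_cancel] at h1
      exact (N.smul_mem_iff (natCast_ne_zero_of_lt (Nat.succ_ne_zero j) hj)).1 h1
  | succ i _ ih =>
    refine ih (by omega) ?_
    have h1 := hA _ h
    rw [hamA_one_monom, monom_eq_zero_of_left_le (by omega : p ≤ i + 1 + (p - 1)), smul_zero,
      add_zero] at h1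
    exact (N.smul_mem_iff (natCast_ne_zero_of_lt (Nat.succ_ne_zero i) hi)).1 h1

theorem eq_top_of_top_monom_mem (hA : ∀ h ∈ N, funAct c (hamA k p 1) h ∈ N)
    (hY : ∀ h ∈ N, funAct c (hamB k p 1 0) h ∈ N) (h : monom k p (p - 1) (p - 1) ∈ N) : N = ⊤ :=
  have hp := (Fact.out : p.Prime).pos
  eq_top_of_monom_mem fun i j hi hj =>
    monom_mem_of_le hA hY (by omega) (by omega) (by omega) (by omega) h

/-- A space of functions that is stable under the action of `Ĥ` twisted by `c`. -/
def FunStable (c : k) (N : Submodule k (TruncPoly k p)) : Prop :=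
  ∀ D ∈ hamHat k p, ∀ h ∈ N, funAct c D h ∈ N

namespace FunStable

theorem monom_mem (hN : FunStable c N) {h : TruncPoly k p} (hh : h ∈ N) (i j : Fin p)
    (hij : (monomBasis k p).repr h (i, j) ≠ 0) : monom k p i j ∈ N := by
  rw [← (monomBasis k p).sum_repr h, Fintype.sum_prod_type] at hh
  have h1 := mem_of_sum_eigenvectors_mem (hN _ xdx_mem) Finset.univ
    (μ := fun i : Fin p => ((i : ℕ) : k) + c)
    (fun i hi j hj h => natCast_injOn hi hj (add_right_cancel h))
    (fun i _ => by
      rw [map_sum, Finset.smul_sum]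
      refine Finset.sum_congr rfl fun j _ => ?_
      rw [map_smul, monomBasis_apply, funAct_xdx_monom, smul_comm]) hh i (Finset.mem_univ _)
  have h2 := mem_of_sum_eigenvectors_mem (hN _ ydy_mem) Finset.univ
    (μ := fun i : Fin p => ((i : ℕ) : k) + c)
    (fun i hi j hj h => natCast_injOn hi hj (add_right_cancel h))
    (fun j _ => by
      rw [map_smul, monomBasis_apply, funAct_ydy_monom, smul_comm]) h1 j (Finset.mem_univ _)
  rw [monomBasis_apply] at h2
  exact (N.smul_mem_iff hij).1 h2

theorem lower (hN : FunStable c N) {i j i' j' : ℕ} (hi : i < p) (hj : j < p) (hi' : i' ≤ i)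
    (hj' : j' ≤ j) (h : monom k p i j ∈ N) : monom k p i' j' ∈ N := by
  have hp := (Fact.out : p.Prime).two_le
  exact monom_mem_of_le (hN _ (hamA_mem k p 1 (by omega)))
    (hN _ (hamB_mem k p 1 0 le_rfl (by omega) (by omega))) hi hj hi' hj' h

theorem raise_left (hN : FunStable c N) {j : ℕ} (hj : (j : k) + c ≠ 0)
    (h : monom k p 0 j ∈ N) : monom k p (p - 1) j ∈ N := by
  have hp := (Fact.out : p.Prime).two_le
  have h1 := hN (hamA k p 1) (hamA_mem k p 1 (by omega)) _ h
  rw [hamA_one_monom, Nat.cast_zero, zero_smul, zero_add, zero_add] at h1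
  exact (N.smul_mem_iff hj).1 h1

/-- Suitable `hamB` send `y` to nonzero multiples of `x^i y^(p-1)` for `i < p - 1`, and lowering
exponents reaches all monomials not divisible by `x^(p-1)`. Those with `x^(p-1)` come from the
wrap-around `y^j ↦ (j + c) x^(p-1) y^j`. At `j = p - 1` the factor is `c - 1`, so only the top
monomial can be missed, and only for `c = 1`. -/
theorem monom_mem_of_coord_one_mem (hN : FunStable c N) (h : coord k p 1 ∈ N) {i j : ℕ}
    (hi : i < p) (hj : j < p) (hc : c ≠ 1 ∨ (i, j) ≠ (p - 1, p - 1)) : monom k p i j ∈ N := by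
  have hp := (Fact.out : p.Prime).two_le
  -- The index `i + 1` must be at most `p - 1` for `hamB` to be a generator; hence the strict bound
  -- on `i`.
  have h1 (i : ℕ) (hi : i < p - 1) : monom k p i (p - 1) ∈ N := by
    have h2 := hN (hamB k p (i + 1) (p - 1)) (hamB_mem k p _ _ (by omega) (by omega) le_rfl) _ h
    have h0 : coord k p 0 ^ (p - 1) * dpow (coord k p 0) (i + 1 : ℕ) = 0 := by
      rw [dpow_natCast, mul_smul_comm, ← pow_add, show p - 1 + (i + 1) = p + i by omega, pow_add,
        coord_pow, zero_mul, smul_zero]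
    rw [hamB_eq, funAct_vf, divg_hamB (by omega) (by omega) le_rfl, del_coord, del_coord,
      mul_neg (coord k p 0 ^ (p - 1)), ← mul_assoc (coord k p 0 ^ (p - 1)), h0] at h2
    simp only [Fin.isValue, zero_ne_one, if_false, if_true, mul_zero, mul_one, zero_add, zero_mul,
      neg_zero, add_zero] at h2
    rw [show ((i + 1 : ℕ) : ℤ) - 1 = i by omega, dpow_natCast, dpow_natCast,
      smul_mul_smul_comm] at h2
    exact (N.smul_mem_iff (mul_ne_zero (inv_ne_zero (factorial_ne_zero_of_lt (by omega)))
      (inv_ne_zero (factorial_ne_zero_of_lt (by omega))))).1 h2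
  by_cases hi2 : i < p - 1
  · exact hN.lower hi (by omega : p - 1 < p) le_rfl (by omega) (h1 i hi2)
  · obtain rfl : i = p - 1 := by omega
    have h2 (j : ℕ) (hj : j < p) (hc : (j : k) + c ≠ 0) : monom k p (p - 1) j ∈ N :=
      hN.raise_left hc (hN.lower (by omega : 0 < p) (by omega : p - 1 < p) le_rfl (by omega)
        (h1 0 (by omega)))
    by_cases hc1 : c = 1
    · refine h2 j hj fun h0 => ?_
      have hj2 : j ≠ p - 1 := by
        rintro rfl
        exact hc.elim (fun h => h hc1) fun h => h rfl
      rw [hc1, ← Nat.cast_succ] at h0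
      exact natCast_ne_zero_of_lt (Nat.succ_ne_zero j) (by omega) h0
    · refine hN.lower hi (by omega : p - 1 < p) le_rfl (by omega) (h2 (p - 1) (by omega) ?_)
      rw [Nat.cast_sub (by omega), CharP.cast_eq_zero, Nat.cast_one, zero_sub, neg_add_eq_sub]
      exact sub_ne_zero.2 hc1

omit [CharP k p] [Fact p.Prime] in
theorem exists_repr_ne_zero {h : TruncPoly k p} (hh : h ≠ 0) :
    ∃ i j, (monomBasis k p).repr h (i, j) ≠ 0 := by
  by_contra! h0
  exact hh ((monomBasis k p).repr.map_eq_zero_iff.1 (Finsupp.ext fun ij => h0 ij.1 ij.2))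

/-- Some monomial lies in `N`, and lowering it gives `1`. On `1` only the divergence term of `hamA k
p 2` acts, with value `c x^(p-1) y`, and this is lowered to `y`. -/
theorem coord_one_mem (hN : FunStable c N) (hp3 : 3 ≤ p) (hc : c ≠ 0) (h : N ≠ ⊥) :
    coord k p 1 ∈ N := by
  obtain ⟨h, hh, h0⟩ := N.ne_bot_iff.1 h
  obtain ⟨i, j, hij⟩ := exists_repr_ne_zero h0
  have h1 := hN.lower i.2 j.2 (Nat.zero_le _) (Nat.zero_le _) (hN.monom_mem hh i j hij)
  rw [monom_zero_zero] at h1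
  have h2 := hN (hamA k p 2) (hamA_mem k p 2 (by omega)) _ h1
  rw [hamA_eq, funAct_vf, divg_hamA (by omega), show ((2 : ℕ) : ℤ) - 1 = 1 by norm_num, dpow_one,
    Derivation.map_one_eq_zero, Derivation.map_one_eq_zero, mul_one, ← Algebra.smul_def] at h2
  simp only [mul_zero, zero_add] at h2
  have h3 : coord k p 0 ^ (p - 1) * coord k p 1 = monom k p (p - 1) 1 := by simp [monom]
  rw [h3] at h2
  have h4 := hN.lower (by omega : p - 1 < p) (by omega : 1 < p) (Nat.zero_le _) le_rfl
    ((N.smul_mem_iff hc).1 h2)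
  rwa [monom_zero_one] at h4

/-- A nonconstant monomial of `N` is lowered to `y`, or to `x`; in the second case `hamA k p 2`
sends `x` to `y`. -/
theorem coord_one_mem_of_zero (hN : FunStable 0 N) (hp3 : 3 ≤ p)
    (h : ¬ N ≤ Submodule.span k {1}) : coord k p 1 ∈ N := by
  obtain ⟨h, hh, h0⟩ := SetLike.not_le_iff_exists.1 h
  obtain ⟨i, j, hij, hne⟩ : ∃ i j, (monomBasis k p).repr h (i, j) ≠ 0 ∧ ((i : ℕ), (j : ℕ)) ≠ (0, 0) := by
    by_contra! h1
    refine h0 ?_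
    rw [← (monomBasis k p).sum_repr h]
    refine Submodule.sum_mem _ fun ij _ => ?_
    by_cases h2 : (monomBasis k p).repr h ij = 0
    · rw [h2, zero_smul]; exact zero_mem _
    · have h3 := h1 ij.1 ij.2 h2
      rw [Prod.mk.injEq] at h3
      rw [monomBasis_apply, h3.1, h3.2, monom_zero_zero]
      exact Submodule.smul_mem _ _ (Submodule.mem_span_singleton_self _)
  have h1 := hN.monom_mem hh i j hij
  by_cases hj : 1 ≤ (j : ℕ)
  · have h4 := hN.lower i.2 j.2 (Nat.zero_le _) hj h1
    rwa [monom_zero_one] at h4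
  · have hi : 1 ≤ (i : ℕ) := by
      by_contra hi
      exact hne (by rw [Prod.mk.injEq]; omega)
    have h4 := hN.lower i.2 j.2 hi (Nat.zero_le _) h1
    rw [monom_one_zero] at h4
    have h2 := hN (hamA k p 2) (hamA_mem k p 2 (by omega)) _ h4
    rw [hamA_eq, funAct_vf, show ((2 : ℕ) : ℤ) - 1 = 1 by norm_num, dpow_one, del_coord,
      del_coord, map_zero] at h2
    simpa using h2

theorem eq_top (hN : FunStable c N) (hp3 : 3 ≤ p) (hc : c ≠ 0) (hc1 : c ≠ 1) (h : N ≠ ⊥) :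
    N = ⊤ :=
  eq_top_of_monom_mem fun _ _ hi hj =>
    hN.monom_mem_of_coord_one_mem (hN.coord_one_mem hp3 hc h) hi hj (Or.inl hc1)

theorem eq_top_of_zero (hN : FunStable 0 N) (hp3 : 3 ≤ p) (h : ¬ N ≤ Submodule.span k {1}) :
    N = ⊤ :=
  eq_top_of_monom_mem fun _ _ hi hj =>
    hN.monom_mem_of_coord_one_mem (hN.coord_one_mem_of_zero hp3 h) hi hj (Or.inl zero_ne_one)

end FunStable

variable (k p) in
/-- The coefficient of the monomial of highest degree. -/
def topCoeff : TruncPoly k p →ₗ[k] k :=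
  have hp := (Fact.out : p.Prime).pos
  (monomBasis k p).coord (⟨p - 1, by omega⟩, ⟨p - 1, by omega⟩)

omit [CharP k p] in
theorem topCoeff_monom {i j : ℕ} (hi : i < p) (hj : j < p) :
    topCoeff k p (monom k p i j) = if (i, j) = (p - 1, p - 1) then 1 else 0 := by
  have h := monomBasis_apply (k := k) ((⟨i, hi⟩, ⟨j, hj⟩) : Fin p × Fin p)
  dsimp only at h
  rw [← h, topCoeff, Module.Basis.coord_apply, Module.Basis.repr_self, Finsupp.single_apply]
  congr 1
  simp [Fin.ext_iff]

theorem FunStable.ker_topCoeff_le {N : Submodule k (TruncPoly k p)} (hN : FunStable 1 N)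
    (hp3 : 3 ≤ p) (h : N ≠ ⊥) : LinearMap.ker (topCoeff k p) ≤ N := by
  intro h hh
  rw [← (monomBasis k p).sum_repr h]
  refine Submodule.sum_mem _ fun ij _ => ?_
  by_cases h2 : ((ij.1 : ℕ), (ij.2 : ℕ)) = (p - 1, p - 1)
  · have h3 : (monomBasis k p).repr h ij = 0 := by
      rw [LinearMap.mem_ker, topCoeff, Module.Basis.coord_apply] at hh
      rw [← hh]
      congr 1
      rw [Prod.mk.injEq] at h2
      ext <;> simp [h2.1, h2.2]
    rw [h3, zero_smul]
    exact zero_mem _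
  · rw [monomBasis_apply]
    exact N.smul_mem _ (hN.monom_mem_of_coord_one_mem (hN.coord_one_mem hp3 one_ne_zero ‹_›)
      ij.1.2 ij.2.2 (Or.inr h2))

end Functions

/-! ### Induced modules -/

section Filtration

variable {k : Type*} [Field k] {p : ℕ} [CharP k p] [Fact p.Prime]

omit [CharP k p] [Fact p.Prime] in
theorem exists_sub_algebraMap_mem (f : TruncPoly k p) :
    ∃ α : k, f - algebraMap k _ α ∈ maxIdeal k p := by
  have hf : f ∈ Algebra.adjoin k (Set.range (coord k p)) := by
    rw [adjoin_coord]; exact Algebra.mem_top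
  induction hf using Algebra.adjoin_induction with
  | mem x hx =>
    refine ⟨0, ?_⟩
    rw [map_zero, sub_zero]
    exact Ideal.subset_span hx
  | algebraMap r => exact ⟨r, by rw [sub_self]; exact zero_mem _⟩
  | add a b _ _ ha hb =>
    obtain ⟨α, hα⟩ := ha
    obtain ⟨β, hβ⟩ := hb
    refine ⟨α + β, ?_⟩
    rw [map_add, add_sub_add_comm]
    exact add_mem hα hβ
  | mul a b _ _ ha hb =>
    obtain ⟨α, hα⟩ := ha
    obtain ⟨β, hβ⟩ := hb
    refine ⟨α * β, ?_⟩
    rw [map_mul, show a * b - algebraMap k _ α * algebraMap k _ β =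
      b * (a - algebraMap k _ α) + algebraMap k _ α * (b - algebraMap k _ β) by ring]
    exact add_mem (Ideal.mul_mem_left _ _ hα) (Ideal.mul_mem_left _ _ hβ)

omit [CharP k p] [Fact p.Prime] in
theorem coord_mem_maxIdeal (i : Fin 2) : coord k p i ∈ maxIdeal k p := Ideal.subset_span ⟨i, rfl⟩

omit [Fact p.Prime] in
theorem vf_mem_wittFil {f g : TruncPoly k p} {n : ℕ} :
    vf f g ∈ wittFil k p n ↔ f ∈ maxIdeal k p ^ (n + 1) ∧ g ∈ maxIdeal k p ^ (n + 1) := by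
  change (∀ i, _) ↔ _
  rw [Fin.forall_fin_two, vf_coord_zero, vf_coord_one]

variable (k p)

/-- The element `∂_x - x^(p-1) y ∂_y` of `Ĥ`. -/
def elA : hamHat k p := ⟨hamA k p 1, hamA_mem k p 1 (by have := (Fact.out : p.Prime).two_le; omega)⟩

/-- The element `∂_y` of `Ĥ`. -/
def elY : hamHat k p :=
  ⟨hamB k p 1 0, hamB_mem k p 1 0 le_rfl (by have := (Fact.out : p.Prime).two_le; omega) (by omega)⟩

variable {k p}

/-- The scalars are the constant terms of `D x` and `D y`: modulo `Ĥ_(0)`, the two chosen elements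
are `∂_x` and `∂_y`. -/
theorem exists_eq_add (D : hamHat k p) : ∃ D₀ : hamHat k p, (D₀ : Witt k p) ∈ wittFil k p 0 ∧
    ∃ α β : k, D = D₀ + α • elA k p + β • elY k p := by
  obtain ⟨α, hα⟩ := exists_sub_algebraMap_mem ((D : Witt k p) (coord k p 0))
  obtain ⟨β, hβ⟩ := exists_sub_algebraMap_mem ((D : Witt k p) (coord k p 1))
  refine ⟨D - α • elA k p - β • elY k p, ?_, α, β, by abel⟩
  intro i
  have h0 : (hamA k p 1) (coord k p 0) = 1 := by rw [hamA_one_eq, vf_coord_zero]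
  have h1 : (hamA k p 1) (coord k p 1) = coord k p 0 ^ (p - 1) * coord k p 1 := by
    rw [hamA_one_eq, vf_coord_one]
  have h2 : (hamB k p 1 0) (coord k p 0) = 0 := by rw [← dy_eq, vf_coord_zero]
  have h3 : (hamB k p 1 0) (coord k p 1) = 1 := by rw [← dy_eq, vf_coord_one]
  have h (i : Fin 2) : (((D - α • elA k p - β • elY k p : hamHat k p) : Witt k p)) (coord k p i) =
    (D : Witt k p) (coord k p i) - α • (hamA k p 1) (coord k p i)
      - β • (hamB k p 1 0) (coord k p i) := rfl
  rw [h, zero_add, pow_one]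
  fin_cases i
  · change (D : Witt k p) (coord k p 0) - α • (hamA k p 1) (coord k p 0)
      - β • (hamB k p 1 0) (coord k p 0) ∈ _
    rw [h0, h2, smul_zero, sub_zero, ← Algebra.algebraMap_eq_smul_one]
    exact hα
  · change (D : Witt k p) (coord k p 1) - α • (hamA k p 1) (coord k p 1)
      - β • (hamB k p 1 0) (coord k p 1) ∈ _
    rw [h1, h3, ← Algebra.algebraMap_eq_smul_one, sub_right_comm]
    refine sub_mem hβ ?_
    rw [Algebra.smul_def, ← mul_assoc]
    exact Ideal.mul_mem_left _ _ (coord_mem_maxIdeal 1)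

/-- The power is the image of `-y ∂_y`. It is not zero, but it belongs to `Ĥ_(0)`, which suffices to
keep exponents below `p` in ordered monomials. -/
theorem envι_elA_pow : ∃ E : hamHat k p, (E : Witt k p) ∈ wittFil k p 0 ∧
    envι k p (elA k p) ^ p = envι k p E := by
  refine ⟨⟨pMap (hamA k p 1), pMap_mem_hamHat k p (elA k p).2⟩, ?_, envι_pow _ _ rfl⟩
  change pMap (hamA k p 1) ∈ wittFil k p 0
  rw [pMap_hamA_one]
  exact (wittFil k p 0).neg_mem (coord_smul_del_mem_wittFil k p 1 1)

theorem pMap_dy : pMap (vf (0 : TruncPoly k p) 1) = 0 := by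
  have hp := (Fact.out : p.Prime).two_le
  refine witt_ext k p fun i => ?_
  have h0 (q : ℕ) : (vf (0 : TruncPoly k p) 1)^[q] 0 = 0 :=
    Function.iterate_fixed (map_zero _) q
  have h := congrArg (fun n => (vf (0 : TruncPoly k p) 1)^[n] (coord k p i))
    (show p = (p - 2) + 1 + 1 by omega)
  rw [pMap_apply]
  refine h.trans ?_
  rw [Function.iterate_succ_apply, Function.iterate_succ_apply]
  fin_cases i
  · exact (congrArg _ ((congrArg _ (vf_coord_zero _ _)).trans (map_zero _))).trans (h0 _)
  · exact (congrArg _ ((congrArg _ (vf_coord_one _ _)).trans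
      (Derivation.map_one_eq_zero _))).trans (h0 _)

theorem envι_elY_pow : envι k p (elY k p) ^ p = 0 := by
  rw [envι_pow (elY k p) 0]
  · simp [envι]
  · change (0 : Witt k p) = pMap (hamB k p 1 0)
    rw [← dy_eq, pMap_dy]

variable {X : Type*} [AddCommGroup X] [Module k X] [Module (RestrictedEnv k p) X]
  [IsScalarTower k (RestrictedEnv k p) X]

/-- The subspace spanned by all `D_1 ⋯ D_m v` with `m ≤ n`, `D_i ∈ Ĥ` and `v ∈ V`. -/
def envFil (V : Submodule k X) : ℕ → Submodule k X
  | 0 => V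
  | n + 1 => envFil V n ⊔
      Submodule.span k {w | ∃ (D : hamHat k p), ∃ u ∈ envFil V n, w = envι k p D • u}

variable {V : Submodule k X}

omit [IsScalarTower k (RestrictedEnv k p) X] in
theorem envFil_mono : Monotone (envFil V) := monotone_nat_of_le_succ fun _ => le_sup_left

omit [IsScalarTower k (RestrictedEnv k p) X] in
theorem envι_smul_mem_envFil_succ (D : hamHat k p) {n : ℕ} {u : X} (hu : u ∈ envFil V n) :
    envι k p D • u ∈ envFil V (n + 1) :=
  Submodule.mem_sup_right (Submodule.subset_span ⟨D, u, hu, rfl⟩)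

/-- In `D E u = E D u + [D,E] u` the first term is handled by induction, and `[D,E]` is a single
element of `Ĥ`, so neither term rises above the level of `E u`. -/
theorem envι_smul_mem_envFil
    (hV : ∀ D : hamHat k p, (D : Witt k p) ∈ wittFil k p 0 → ∀ v ∈ V, envι k p D • v ∈ V)
    {D : hamHat k p} (hD : (D : Witt k p) ∈ wittFil k p 0) {n : ℕ} {u : X}
    (hu : u ∈ envFil V n) : envι k p D • u ∈ envFil V n := by
  induction n generalizing u with
  | zero => exact hV D hD u hu
  | succ n ih =>
    have h : envFil V (n + 1) ≤ (envFil V (n + 1)).comap (DistribSMul.toLinearMap k X (envι k p D)) := by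
      refine sup_le (fun u hu => envFil_mono (Nat.le_succ n) (ih hu)) (Submodule.span_le.2 ?_)
      rintro _ ⟨E, u, hu, rfl⟩
      change envι k p D • envι k p E • u ∈ envFil V (n + 1)
      have h2 : envι k p D • envι k p E • u =
          envι k p E • envι k p D • u + envι k p ⁅D, E⁆ • u := by
        rw [envι_lie, sub_smul, mul_smul, mul_smul, add_sub_cancel]
      rw [h2]
      exact add_mem (envι_smul_mem_envFil_succ E (ih hu)) (envι_smul_mem_envFil_succ _ hu)
    exact h hu

omit [IsScalarTower k (RestrictedEnv k p) X] in
theorem pow_elY_smul_mem {v : X} (hv : v ∈ V) (j : ℕ) :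
    envι k p (elY k p) ^ j • v ∈ envFil V j := by
  induction j with
  | zero => rw [pow_zero, one_smul]; exact hv
  | succ j ih =>
    rw [pow_succ', mul_smul]
    exact envι_smul_mem_envFil_succ _ ih

omit [IsScalarTower k (RestrictedEnv k p) X] in
-- Interchanging `∂_y` with a power of the other generator costs terms one filtration step below the
-- product. The second conjunct is carried along for the induction.
theorem elY_pow_elA_smul_sub_mem (i : ℕ) {m : ℕ} {u : X} (hu : u ∈ envFil V m) :
    envι k p (elY k p) • envι k p (elA k p) ^ i • u -
      envι k p (elA k p) ^ i • envι k p (elY k p) • u ∈ envFil V (m + i) ∧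
    envι k p (elA k p) ^ i • u ∈ envFil V (m + i) := by
  induction i with
  | zero =>
    rw [pow_zero, one_smul, one_smul, sub_self]
    exact ⟨zero_mem _, hu⟩
  | succ i ih =>
    refine ⟨?_, ?_⟩
    · have h : envι k p (elY k p) • envι k p (elA k p) ^ (i + 1) • u -
          envι k p (elA k p) ^ (i + 1) • envι k p (elY k p) • u =
          envι k p (elA k p) • (envι k p (elY k p) • envι k p (elA k p) ^ i • u -
            envι k p (elA k p) ^ i • envι k p (elY k p) • u) +
          envι k p ⁅elY k p, elA k p⁆ • envι k p (elA k p) ^ i • u := by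
        rw [envι_lie, pow_succ']
        simp only [sub_smul, mul_smul, smul_sub]
        abel
      rw [h]
      exact add_mem (envι_smul_mem_envFil_succ _ ih.1) (envι_smul_mem_envFil_succ _ ih.2)
    · rw [pow_succ', mul_smul]
      exact envι_smul_mem_envFil_succ _ ih.2

/-- The subspace spanned by the ordered monomials of bounded degree. -/
def pbwFil (V : Submodule k X) (n : ℕ) : Submodule k X :=
  Submodule.span k {w | ∃ i j, i < p ∧ j < p ∧ i + j ≤ n ∧ ∃ v ∈ V,
    w = envι k p (elA k p) ^ i • envι k p (elY k p) ^ j • v}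

omit [IsScalarTower k (RestrictedEnv k p) X] in
theorem pbwFil_mono : Monotone (pbwFil V) := by
  intro m n hmn
  refine Submodule.span_mono ?_
  rintro _ ⟨i, j, hi, hj, hij, v, hv, rfl⟩
  exact ⟨i, j, hi, hj, hij.trans hmn, v, hv, rfl⟩

/-- This is the spanning half of a Poincaré–Birkhoff–Witt theorem relative to `Ĥ_(0)`. The
independence half is not proved; a dimension count against an explicit module replaces it. -/
theorem envFil_le_pbwFil
    (hV : ∀ D : hamHat k p, (D : Witt k p) ∈ wittFil k p 0 → ∀ v ∈ V, envι k p D • v ∈ V)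
    (n : ℕ) : envFil V n ≤ pbwFil V n := by
  have hp := (Fact.out : p.Prime).pos
  induction n with
  | zero =>
    intro v hv
    exact Submodule.subset_span ⟨0, 0, hp, hp, le_rfl, v, hv, by rw [pow_zero, one_smul, pow_zero, one_smul]⟩
  | succ n ih =>
    have hmono := pbwFil_mono (V := V) (Nat.le_succ n)
    refine sup_le (ih.trans hmono) (Submodule.span_le.2 ?_)
    rintro _ ⟨D, u, hu, rfl⟩
    obtain ⟨D₀, hD₀, α, β, rfl⟩ := exists_eq_add D
    rw [envι_add, envι_add, envι_smul, envι_smul, add_smul, add_smul, smul_assoc, smul_assoc]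
    have hA : pbwFil V n ≤
        (pbwFil V (n + 1)).comap (DistribSMul.toLinearMap k X (envι k p (elA k p))) := by
      refine Submodule.span_le.2 ?_
      rintro _ ⟨i, j, hi, hj, hij, v, hv, rfl⟩
      change envι k p (elA k p) • _ ∈ pbwFil V (n + 1)
      rw [← mul_smul, ← pow_succ']
      by_cases hi' : i + 1 < p
      · exact Submodule.subset_span ⟨i + 1, j, hi', hj, by omega, v, hv, rfl⟩
      -- When the exponent reaches `p`, the power becomes an element of `Ĥ_(0)`, which preserves the
      -- filtration, so the degree falls back to `j ≤ n`.
      · obtain ⟨E, hE, hE'⟩ := envι_elA_pow (k := k) (p := p)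
        rw [show i + 1 = p by omega, hE']
        exact hmono (ih (envFil_mono (by omega)
          (envι_smul_mem_envFil hV hE (pow_elY_smul_mem hv j))))
    have hY : pbwFil V n ≤
        (pbwFil V (n + 1)).comap (DistribSMul.toLinearMap k X (envι k p (elY k p))) := by
      refine Submodule.span_le.2 ?_
      rintro _ ⟨i, j, hi, hj, hij, v, hv, rfl⟩
      change envι k p (elY k p) • _ ∈ pbwFil V (n + 1)
      -- The commutator has degree at most `n`, so the induction hypothesis absorbs it; what remains
      -- is an ordered monomial, or zero if the exponent of `∂_y` reaches `p`.
      have h1 := (elY_pow_elA_smul_sub_mem i (pow_elY_smul_mem hv j)).1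
      have h2 := hmono (ih (envFil_mono (by omega : j + i ≤ n) h1))
      rw [← sub_add_cancel (envι k p (elY k p) • _) (envι k p (elA k p) ^ i • _)]
      refine add_mem h2 ?_
      rw [← mul_smul (envι k p (elY k p)), ← pow_succ']
      by_cases hj' : j + 1 < p
      · exact Submodule.subset_span ⟨i, j + 1, hi, hj', by omega, v, hv, rfl⟩
      · rw [show j + 1 = p by omega, envι_elY_pow, zero_smul, smul_zero]
        exact zero_mem _
    exact add_mem (add_mem (hmono (ih (envι_smul_mem_envFil hV hD₀ hu)))
      (Submodule.smul_mem _ _ (hA (ih hu)))) (Submodule.smul_mem _ _ (hY (ih hu)))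

/-- The subspace generated by a subspace that is stable under `Ĥ_(0)` is spanned by ordered
monomials. -/
theorem smul_mem_span_monomials
    (hV : ∀ D : hamHat k p, (D : Witt k p) ∈ wittFil k p 0 → ∀ v ∈ V, envι k p D • v ∈ V)
    (u : RestrictedEnv k p) {v : X} (hv : v ∈ V) : u • v ∈ ⨆ n, pbwFil V n := by
  have h : u • v ∈ ⨆ n, envFil V n := by
    refine smul_mem_of_envι_smul_mem (fun D w hw => ?_) u
      (Submodule.mem_iSup_of_mem 0 hv)
    rw [Submodule.mem_iSup_of_directed _ envFil_mono.directed_le] at hw ⊢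
    obtain ⟨n, hn⟩ := hw
    exact ⟨n + 1, envι_smul_mem_envFil_succ D hn⟩
  exact iSup_mono (envFil_le_pbwFil hV) h

end Filtration

/-! ### Universal property of induced modules and the dimension bound -/

section Induced

variable {k : Type*} [Field k] {p : ℕ} [CharP k p] [Fact p.Prime]
  {M : Type*} [AddCommGroup M] [Module k M]
  [LieRingModule (hamFil k p 0) M]
  {X : Type*} [AddCommGroup X] [Module k X] [Module (RestrictedEnv k p) X]
  [IsScalarTower k (RestrictedEnv k p) X]

variable (k p M) in
/-- The canonical map `M → Z(M)`. -/
def toInduced : M →ₗ[k] Induced k p M :=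
  (balancedRel k p M).mkQ.restrictScalars k ∘ₗ TensorProduct.mk k (RestrictedEnv k p) M 1

theorem mk_tmul_eq (u : RestrictedEnv k p) (m : M) :
    (balancedRel k p M).mkQ (u ⊗ₜ[k] m) = u • toInduced k p M m := by
  change _ = u • (balancedRel k p M).mkQ (1 ⊗ₜ[k] m)
  rw [← map_smul, TensorProduct.smul_tmul', smul_eq_mul, mul_one]

theorem toInduced_lie (D : hamFil k p 0) (m : M) :
    toInduced k p M ⁅D, m⁆ = envι k p ⟨D, D.2.1⟩ • toInduced k p M m := by
  rw [← mk_tmul_eq]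
  change (balancedRel k p M).mkQ (1 ⊗ₜ[k] ⁅D, m⁆) = _
  rw [eq_comm, ← sub_eq_zero, ← map_sub, Submodule.mkQ_apply, Submodule.Quotient.mk_eq_zero]
  exact Submodule.subset_span ⟨D, m, rfl⟩

/-- The homomorphism from `Z(M)` extending a homomorphism of `Ĥ_(0)`-modules. -/
def inducedLift (f : M →ₗ[k] X)
    (hf : ∀ (D : hamFil k p 0) (m : M), f ⁅D, m⁆ = envι k p ⟨D, D.2.1⟩ • f m) :
    Induced k p M →ₗ[RestrictedEnv k p] X :=
  (balancedRel k p M).liftQ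
    (TensorProduct.AlgebraTensorModule.lift
      ((LinearMap.toSpanSingleton (RestrictedEnv k p) (M →ₗ[k] X) f))) (by
    rw [balancedRel, Submodule.span_le]
    rintro _ ⟨D, m, rfl⟩
    simp [hf])

theorem inducedLift_toInduced (f : M →ₗ[k] X)
    (hf : ∀ (D : hamFil k p 0) (m : M), f ⁅D, m⁆ = envι k p ⟨D, D.2.1⟩ • f m) (m : M) :
    inducedLift f hf (toInduced k p M m) = f m := by
  refine (Submodule.liftQ_apply _ _ _).trans ?_
  simp

variable (k p M) in
/-- The map from which `Z(M)` is seen to be spanned by ordered monomials. -/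
def pbwMap : (Fin p × Fin p → M) →ₗ[k] Induced k p M :=
  ∑ ij : Fin p × Fin p, DistribSMul.toLinearMap k _
    (envι k p (elA k p) ^ (ij.1 : ℕ) * envι k p (elY k p) ^ (ij.2 : ℕ)) ∘ₗ
      toInduced k p M ∘ₗ LinearMap.proj ij

theorem pbwMap_surjective : Function.Surjective (pbwMap k p M) := by
  classical
  rw [← LinearMap.range_eq_top, eq_top_iff]
  rintro z -
  have hmem (i j : ℕ) (hi : i < p) (hj : j < p) (m : M) :
      envι k p (elA k p) ^ i • envι k p (elY k p) ^ j • toInduced k p M m ∈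
        LinearMap.range (pbwMap k p M) := by
    refine ⟨Pi.single (⟨i, hi⟩, ⟨j, hj⟩) m, ?_⟩
    rw [pbwMap, LinearMap.sum_apply, Finset.sum_eq_single (⟨i, hi⟩, ⟨j, hj⟩)]
    · simp [mul_smul]
    · intro b _ hb
      simp [Pi.single_eq_of_ne hb]
    · simp
  obtain ⟨t, rfl⟩ := Submodule.mkQ_surjective _ z
  induction t with
  | zero => rw [map_zero]; exact zero_mem _
  | add a b ha hb => rw [map_add]; exact add_mem ha hb
  | tmul u m =>
    rw [mk_tmul_eq]
    have h := smul_mem_span_monomials (k := k) (p := p) (X := Induced k p M)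
      (V := LinearMap.range (toInduced k p M)) (fun D hD v hv => by
        obtain ⟨m, rfl⟩ := hv
        exact ⟨⁅(⟨D, D.2, hD⟩ : hamFil k p 0), m⁆, toInduced_lie _ _⟩) u ⟨m, rfl⟩
    refine (iSup_le fun n => Submodule.span_le.2 ?_ :
      _ ≤ LinearMap.range (pbwMap k p M)) h
    rintro _ ⟨i, j, hi, hj, -, _, ⟨m, rfl⟩, rfl⟩
    exact hmem i j hi hj m

/-- A surjection from `Z(M)` onto a module of dimension `p² dim M` is an isomorphism. -/
theorem bijective_of_surjective [FiniteDimensional k M] [FiniteDimensional k X]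
    (f : Induced k p M →ₗ[RestrictedEnv k p] X) (hf : Function.Surjective f)
    (hX : Module.finrank k X = p ^ 2 * Module.finrank k M) : Function.Bijective f := by
  refine ⟨?_, hf⟩
  have h : Function.Surjective (f.restrictScalars k ∘ₗ pbwMap k p M) :=
    hf.comp pbwMap_surjective
  -- A surjection between spaces of the same finite dimension is injective, and `pbwMap` is onto, so
  -- `f` itself is injective.
  have h2 : Function.Injective (f.restrictScalars k ∘ₗ pbwMap k p M) := by
    rwa [LinearMap.injective_iff_surjective_of_finrank_eq_finrank]
    rw [hX, Module.finrank_pi_fintype]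
    simp [sq]
  exact Function.Injective.of_comp_right h2 pbwMap_surjective

end Induced

/-! ### The linear part of `Ĥ_(0)` -/

section LinearPart

variable {k : Type*} [Field k] {p : ℕ}

theorem exists_linear_part {f : TruncPoly k p} (hf : f ∈ maxIdeal k p) :
    ∃ α β : k, f - α • coord k p 0 - β • coord k p 1 ∈ maxIdeal k p ^ 2 := by
  have hr : Set.range (coord k p) = {coord k p 0, coord k p 1} := by
    refine (Set.range_eq_iff _ _).2 ⟨fun i => by fin_cases i <;> simp, fun b hb => ?_⟩
    rcases hb with rfl | rfl
    exacts [⟨0, rfl⟩, ⟨1, rfl⟩]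
  rw [maxIdeal, hr, Ideal.mem_span_pair] at hf
  obtain ⟨u, v, rfl⟩ := hf
  obtain ⟨α, hα⟩ := exists_sub_algebraMap_mem u
  obtain ⟨β, hβ⟩ := exists_sub_algebraMap_mem v
  refine ⟨α, β, ?_⟩
  rw [Algebra.smul_def, Algebra.smul_def, show u * coord k p 0 + v * coord k p 1
      - algebraMap k _ α * coord k p 0 - algebraMap k _ β * coord k p 1 =
    (u - algebraMap k _ α) * coord k p 0 + (v - algebraMap k _ β) * coord k p 1 by ring, sq]
  exact add_mem (Ideal.mul_mem_mul hα (coord_mem_maxIdeal 0))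
    (Ideal.mul_mem_mul hβ (coord_mem_maxIdeal 1))

variable [CharP k p]

theorem del_mem_maxIdeal (i : Fin 2) {f : TruncPoly k p} (hf : f ∈ maxIdeal k p ^ 2) :
    del k p i f ∈ maxIdeal k p := by
  rw [sq] at hf
  induction hf using Submodule.mul_induction_on' with
  | mem_mul_mem a ha b hb =>
    rw [Derivation.leibniz]
    exact add_mem (Ideal.mul_mem_right _ _ ha) (Ideal.mul_mem_right _ _ hb)
  | add a _ b _ ha hb => rw [map_add]; exact add_mem ha hb

variable [Fact p.Prime]

omit [CharP k p] in
theorem mul_top_monom {f : TruncPoly k p} (hf : f ∈ maxIdeal k p) :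
    f * monom k p (p - 1) (p - 1) = 0 := by
  have hp := (Fact.out : p.Prime).pos
  induction hf using Submodule.span_induction with
  | mem f hf =>
    obtain ⟨i, rfl⟩ := hf
    fin_cases i
    · change coord k p 0 * _ = 0
      rw [← monom_one_zero, monom_mul_monom, monom_eq_zero_of_left_le (by omega)]
    · change coord k p 1 * _ = 0
      rw [← monom_zero_one, monom_mul_monom, monom_eq_zero_of_right_le _ (by omega)]
  | zero => rw [zero_mul]
  | add a b _ _ ha hb => rw [add_mul, ha, hb, add_zero]
  | smul a f _ hf => rw [smul_eq_mul, mul_assoc, hf, mul_zero]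

/-- Differentiate `f x^(p-1) y^(p-1) = 0`: the derivative of `f` is still in the maximal ideal and
kills the monomial too. This is why `Ĥ_(1)` annihilates the top monomial and the top forms. -/
theorem mul_del_top_monom (i : Fin 2) {f : TruncPoly k p} (hf : f ∈ maxIdeal k p ^ 2) :
    f * del k p i (monom k p (p - 1) (p - 1)) = 0 := by
  have h := congrArg (del k p i) (mul_top_monom (Ideal.pow_le_self two_ne_zero hf))
  rw [Derivation.leibniz, map_zero, smul_eq_mul, smul_eq_mul, mul_comm (monom k p _ _),
    mul_top_monom (del_mem_maxIdeal i hf), add_zero] at h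
  exact h

variable (k p) in
theorem hamA_two_eq : hamA k p 2 =
    vf (coord k p 1) (coord k p 0 ^ (p - 1) * dpow (coord k p 1) 2) := by
  rw [hamA_eq, show ((2 : ℕ) : ℤ) - 1 = 1 by norm_num, dpow_one]
  rfl

omit [CharP k p] [Fact p.Prime] in
theorem dpow_two_mem (n : ℕ) : coord k p 0 ^ n * dpow (coord k p 1) 2 ∈ maxIdeal k p ^ 2 := by
  have h := dpow_natCast (coord k p 1) 2
  rw [Nat.cast_two] at h
  rw [h, Algebra.smul_def]
  exact Ideal.mul_mem_left _ _ (Ideal.mul_mem_left _ _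
    (Ideal.pow_mem_pow (coord_mem_maxIdeal 1) 2))

/-- Modulo the square of the maximal ideal the field sends `x` to `y` and `y` to `0`. Two
applications land in that square, which the field preserves. -/
theorem pMap_hamA_two_mem : pMap (hamA k p 2) ∈ wittFil k p 1 := by
  have hp := (Fact.out : p.Prime).two_le
  have hI (q : ℕ) {f : TruncPoly k p} (hf : f ∈ maxIdeal k p ^ 2) :
      (hamA k p 2)^[q] f ∈ maxIdeal k p ^ 2 := by
    induction q with
    | zero => exact hf
    | succ q ih =>
      rw [Function.iterate_succ_apply']
      generalize (hamA k p 2)^[q] f = w at ih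
      rw [hamA_two_eq, vf_apply, sq]
      exact add_mem (Ideal.mul_mem_mul (coord_mem_maxIdeal 1) (del_mem_maxIdeal 0 ih))
        (Ideal.mul_mem_mul (Ideal.pow_le_self two_ne_zero (dpow_two_mem _))
          (del_mem_maxIdeal 1 ih))
  have h1 : hamA k p 2 (coord k p 1) ∈ maxIdeal k p ^ 2 := by
    rw [hamA_two_eq, vf_coord_one]
    exact dpow_two_mem _
  have h0 : hamA k p 2 (coord k p 0) = coord k p 1 := by
    rw [hamA_two_eq, vf_coord_zero]
  intro i
  have h := congrArg (fun n => (hamA k p 2)^[n] (coord k p i))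
    (show p = (p - 2) + 1 + 1 by omega)
  rw [pMap_apply, show (hamA k p 2)^[p] (coord k p i) = _ from h, Function.iterate_succ_apply,
    Function.iterate_succ_apply]
  refine hI _ ?_
  fin_cases i
  · change hamA k p 2 (hamA k p 2 (coord k p 0)) ∈ _
    rw [h0]
    exact h1
  · exact hI 1 h1

variable (k p)

/-- `x ∂_y` as an element of `Ĥ_(0)`. -/
def elE (hp : 3 ≤ p) : hamFil k p 0 :=
  ⟨coord k p 0 • del k p 1, xdy_mem_hamHat k p hp, coord_smul_del_mem_wittFil k p 0 1⟩

/-- `y ∂_x - x^(p-1) y^(2) ∂_y` as an element of `Ĥ_(0)`. -/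
def elF (hp : 3 ≤ p) : hamFil k p 0 :=
  ⟨hamA k p 2, hamA_mem k p 2 (by omega), by
    rw [hamA_two_eq]
    refine vf_mem_wittFil.2 ?_
    rw [zero_add, pow_one]
    exact ⟨coord_mem_maxIdeal 1, Ideal.pow_le_self two_ne_zero (dpow_two_mem _)⟩⟩

variable {k p}

theorem coe_xdx : (xdx k p : Witt k p) = vf (coord k p 0) 0 :=
  ((congrArg _ (zero_smul _ _)).trans (add_zero _)).symm

theorem coe_ydy : (ydy k p : Witt k p) = vf 0 (coord k p 1) :=
  ((congrArg (· + _) (zero_smul _ _)).trans (zero_add _)).symm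

theorem coe_elE (hp : 3 ≤ p) : (elE k p hp : Witt k p) = vf 0 (coord k p 0) :=
  ((congrArg (· + _) (zero_smul _ _)).trans (zero_add _)).symm

theorem coe_elF (hp : 3 ≤ p) : (elF k p hp : Witt k p) =
    vf (coord k p 1) (coord k p 0 ^ (p - 1) * dpow (coord k p 1) 2) := hamA_two_eq k p

/-- Every element of `Ĥ_(0)` has a linear part. -/
theorem exists_linear_part_hamFil (hp : 3 ≤ p) (D : hamFil k p 0) :
    ∃ α β γ δ : k, ∃ D₁ : hamFil k p 0, (D₁ : Witt k p) ∈ hamFil k p 1 ∧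
      D = α • xdx k p + β • ydy k p + γ • elE k p hp + δ • elF k p hp + D₁ := by
  have hD := D.2.2
  have hD0 := hD 0
  have hD1 := hD 1
  rw [zero_add, pow_one] at hD0 hD1
  obtain ⟨α, δ, h0⟩ := exists_linear_part hD0
  obtain ⟨γ, β, h1⟩ := exists_linear_part hD1
  refine ⟨α, β, γ, δ, D - (α • xdx k p + β • ydy k p + γ • elE k p hp + δ • elF k p hp),
    ⟨(D - (α • xdx k p + β • ydy k p + γ • elE k p hp + δ • elF k p hp)).2.1, fun i => ?_⟩,
    by abel⟩
  have h (i : Fin 2) : (((D - (α • xdx k p + β • ydy k p + γ • elE k p hp + δ • elF k p hp) :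
      hamFil k p 0)) : Witt k p) (coord k p i) = (D : Witt k p) (coord k p i) -
      (α • vf (coord k p 0) 0 (coord k p i) + β • vf 0 (coord k p 1) (coord k p i) +
        γ • vf 0 (coord k p 0) (coord k p i) +
        δ • vf (coord k p 1) (coord k p 0 ^ (p - 1) * dpow (coord k p 1) 2) (coord k p i)) := by
    rw [← coe_xdx, ← coe_ydy, ← coe_elE hp, ← coe_elF hp]
    rfl
  rw [h]
  fin_cases i
  · change (D : Witt k p) (coord k p 0) - (α • vf (coord k p 0) 0 (coord k p 0)
        + β • vf 0 (coord k p 1) (coord k p 0) + γ • vf 0 (coord k p 0) (coord k p 0) +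
        δ • vf (coord k p 1) (coord k p 0 ^ (p - 1) * dpow (coord k p 1) 2) (coord k p 0)) ∈ _
    rw [vf_coord_zero, vf_coord_zero, vf_coord_zero, vf_coord_zero, smul_zero, smul_zero, add_zero,
      add_zero, ← sub_sub]
    exact h0
  · change (D : Witt k p) (coord k p 1) - (α • vf (coord k p 0) 0 (coord k p 1)
        + β • vf 0 (coord k p 1) (coord k p 1) + γ • vf 0 (coord k p 0) (coord k p 1) +
        δ • vf (coord k p 1) (coord k p 0 ^ (p - 1) * dpow (coord k p 1) 2) (coord k p 1)) ∈ _
    rw [vf_coord_one, vf_coord_one, vf_coord_one, vf_coord_one, smul_zero, zero_add, ← sub_sub,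
      add_comm (β • _), ← sub_sub]
    refine sub_mem h1 ?_
    rw [Algebra.smul_def]
    exact Ideal.mul_mem_left _ _ (dpow_two_mem _)

omit [Fact p.Prime] in
theorem vf_sub (f g f' g' : TruncPoly k p) : vf f g - vf f' g' = vf (f - f') (g - g') := by
  refine witt_ext k p fun i => ?_
  change vf f g _ - vf f' g' _ = vf (f - f') (g - g') _
  simp only [vf_apply]
  ring

omit [CharP k p] in
theorem coord_mul_pow : coord k p 0 * coord k p 0 ^ (p - 1) = 0 := by
  rw [mul_comm, pow_sub_one_mul (Fact.out : p.Prime).ne_zero, coord_pow]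

omit [Fact p.Prime] in
theorem two_ne_zero_of_le (hp : 3 ≤ p) : (2 : k) ≠ 0 := by
  have h := natCast_ne_zero_of_lt (k := k) (n := 2) (p := p) two_ne_zero (by omega)
  exact_mod_cast h

omit [Fact p.Prime] in
theorem sq_eq_dpow_two (hp : 3 ≤ p) : coord k p 1 ^ 2 = 2 * dpow (coord k p 1) 2 := by
  have h := dpow_natCast (coord k p 1) 2
  rw [Nat.cast_two] at h
  have h2 : (2 : TruncPoly k p) = algebraMap k _ 2 := (map_ofNat _ 2).symm
  rw [h, h2, ← Algebra.smul_def, smul_smul, Nat.factorial_two, Nat.cast_two,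
    mul_inv_cancel₀ (two_ne_zero_of_le hp), one_smul]

omit [Fact p.Prime] in
theorem del_dpow_two (hp : 3 ≤ p) : del k p 1 (dpow (coord k p 1) 2) = coord k p 1 := by
  have h := del_dpow (k := k) (p := p) 1 (n := 2) hp
  rw [show ((2 : ℕ) : ℤ) - 1 = 1 by norm_num, dpow_one] at h
  exact h

theorem xdx_pow : coord k p 0 * del k p 0 (coord k p 0 ^ (p - 1)) = -coord k p 0 ^ (p - 1) := by
  have h := xdx_apply_monom (k := k) (p := p) (p - 1) 0
  have hp := (Fact.out : p.Prime).one_le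
  rw [Nat.cast_sub hp, CharP.cast_eq_zero, Nat.cast_one, zero_sub, neg_smul, one_smul] at h
  simpa [monom] using h

/-- This and the following relations hold exactly, not just modulo `Ĥ_(1)`. The correction in `elF`
is harmless since `x^p = 0`, and since `p - 1 = -1` in `k` gives `x^(p-1) y^2 ∂_y` the same weight
as `y ∂_x`. -/
theorem lie_elE_elF (hp : 3 ≤ p) : ⁅elE k p hp, elF k p hp⁆ = xdx k p - ydy k p := by
  refine Subtype.ext ?_
  change ⁅(elE k p hp : Witt k p), (elF k p hp : Witt k p)⁆ = (xdx k p : Witt k p) - (ydy k p : Witt k p)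
  rw [coe_elE, coe_elF, coe_xdx, coe_ydy, vf_lie, vf_sub]
  congr 1
  · simp [vf_apply, del_coord]
  · simp only [vf_apply, del_coord, Derivation.leibniz, del_dpow_two hp, del_one_pow_coord_zero,
      smul_eq_mul, if_true, one_ne_zero, if_false]
    linear_combination (coord k p 1) * coord_mul_pow (k := k) (p := p)

theorem lie_xdx_elE (hp : 3 ≤ p) : ⁅xdx k p, elE k p hp⁆ = elE k p hp := by
  refine Subtype.ext ?_
  change ⁅(xdx k p : Witt k p), (elE k p hp : Witt k p)⁆ = (elE k p hp : Witt k p)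
  rw [coe_elE, coe_xdx, vf_lie]
  congr 1 <;> simp [vf_apply, del_coord]

theorem lie_ydy_elE (hp : 3 ≤ p) : ⁅ydy k p, elE k p hp⁆ = -elE k p hp := by
  refine Subtype.ext ?_
  change ⁅(ydy k p : Witt k p), (elE k p hp : Witt k p)⁆ = -(elE k p hp : Witt k p)
  rw [coe_elE, coe_ydy, vf_lie, ← zero_sub (vf _ _), ← sub_self (vf 0 0), vf_sub, vf_sub]
  congr 1 <;> simp [vf_apply, del_coord]

theorem lie_xdx_elF (hp : 3 ≤ p) : ⁅xdx k p, elF k p hp⁆ = -elF k p hp := by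
  refine Subtype.ext ?_
  change ⁅(xdx k p : Witt k p), (elF k p hp : Witt k p)⁆ = -(elF k p hp : Witt k p)
  rw [coe_elF, coe_xdx, vf_lie, ← zero_sub (vf _ _), ← sub_self (vf 0 0), vf_sub, vf_sub]
  congr 1
  · simp [vf_apply, del_coord]
  · simp only [vf_apply, Derivation.leibniz, map_zero, smul_eq_mul]
    rw [del_dpow_of_ne (show (0 : Fin 2) ≠ 1 by decide)]
    linear_combination (dpow (coord k p 1) 2) * xdx_pow (k := k) (p := p)

theorem lie_ydy_elF (hp : 3 ≤ p) : ⁅ydy k p, elF k p hp⁆ = elF k p hp := by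
  refine Subtype.ext ?_
  change ⁅(ydy k p : Witt k p), (elF k p hp : Witt k p)⁆ = (elF k p hp : Witt k p)
  rw [coe_elF, coe_ydy, vf_lie]
  congr 1
  · simp [vf_apply, del_coord]
  · simp only [vf_apply, del_coord, Derivation.leibniz, smul_eq_mul, del_dpow_two hp,
      del_one_pow_coord_zero, if_true, zero_ne_one, if_false]
    linear_combination (coord k p 0 ^ (p - 1)) * sq_eq_dpow_two (k := k) hp

/-- The elements `x ∂_y` and `y ∂_x - x^(p-1) y^(2) ∂_y` generate a copy of `sl_2`. -/
theorem isSl2Triple (hp : 3 ≤ p) :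
    IsSl2Triple (xdx k p - ydy k p) (elE k p hp) (elF k p hp) where
  h_ne_zero h := by
    have h1 : vf (coord k p 0 - 0) (0 - coord k p 1) = 0 := by
      rw [← vf_sub, ← coe_xdx, ← coe_ydy]
      exact congrArg Subtype.val h
    have h2 := congrArg (fun D : Witt k p => D (coord k p 0)) h1
    rw [vf_coord_zero, sub_zero, Derivation.zero_apply, ← monom_one_zero] at h2
    exact monom_ne_zero (by omega) (by omega) h2
  lie_e_f := lie_elE_elF hp
  lie_h_e_nsmul := by rw [sub_lie, lie_xdx_elE, lie_ydy_elE, sub_neg_eq_add, two_nsmul]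
  lie_h_f_nsmul := by rw [sub_lie, lie_xdx_elF, lie_ydy_elF, two_nsmul]; abel

end LinearPart

/-! ### Simple modules over the linear part, by `sl_2` theory -/

section HighestWeight

variable {k : Type*} [Field k] {p : ℕ} [CharP k p] [Fact p.Prime]
  {M : Type*} [AddCommGroup M] [Module k M]
  [LieRingModule (hamFil k p 0) M] [LieModule k (hamFil k p 0) M]

theorem lie_mem_of_linear_part (hp : 3 ≤ p)
    (h1 : ∀ D : hamFil k p 0, (D : Witt k p) ∈ hamFil k p 1 → ∀ m : M, ⁅D, m⁆ = 0)
    {P : Submodule k M} (hx : ∀ m ∈ P, ⁅xdx k p, m⁆ ∈ P) (hy : ∀ m ∈ P, ⁅ydy k p, m⁆ ∈ P)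
    (he : ∀ m ∈ P, ⁅elE k p hp, m⁆ ∈ P) (hf : ∀ m ∈ P, ⁅elF k p hp, m⁆ ∈ P)
    (D : hamFil k p 0) {m : M} (hm : m ∈ P) : ⁅D, m⁆ ∈ P := by
  obtain ⟨α, β, γ, δ, D₁, hD₁, rfl⟩ := exists_linear_part_hamFil hp D
  simp only [add_lie, smul_lie, h1 D₁ hD₁, add_zero]
  exact add_mem (add_mem (add_mem (P.smul_mem _ (hx m hm)) (P.smul_mem _ (hy m hm)))
    (P.smul_mem _ (he m hm))) (P.smul_mem _ (hf m hm))

open LieModule in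
/-- The structure of the simple module whose highest weight is `(a, b)` with `a - b = r`. -/
theorem IsSimpleOfHighestWeight.exists_vector (hp : 3 ≤ p) {a b : ZMod p}
    (hM : IsSimpleOfHighestWeight k p a b M) (r : ℕ) (hr : r < p) (hab : a - b = r) :
    ∃ m : M, m ≠ 0 ∧ ⁅xdx k p, m⁆ = ZMod.castHom (dvd_refl p) k a • m ∧
      ⁅ydy k p, m⁆ = ZMod.castHom (dvd_refl p) k b • m ∧ ⁅elE k p hp, m⁆ = 0 ∧
      (toEnd k (hamFil k p 0) M (elF k p hp) ^ (r + 1)) m = 0 ∧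
      Submodule.span k ((fun i => (toEnd k (hamFil k p 0) M (elF k p hp) ^ i) m) '' Set.Iic r) = ⊤ := by
  obtain ⟨m, hm, hx, hy, D, hD, he⟩ := hM.highestWeight
  obtain rfl : D = elE k p hp := Subtype.ext hD
  refine ⟨m, hm, hx, hy, he, ?_⟩
  set F := toEnd k (hamFil k p 0) M (elF k p hp) with hF
  have P : IsSl2Triple.HasPrimitiveVectorWith (isSl2Triple hp) m (r : k) :=
    ⟨hm, by
      have h := congrArg (ZMod.castHom (dvd_refl p) k) hab
      rw [map_sub, map_natCast] at h
      rw [sub_lie, hx, hy, ← sub_smul, h], he⟩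
  have hFs (i : ℕ) : ⁅elF k p hp, (F ^ i) m⁆ = (F ^ (i + 1)) m := by
    rw [pow_succ', Module.End.mul_apply]; rfl
  have hxi (i : ℕ) : ⁅xdx k p, (F ^ i) m⁆ =
      (ZMod.castHom (dvd_refl p) k a - i) • (F ^ i) m := by
    induction i with
    | zero => simpa using hx
    | succ i ih =>
      rw [← hFs, leibniz_lie, lie_xdx_elF, ih, neg_lie, lie_smul, Nat.cast_succ]
      module
  have hyi (i : ℕ) : ⁅ydy k p, (F ^ i) m⁆ =
      (ZMod.castHom (dvd_refl p) k b + i) • (F ^ i) m := by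
    induction i with
    | zero => simpa using hy
    | succ i ih =>
      rw [← hFs, leibniz_lie, lie_ydy_elF, ih, lie_smul, Nat.cast_succ]
      module
  -- Raising `F ^ (i + 1) m` gives `(i + 1)(r - i) F ^ i m`. The coefficient vanishes at `i = r`, so
  -- an index set may begin at `r + 1` without containing `r`.
  have key (I : Set ℕ) (h1 : ∀ i ∈ I, (F ^ (i + 1)) m ∈ Submodule.span k ((fun i => (F ^ i) m) '' I))
      (h2 : ∀ i, i + 1 ∈ I → i = r ∨ i ∈ I) :
      ∃ N : LieSubmodule k (hamFil k p 0) M,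
        N.toSubmodule = Submodule.span k ((fun i => (F ^ i) m) '' I) := by
    have hstab (D : hamFil k p 0) (h : ∀ i ∈ I, ⁅D, (F ^ i) m⁆ ∈
        Submodule.span k ((fun i => (F ^ i) m) '' I)) :
        ∀ v ∈ Submodule.span k ((fun i => (F ^ i) m) '' I), ⁅D, v⁆ ∈
          Submodule.span k ((fun i => (F ^ i) m) '' I) := by
      have h3 : Submodule.span k ((fun i => (F ^ i) m) '' I) ≤
          (Submodule.span k ((fun i => (F ^ i) m) '' I)).comap (toEnd k _ M D) := by
        rw [Submodule.span_le]
        rintro _ ⟨i, hi, rfl⟩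
        exact h i hi
      exact h3
    have hmem (i : ℕ) (hi : i ∈ I) : (F ^ i) m ∈ Submodule.span k ((fun i => (F ^ i) m) '' I) :=
      Submodule.subset_span ⟨i, hi, rfl⟩
    refine ⟨{ Submodule.span k ((fun i => (F ^ i) m) '' I) with
      lie_mem := fun {D v} hv => lie_mem_of_linear_part hp hM.inflated
        (hstab _ fun i hi => ?_) (hstab _ fun i hi => ?_) (hstab _ fun i hi => ?_)
        (hstab _ fun i hi => ?_) D hv }, rfl⟩
    · rw [hxi]; exact Submodule.smul_mem _ _ (hmem i hi)
    · rw [hyi]; exact Submodule.smul_mem _ _ (hmem i hi)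
    · rcases i with _ | i
      · rw [pow_zero, Module.End.one_apply, he]; exact zero_mem _
      · rw [P.lie_e_pow_succ_toEnd_f i]
        rcases h2 i hi with rfl | h
        · rw [sub_self, mul_zero, zero_smul]; exact zero_mem _
        · exact Submodule.smul_mem _ _ (hmem i h)
    · rw [hFs]; exact h1 i hi
  have hsimple := hM.simple
  -- The vectors `F ^ i m` with `i > r` span a submodule. Were it everything, `F` would be
  -- surjective; but `F ^ p = 0`, because the `p`-th power of `elF` lies in `Ĥ_(1)`.
  have hFr : (F ^ (r + 1)) m = 0 := by
    obtain ⟨N, hN⟩ := key (Set.Ici (r + 1))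
      (fun i hi => Submodule.subset_span ⟨i + 1, by simp only [Set.mem_Ici] at hi ⊢; omega, rfl⟩)
      (fun i hi => by simp only [Set.mem_Ici] at hi ⊢; omega)
    have hmem : (F ^ (r + 1)) m ∈ N.toSubmodule := by
      rw [hN]
      exact Submodule.subset_span ⟨r + 1, Set.mem_Ici.2 le_rfl, rfl⟩
    rcases IsSimpleOrder.eq_bot_or_eq_top N with h | h
    · rw [h] at hmem
      exact hmem
    · exfalso
      have hFp : F ^ p = 0 := by
        have h3 : (pMap (hamA k p 2) : Witt k p) ∈ hamFil k p 1 :=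
          ⟨pMap_mem_hamHat k p (hamA_mem k p 2 (by omega)), pMap_hamA_two_mem⟩
        have h4 := hM.restricted (elF k p hp) ⟨pMap (hamA k p 2), h3.1, fun i =>
          Ideal.pow_le_pow_right (by omega) (h3.2 i)⟩ rfl
        rw [← hF] at h4
        rw [← h4]
        exact LinearMap.ext fun v => hM.inflated _ h3 v
      have hr : LinearMap.range F = ⊤ := by
        rw [eq_top_iff]
        refine le_trans (b := N.toSubmodule) (by rw [h]; exact le_rfl) ?_
        rw [hN, Submodule.span_le]
        rintro _ ⟨i, hi, rfl⟩
        obtain ⟨j, rfl⟩ := Nat.exists_eq_add_of_le' (show 1 ≤ i by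
          simp only [Set.mem_Ici] at hi; omega)
        exact ⟨(F ^ j) m, hFs j⟩
      have hs : Function.Surjective (F ^ p) := by
        rw [Module.End.coe_pow]
        exact (LinearMap.range_eq_top.1 hr).iterate p
      obtain ⟨v, hv⟩ := hs m
      rw [hFp] at hv
      exact hm hv.symm
  refine ⟨hFr, ?_⟩
  obtain ⟨N, hN⟩ := key (Set.Iic r)
    (fun i hi => by
      rcases (Set.mem_Iic.1 hi).lt_or_eq with h | rfl
      · exact Submodule.subset_span ⟨i + 1, Set.mem_Iic.2 h, rfl⟩
      · rw [hFr]; exact zero_mem _)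
    (fun i hi => Or.inr (by simp only [Set.mem_Iic] at hi ⊢; omega))
  rw [← hN]
  rcases IsSimpleOrder.eq_bot_or_eq_top N with h | h
  · have hmem : m ∈ N.toSubmodule := by
      rw [hN]
      exact Submodule.subset_span ⟨0, Set.mem_Iic.2 (Nat.zero_le r), rfl⟩
    rw [h] at hmem
    exact absurd hmem hm
  · rw [h]; rfl

end HighestWeight

/-! ### Induced modules as modules of functions and forms -/

section TopForms

variable {k : Type*} [Field k] {p : ℕ} [CharP k p] [Fact p.Prime]

variable (k p) in
/-- The monomial of highest degree. -/
abbrev topMonom : TruncPoly k p := monom k p (p - 1) (p - 1)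

theorem funAct_topMonom (c : k) {f g : TruncPoly k p} (hf : f ∈ maxIdeal k p ^ 2)
    (hg : g ∈ maxIdeal k p ^ 2) : funAct c (vf f g) (topMonom k p) = 0 := by
  rw [funAct_vf, mul_del_top_monom 0 hf, mul_del_top_monom 1 hg, add_mul,
    mul_top_monom (del_mem_maxIdeal 0 hf), mul_top_monom (del_mem_maxIdeal 1 hg)]
  simp

theorem formAct_topMonom (c : k) {f g : TruncPoly k p} (hf : f ∈ maxIdeal k p ^ 2)
    (hg : g ∈ maxIdeal k p ^ 2) :
    formAct c (vf f g) (topMonom k p, 0) = 0 ∧ formAct c (vf f g) (0, topMonom k p) = 0 := by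
  have h (i : Fin 2) {f : TruncPoly k p} (hf : f ∈ maxIdeal k p ^ 2) :=
    mul_top_monom (del_mem_maxIdeal i hf)
  simp only [formAct_vf, mul_del_top_monom _ hf, mul_del_top_monom _ hg, add_mul, h _ hf, h _ hg,
    map_zero, mul_zero, add_zero]
  exact ⟨rfl, rfl⟩

theorem natCast_pred : ((p - 1 : ℕ) : k) = -1 := by
  rw [Nat.cast_sub (Fact.out : p.Prime).one_le, CharP.cast_eq_zero, Nat.cast_one, zero_sub]

theorem xdx_topMonom : coord k p 0 * del k p 0 (topMonom k p) = -topMonom k p := by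
  rw [xdx_apply_monom, natCast_pred, neg_smul, one_smul]

theorem ydy_topMonom : coord k p 1 * del k p 1 (topMonom k p) = -topMonom k p := by
  rw [ydy_apply_monom, natCast_pred, neg_smul, one_smul]

theorem xdy_topMonom : coord k p 0 * del k p 1 (topMonom k p) = 0 := by
  have hp := (Fact.out : p.Prime).pos
  rw [del_one_monom, mul_smul_comm, ← monom_one_zero, monom_mul_monom,
    monom_eq_zero_of_left_le (by omega), smul_zero]

theorem ydx_topMonom : coord k p 1 * del k p 0 (topMonom k p) = 0 := by
  have hp := (Fact.out : p.Prime).pos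
  rw [del_zero_monom, mul_smul_comm, ← monom_zero_one, monom_mul_monom,
    monom_eq_zero_of_right_le _ (by omega), smul_zero]

theorem formAct_hamA_one_left (c : k) (u : TruncPoly k p) :
    formAct c (hamA k p 1) (u, 0) = (funAct c (hamA k p 1) u, 0) := by
  rw [hamA_one_eq, formAct_vf, funAct_vf, Derivation.map_one_eq_zero, Derivation.map_one_eq_zero]
  simp

omit [Fact p.Prime] in
theorem formAct_dy (c : k) (u v : TruncPoly k p) :
    formAct c (hamB k p 1 0) (u, v) =
      (funAct c (hamB k p 1 0) u, funAct (c + 1) (hamB k p 1 0) v) := by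
  rw [← dy_eq, formAct_vf, funAct_vf, funAct_vf, Derivation.map_one_eq_zero,
    Derivation.map_one_eq_zero]
  simp

theorem formAct_hamA_one_right (c : k) (v : TruncPoly k p) :
    ∃ u, formAct c (hamA k p 1) (0, v) = (u, funAct (c + 1) (hamA k p 1) v) := by
  refine ⟨_, Prod.ext rfl ?_⟩
  rw [hamA_one_eq, formAct_vf, funAct_vf, Derivation.map_one_eq_zero, RingHom.map_add,
    RingHom.map_one]
  ring

/-- For the two lowering operators the forms `u dx` are an invariant subspace acting like functions
of twist `c`, and the quotient by it acts like functions of twist `c + 1`. In each of the two the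
top monomial generates. -/
theorem eq_top_of_topForms_mem (c : k) {N : Submodule k (TruncPoly k p × TruncPoly k p)}
    (hA : ∀ w ∈ N, formAct c (hamA k p 1) w ∈ N) (hY : ∀ w ∈ N, formAct c (hamB k p 1 0) w ∈ N)
    (h0 : (topMonom k p, 0) ∈ N) (h1 : (0, topMonom k p) ∈ N) : N = ⊤ := by
  have hl (u : TruncPoly k p) : (u, 0) ∈ N := by
    have h : N.comap (LinearMap.inl k _ _) = ⊤ :=
      eq_top_of_top_monom_mem (c := c) (fun h hh => by
        have := hA _ hh
        rwa [LinearMap.inl_apply, formAct_hamA_one_left] at this)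
        (fun h hh => by
        have := hY _ hh
        rwa [LinearMap.inl_apply, formAct_dy, map_zero] at this) h0
    have hu : u ∈ N.comap (LinearMap.inl k _ _) := by rw [h]; trivial
    exact hu
  have hr (v : TruncPoly k p) : (0, v) ∈ N := by
    have h : N.comap (LinearMap.inr k _ _) = ⊤ :=
      eq_top_of_top_monom_mem (c := c + 1) (fun h hh => by
        have h2 := hA _ hh
        obtain ⟨u, hu⟩ := formAct_hamA_one_right c h
        rw [LinearMap.inr_apply, hu] at h2
        have h3 := N.sub_mem h2 (hl u)
        rwa [Prod.mk_sub_mk, sub_self, sub_zero] at h3)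
        (fun h hh => by
        have := hY _ hh
        rwa [LinearMap.inr_apply, formAct_dy, map_zero] at this) h1
    have hv : v ∈ N.comap (LinearMap.inr k _ _) := by rw [h]; trivial
    exact hv
  rw [eq_top_iff]
  rintro ⟨u, v⟩ -
  have h := add_mem (hl u) (hr v)
  rwa [Prod.mk_add_mk, add_zero, zero_add] at h

end TopForms

/-! ### Isomorphisms of induced modules with functions and forms -/

section Realization

variable {k : Type*} [Field k] {p : ℕ} [CharP k p] [Fact p.Prime]
  {M : Type*} [AddCommGroup M] [Module k M]
  [LieRingModule (hamFil k p 0) M] [LieModule k (hamFil k p 0) M]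

/-- Every element of `Ĥ_(0)` is a combination of four linear elements and one in `Ĥ_(1)`, so
equivariance needs only these to be tested on a spanning set. -/
theorem map_lie_of_linear_part (hp : 3 ≤ p)
    (h1 : ∀ D : hamFil k p 0, (D : Witt k p) ∈ hamFil k p 1 → ∀ m : M, ⁅D, m⁆ = 0)
    {V : Type*} [AddCommGroup V] [Module k V] (ρ : RestrictedRep k p V) (f : M →ₗ[k] V)
    {s : Set M} (hs : Submodule.span k s = ⊤)
    (hf1 : ∀ g h : TruncPoly k p, g ∈ maxIdeal k p ^ 2 → h ∈ maxIdeal k p ^ 2 → ∀ m ∈ s,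
      ρ.act (vf g h) (f m) = 0)
    (hx : ∀ m ∈ s, f ⁅xdx k p, m⁆ = ρ.act (vf (coord k p 0) 0) (f m))
    (hy : ∀ m ∈ s, f ⁅ydy k p, m⁆ = ρ.act (vf 0 (coord k p 1)) (f m))
    (he : ∀ m ∈ s, f ⁅elE k p hp, m⁆ = ρ.act (vf 0 (coord k p 0)) (f m))
    (hF : ∀ m ∈ s, f ⁅elF k p hp, m⁆ =
      ρ.act (vf (coord k p 1) (coord k p 0 ^ (p - 1) * dpow (coord k p 1) 2)) (f m))
    (D : hamFil k p 0) (m : M) : f ⁅D, m⁆ = ρ.act D (f m) := by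
  have h : f ∘ₗ LieModule.toEnd k (hamFil k p 0) M D = ρ.act D ∘ₗ f := by
    refine LinearMap.ext_on hs fun m hm => ?_
    obtain ⟨α, β, γ, δ, D₁, hD₁, rfl⟩ := exists_linear_part_hamFil hp D
    have hD₁' := hf1 _ _ (hD₁.2 0) (hD₁.2 1) m hm
    rw [← eq_vf] at hD₁'
    change f ⁅_, m⁆ = ρ.act (α • (xdx k p : Witt k p) + β • (ydy k p : Witt k p) +
      γ • (elE k p hp : Witt k p) + δ • (elF k p hp : Witt k p) + (D₁ : Witt k p)) (f m)
    rw [coe_xdx, coe_ydy, coe_elE, coe_elF]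
    simp only [add_lie, smul_lie, h1 D₁ hD₁, map_add, map_smul, hx m hm, hy m hm, he m hm, hF m hm,
      LinearMap.add_apply, LinearMap.smul_apply, hD₁', map_zero]
  exact LinearMap.congr_fun h m

theorem span_Iic_one {m m' : M} (F : Module.End k M) (hm' : F m = m')
    (h : Submodule.span k ((fun i => (F ^ i) m) '' Set.Iic 1) = ⊤) :
    Submodule.span k {m, m'} = ⊤ := by
  rw [← h]
  congr 1
  ext v
  constructor
  · rintro (rfl | rfl)
    · exact ⟨0, by simp, rfl⟩
    · exact ⟨1, by simp, by simpa using hm'⟩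
  · rintro ⟨i, hi, rfl⟩
    rw [Set.mem_Iic, Nat.le_one_iff_eq_zero_or_eq_one] at hi
    rcases hi with rfl | rfl
    · exact Or.inl rfl
    · exact Or.inr (by simpa using hm')

variable (k p) in
/-- For `a - b = 1`, the module `Z(a,b)` is a module of twisted differential forms. -/
theorem IsSimpleOfHighestWeight.nonempty_equiv_formRep (hp : 3 ≤ p) {a b : ZMod p}
    (hM : IsSimpleOfHighestWeight k p a b M) (hab : a - b = 1) :
    Nonempty (Induced k p M ≃ₗ[RestrictedEnv k p] (formRep k p a).Space) := by
  obtain ⟨m, hm, hx, hy, he, hF2, hspan⟩ := hM.exists_vector hp 1 (by omega) (by simpa using hab)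
  set c := ZMod.castHom (dvd_refl p) k a with hc
  have hb : ZMod.castHom (dvd_refl p) k b = c - 1 := by
    rw [hc, ← sub_sub_cancel a b, hab, map_sub, map_one]
  rw [hb] at hy
  obtain ⟨m', hm'⟩ : ∃ m', ⁅elF k p hp, m⁆ = m' := ⟨_, rfl⟩
  have hspan2 := span_Iic_one (LieModule.toEnd k (hamFil k p 0) M (elF k p hp)) hm' hspan
  have hF' : ⁅elF k p hp, m'⁆ = 0 := by
    rw [← hm']
    simpa [pow_succ] using hF2
  have hx' : ⁅xdx k p, m'⁆ = (c - 1) • m' := by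
    rw [← hm', leibniz_lie, lie_xdx_elF, hx, neg_lie, lie_smul]
    module
  have hy' : ⁅ydy k p, m'⁆ = c • m' := by
    rw [← hm', leibniz_lie, lie_ydy_elF, hy, lie_smul]
    module
  have he' : ⁅elE k p hp, m'⁆ = m := by
    rw [← hm', leibniz_lie, lie_elE_elF, sub_lie, hx, hy, he, lie_zero]
    module
  -- The raising operator kills `m` and sends `m'` to `m`, so a linear relation loses its
  -- coefficients one by one.
  have hli : LinearIndependent k ![m, m'] := by
    rw [LinearIndependent.pair_iff]
    intro s t hst
    have h := congrArg (fun v => ⁅elE k p hp, v⁆) hst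
    simp only [lie_add, lie_smul, he, he', smul_zero, zero_add, lie_zero] at h
    obtain rfl : t = 0 := (smul_eq_zero.1 h).resolve_right hm
    rw [zero_smul, add_zero] at hst
    exact ⟨(smul_eq_zero.1 hst).resolve_right hm, rfl⟩
  let B := Module.Basis.mk hli (by rw [Matrix.range_cons_cons_empty, hspan2])
  have hB0 : B 0 = m := by simp [B]
  have hB1 : B 1 = m' := by simp [B]
  -- The form `x^(p-1) y^(p-1) dx` has weight `(-1 + 1 + c, -1 + c) = (c, c - 1)`, the weight of
  -- `m`; its `dy` companion has the weight of `m'`.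
  let f : M →ₗ[k] TruncPoly k p × TruncPoly k p :=
    B.constr k ![(topMonom k p, 0), (0, topMonom k p)]
  have hf0 : f m = (topMonom k p, 0) := by
    rw [← hB0]; exact (B.constr_basis k _ 0)
  have hf1 : f m' = (0, topMonom k p) := by
    rw [← hB1]; exact (B.constr_basis k _ 1)
  have hg2 := dpow_two_mem (k := k) (p := p) (p - 1)
  have hg0 := mul_top_monom (del_mem_maxIdeal 0 hg2)
  have hg1 := mul_top_monom (del_mem_maxIdeal 1 hg2)
  have hf := map_lie_of_linear_part hp hM.inflated (formRep k p a) f hspan2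
    (fun g h hg hh v hv => by
      rcases hv with rfl | rfl
      · rw [hf0]; exact (formAct_topMonom _ hg hh).1
      · rw [hf1]; exact (formAct_topMonom _ hg hh).2)
    (fun v hv => by
      change f _ = formAct c _ _
      rcases hv with rfl | rfl
      · rw [hx, map_smul, hf0, formAct_vf, xdx_topMonom, del_coord, Algebra.smul_def]
        simp [del_coord]
      · rw [hx', map_smul, hf1, formAct_vf, xdx_topMonom, del_coord]
        simp [del_coord, Algebra.smul_def, sub_eq_neg_add, add_mul])
    (fun v hv => by
      change f _ = formAct c _ _
      rcases hv with rfl | rfl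
      · rw [hy, map_smul, hf0, formAct_vf, ydy_topMonom, del_coord]
        simp [del_coord, Algebra.smul_def, sub_eq_neg_add, add_mul]
      · rw [hy', map_smul, hf1, formAct_vf, ydy_topMonom, del_coord]
        simp [del_coord, Algebra.smul_def])
    (fun v hv => by
      change f _ = formAct c _ _
      rcases hv with rfl | rfl
      · rw [he, map_zero, hf0, formAct_vf, xdy_topMonom]
        simp [del_coord]
        rfl
      · rw [he', hf0, hf1, formAct_vf, xdy_topMonom]
        simp [del_coord])
    (fun v hv => by
      change f _ = formAct c _ _
      rcases hv with rfl | rfl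
      · rw [hm', hf0, hf1, formAct_vf, ydx_topMonom, mul_del_top_monom 1 hg2, add_mul, hg1]
        simp [del_coord]
      · rw [hF', map_zero, hf1, formAct_vf, ydx_topMonom, mul_del_top_monom 1 hg2]
        simp only [add_mul, mul_assoc, hg1, hg0]
        simp [del_coord]
        rfl)
  let Φ := inducedLift (X := (formRep k p a).Space) (show M →ₗ[k] (formRep k p a).Space from f)
    (fun D m => (hf D m).trans (RestrictedRep.envι_smul_eq (formRep k p a) ⟨D, D.2.1⟩ (f m)).symm)
  have hsurj : Function.Surjective Φ := by
    have h : (LinearMap.range Φ).restrictScalars k = ⊤ := by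
      refine eq_top_of_topForms_mem c
        (fun w hw => RestrictedRep.act_mem _ (LinearMap.range Φ) (elA k p).2 hw)
        (fun w hw => RestrictedRep.act_mem _ (LinearMap.range Φ) (elY k p).2 hw) ?_ ?_
      · exact ⟨toInduced k p M m, (inducedLift_toInduced _ _ m).trans hf0⟩
      · exact ⟨toInduced k p M m', (inducedLift_toInduced _ _ m').trans hf1⟩
    rw [← LinearMap.range_eq_top, ← Submodule.restrictScalars_eq_top_iff k, h]
  have : FiniteDimensional k M := B.finiteDimensional_of_finite
  refine ⟨LinearEquiv.ofBijective Φ (bijective_of_surjective Φ hsurj ?_)⟩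
  rw [Module.finrank_eq_card_basis B, Fintype.card_fin]
  change Module.finrank k (TruncPoly k p × TruncPoly k p) = _
  rw [Module.finrank_prod, finrank_truncPoly]
  ring

variable (k p) in
/-- The module `Z(a,a)` is a module of twisted functions. -/
theorem IsSimpleOfHighestWeight.nonempty_equiv_funRep (hp : 3 ≤ p) {a : ZMod p}
    (hM : IsSimpleOfHighestWeight k p a a M) :
    Nonempty (Induced k p M ≃ₗ[RestrictedEnv k p] (funRep k p (a + 1)).Space) := by
  obtain ⟨m, hm, hx, hy, he, hF, hspan⟩ := hM.exists_vector hp 0 (by omega) (by simp)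
  have hF : ⁅elF k p hp, m⁆ = 0 := by simpa using hF
  have hspan2 : Submodule.span k {m} = ⊤ := by
    rwa [show Set.Iic 0 = ({0} : Set ℕ) by ext; simp, Set.image_singleton, pow_zero] at hspan
  -- In twist `c` the top monomial has weight `(c - 1, c - 1)`; hence the shift by one.
  set c := ZMod.castHom (dvd_refl p) k (a + 1) with hc
  have ha : ZMod.castHom (dvd_refl p) k a = c - 1 := by
    rw [hc, map_add, map_one, add_sub_cancel_right]
  rw [ha] at hx hy
  let B := Module.Basis.mk (v := fun _ : Unit => m) (linearIndependent_unique_iff.2 hm)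
    (by rw [Set.range_const, hspan2])
  have hB0 : B () = m := by simp [B]
  let f : M →ₗ[k] TruncPoly k p := B.constr k fun _ => topMonom k p
  have hf0 : f m = topMonom k p := by
    rw [← hB0]; exact (B.constr_basis k _ ())
  have hg2 := dpow_two_mem (k := k) (p := p) (p - 1)
  have hg1 := mul_top_monom (del_mem_maxIdeal 1 hg2)
  have hf := map_lie_of_linear_part hp hM.inflated (funRep k p (a + 1)) f hspan2
    (fun g h hg hh v hv => by
      rcases hv with rfl
      rw [hf0]; exact funAct_topMonom _ hg hh)
    (fun v hv => by
      change f _ = funAct c _ _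
      rcases hv with rfl
      rw [hx, map_smul, hf0, funAct_vf, xdx_topMonom, del_coord]
      simp [Algebra.smul_def, sub_eq_neg_add, add_mul])
    (fun v hv => by
      change f _ = funAct c _ _
      rcases hv with rfl
      rw [hy, map_smul, hf0, funAct_vf, ydy_topMonom, del_coord]
      simp [Algebra.smul_def, sub_eq_neg_add, add_mul])
    (fun v hv => by
      change f _ = funAct c _ _
      rcases hv with rfl
      rw [he, map_zero, hf0, funAct_vf, xdy_topMonom]
      simp [del_coord])
    (fun v hv => by
      change f _ = funAct c _ _
      rcases hv with rfl
      rw [hF, map_zero, hf0, funAct_vf, ydx_topMonom, mul_del_top_monom 1 hg2, add_mul, hg1]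
      simp [del_coord])
  let Φ := inducedLift (X := (funRep k p (a + 1)).Space)
    (show M →ₗ[k] (funRep k p (a + 1)).Space from f)
    (fun D m => (hf D m).trans
      (RestrictedRep.envι_smul_eq (funRep k p (a + 1)) ⟨D, D.2.1⟩ (f m)).symm)
  have hsurj : Function.Surjective Φ := by
    have h : (LinearMap.range Φ).restrictScalars k = ⊤ := by
      refine eq_top_of_top_monom_mem (c := c)
        (fun w hw => RestrictedRep.act_mem _ (LinearMap.range Φ) (elA k p).2 hw)
        (fun w hw => RestrictedRep.act_mem _ (LinearMap.range Φ) (elY k p).2 hw) ?_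
      exact ⟨toInduced k p M m, (inducedLift_toInduced _ _ m).trans hf0⟩
    rw [← LinearMap.range_eq_top, ← Submodule.restrictScalars_eq_top_iff k, h]
  have : FiniteDimensional k M := B.finiteDimensional_of_finite
  refine ⟨LinearEquiv.ofBijective Φ (bijective_of_surjective Φ hsurj ?_)⟩
  rw [Module.finrank_eq_card_basis B, Fintype.card_unit, mul_one]
  exact finrank_truncPoly

end Realization

/-! ### Covers, dimensions and composition series of submodules -/

section Covers

variable {R X Y : Type*} [Ring R] [AddCommGroup X] [Module R X] [AddCommGroup Y] [Module R Y]

/-- The correspondence between submodules containing the kernel and submodules of the range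
preserves strict inclusions in both directions. -/
theorem covBy_map (f : X →ₗ[R] Y) {A B : Submodule R X} (hA : LinearMap.ker f ≤ A) (h : A ⋖ B) :
    A.map f ⋖ B.map f := by
  have hB := hA.trans h.le
  refine ⟨(Submodule.map_mono h.le).lt_of_not_ge fun hle => h.1.not_ge ?_, fun C hAC hCB => ?_⟩
  · rw [← Submodule.comap_map_eq_self hA, ← Submodule.comap_map_eq_self hB]
    exact Submodule.comap_mono hle
  · have hC : (C.comap f).map f = C :=
      Submodule.map_comap_eq_self (hCB.le.trans LinearMap.map_le_range)
    refine h.2 (c := C.comap f) ((Submodule.map_le_iff_le_comap.1 hAC.le).lt_of_not_ge fun hle => ?_)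
      (lt_of_le_of_ne ?_ fun heq => ?_)
    · exact hAC.not_ge (hC.symm.le.trans (Submodule.map_mono hle))
    · rw [← Submodule.comap_map_eq_self hB]
      exact Submodule.comap_mono hCB.le
    · exact hCB.ne (by rw [← hC, heq])

theorem covBy_comap (f : X →ₗ[R] Y) {A B : Submodule R Y} (hB : B ≤ LinearMap.range f)
    (h : A ⋖ B) : A.comap f ⋖ B.comap f := by
  have hA := h.le.trans hB
  refine ⟨(Submodule.comap_mono h.le).lt_of_not_ge fun hle => h.1.not_ge ?_, fun C hAC hCB => ?_⟩
  · rw [← Submodule.map_comap_eq_self hA, ← Submodule.map_comap_eq_self hB]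
    exact Submodule.map_mono hle
  · have hC : (C.map f).comap f = C :=
      Submodule.comap_map_eq_self ((LinearMap.ker_le_comap f).trans hAC.le)
    refine h.2 (c := C.map f) (lt_of_le_of_ne ?_ fun heq => ?_)
      ((Submodule.map_le_iff_le_comap.2 hCB.le).lt_of_not_ge fun hle => ?_)
    · rw [← Submodule.map_comap_eq_self hA]
      exact Submodule.map_mono hAC.le
    · exact hAC.ne (by rw [heq, hC])
    · exact hCB.not_ge ((Submodule.comap_mono hle).trans hC.le)

/-- A factor of a composition series. -/
abbrev seriesFactor (s : CompositionSeries (Submodule R X)) (i : Fin s.length) : Type _ :=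
  ↥(s i.succ) ⧸ (s i.castSucc).submoduleOf (s i.succ)

/-- Two composition series of isomorphic modules have the same factors. -/
theorem exists_equiv_factors (e : X ≃ₗ[R] Y) (s : CompositionSeries (Submodule R X))
    (t : CompositionSeries (Submodule R Y)) (hs : s.head = ⊥) (hs' : s.last = ⊤)
    (ht : t.head = ⊥) (ht' : t.last = ⊤) :
    ∃ σ : Fin t.length ≃ Fin s.length, ∀ i, Nonempty
      (seriesFactor s (σ i) ≃ₗ[R] seriesFactor t i) := by
  let s' : CompositionSeries (Submodule R Y) :=
    ⟨s.length, fun i => (s i).map e.toLinearMap, fun i =>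
      covBy_map _ (by rw [LinearEquiv.ker]; exact bot_le) (s.step i)⟩
  have h0 : s'.head = t.head := by
    rw [ht]
    exact (congrArg (Submodule.map e.toLinearMap) hs).trans (Submodule.map_bot _)
  have h1 : s'.last = t.last := by
    rw [ht']
    refine (congrArg (Submodule.map e.toLinearMap) hs').trans ?_
    rw [Submodule.map_top, LinearEquiv.range]
  obtain ⟨σ, hσ⟩ := CompositionSeries.jordan_holder t s' h0.symm h1.symm
  refine ⟨σ, fun i => ⟨(Submodule.Quotient.equiv _ _ (e.submoduleMap (s (σ i).succ)) ?_).trans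
    (JordanHolderLattice.Iso.linearEquiv (hσ i)).symm⟩⟩
  ext ⟨y, hy⟩
  constructor
  · rintro ⟨⟨x, hx⟩, hx', h⟩
    exact ⟨x, hx', congrArg Subtype.val h⟩
  · rintro ⟨x, hx, rfl⟩
    exact ⟨⟨x, (s.step (σ i)).le hx⟩, hx, rfl⟩

theorem exists_compositionSeries (e : X ≃ₗ[R] Y) (t : CompositionSeries (Submodule R Y))
    (ht : t.head = ⊥) (ht' : t.last = ⊤) :
    ∃ s : CompositionSeries (Submodule R X), s.head = ⊥ ∧ s.last = ⊤ := by
  refine ⟨⟨t.length, fun i => (t i).map e.symm.toLinearMap, fun i =>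
      covBy_map _ (by rw [LinearEquiv.ker]; exact bot_le) (t.step i)⟩, ?_, ?_⟩
  · exact (congrArg (Submodule.map e.symm.toLinearMap) ht).trans (Submodule.map_bot _)
  · refine (congrArg (Submodule.map e.symm.toLinearMap) ht').trans ?_
    rw [Submodule.map_top, LinearEquiv.range]

/-- The quotient by the sum of all proper submodules, if there is a largest one. -/
theorem nonempty_quotient_sSup_equiv (e : X ≃ₗ[R] Y) {K : Submodule R Y} (hK : K ≠ ⊤)
    (h : ∀ N : Submodule R Y, N ≠ ⊤ → N ≤ K) :
    Nonempty ((X ⧸ sSup {N : Submodule R X | N ≠ ⊤}) ≃ₗ[R] Y ⧸ K) := by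
  have hs : sSup {N : Submodule R X | N ≠ ⊤} = K.comap e.toLinearMap := by
    refine le_antisymm (sSup_le fun N hN => Submodule.map_le_iff_le_comap.1 (h _ fun ht => hN ?_))
      (le_sSup fun ht => hK ?_)
    · rw [← Submodule.comap_map_eq_self (f := e.toLinearMap) (p := N)
        (by rw [LinearEquiv.ker]; exact bot_le), ht, Submodule.comap_top]
    · rw [← Submodule.map_comap_eq_self (f := e.toLinearMap) (q := K)
        (by rw [LinearEquiv.range]; exact le_top), ht, Submodule.map_top, LinearEquiv.range]
  refine ⟨Submodule.Quotient.equiv _ _ e ?_⟩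
  rw [hs]
  exact Submodule.map_comap_eq_self (by rw [LinearEquiv.range]; exact le_top)

/-- The factor `⊤ / A`. -/
def topFactorEquiv (A : Submodule R X) :
    (↥(⊤ : Submodule R X) ⧸ A.submoduleOf ⊤) ≃ₗ[R] X ⧸ A :=
  Submodule.Quotient.equiv _ _ Submodule.topEquiv (by
    ext v
    exact ⟨fun ⟨w, hw, h⟩ => h ▸ hw, fun hv => ⟨⟨v, trivial⟩, hv, rfl⟩⟩)

/-- The factor `A / ⊥`. -/
def botFactorEquiv (A : Submodule R X) : (↥A ⧸ (⊥ : Submodule R X).submoduleOf A) ≃ₗ[R] A :=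
  Submodule.quotEquivOfEqBot _ ((Submodule.eq_bot_iff _).2 fun _ hv => Subtype.ext hv)

/-- A composition series with four factors. -/
def compositionSeriesFour {A B C : Submodule R X} (h0 : ⊥ ⋖ A) (h1 : A ⋖ B) (h2 : B ⋖ C)
    (h3 : C ⋖ ⊤) : CompositionSeries (Submodule R X) :=
  ⟨4, ![⊥, A, B, C, ⊤], fun i => by
    fin_cases i
    exacts [h0, h1, h2, h3]⟩

end Covers

/-! ### Dimensions of composition factors -/

section Dimensions

variable {k R X Y : Type*} [Field k] [Ring R] [Algebra k R]
  [AddCommGroup X] [Module k X] [Module R X] [IsScalarTower k R X] [FiniteDimensional k X]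
  [AddCommGroup Y] [Module k Y] [Module R Y] [IsScalarTower k R Y]

variable (k) in
theorem finrank_factor_add {A B : Submodule R X} (h : A ≤ B) :
    Module.finrank k (↥B ⧸ A.submoduleOf B) + Module.finrank k A = Module.finrank k B := by
  have : FiniteDimensional k B := inferInstanceAs (FiniteDimensional k (B.restrictScalars k))
  have h1 := Submodule.finrank_quotient_add_finrank ((A.submoduleOf B).restrictScalars k)
  have h2 := ((Submodule.submoduleOfEquivOfLe h).restrictScalars k).finrank_eq
  have h3 := (Submodule.Quotient.restrictScalarsEquiv k (A.submoduleOf B)).finrank_eq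
  rw [← h1, ← h2, ← h3]
  rfl

variable (k) in
theorem finrank_range_add_finrank_ker' (f : X →ₗ[R] Y) :
    Module.finrank k (LinearMap.range f) + Module.finrank k (LinearMap.ker f) =
      Module.finrank k X :=
  LinearMap.finrank_range_add_finrank_ker (f.restrictScalars k)

omit [FiniteDimensional k X] in
variable (k) in
theorem finrank_top' : Module.finrank k (⊤ : Submodule R X) = Module.finrank k X :=
  ((Submodule.topEquiv (R := R) (M := X)).restrictScalars k).finrank_eq

omit [FiniteDimensional k X] in
variable (k R X) in
theorem finrank_bot' : Module.finrank k (⊥ : Submodule R X) = 0 :=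
  Module.finrank_zero_of_subsingleton

variable (k) in
theorem covBy_of_finrank {A B : Submodule R X} (h : A ≤ B)
    (hd : Module.finrank k B = Module.finrank k A + 1) : A ⋖ B := by
  have hlt {C D : Submodule R X} (h : C < D) : Module.finrank k C < Module.finrank k D :=
    Submodule.finrank_lt_finrank_of_lt (s := C.restrictScalars k) (t := D.restrictScalars k) h
  refine ⟨lt_of_le_of_ne h fun he => ?_, fun C hAC hCB => ?_⟩
  · rw [he] at hd
    omega
  · have h1 := hlt hAC
    have h2 := hlt hCB
    omega

variable (k) in
theorem eq_of_le_of_finrank_eq' {A B : Submodule R X} (h : A ≤ B)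
    (hd : Module.finrank k A = Module.finrank k B) : A = B :=
  Submodule.restrictScalars_injective k R X
    (Submodule.eq_of_le_of_finrank_eq (S₁ := A.restrictScalars k) (S₂ := B.restrictScalars k) h hd)

variable (k) in
theorem finrank_factor {A B : Submodule R X} (h : A ≤ B) {m n : ℕ} (hA : Module.finrank k A = m)
    (hB : Module.finrank k B = m + n) : Module.finrank k (↥B ⧸ A.submoduleOf B) = n := by
  have h1 := finrank_factor_add k h
  omega

variable (k) in
/-- The dimensions of the factors of a composition series. -/
def seriesDims (t : CompositionSeries (Submodule R X)) : Multiset ℕ :=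
  Finset.univ.val.map fun i : Fin t.length =>
    Module.finrank k (seriesFactor t i)

omit [FiniteDimensional k X] in
variable (k) in
theorem seriesDims_eq (e : X ≃ₗ[R] Y) (s : CompositionSeries (Submodule R X))
    (t : CompositionSeries (Submodule R Y)) (hs : s.head = ⊥) (hs' : s.last = ⊤)
    (ht : t.head = ⊥) (ht' : t.last = ⊤) : seriesDims k s = seriesDims k t := by
  obtain ⟨σ, hσ⟩ := exists_equiv_factors e s t hs hs' ht ht'
  rw [seriesDims, ← Multiset.map_univ_val_equiv σ, Multiset.map_map]
  exact Multiset.map_congr rfl fun i _ => ((hσ i).some.restrictScalars k).finrank_eq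

variable (k) in
/-- A composition series with two factors. -/
theorem exists_compositionSeries_two {A : Submodule R X} {l m : ℕ} (h0 : ⊥ ⋖ A) (h1 : A ⋖ ⊤)
    (hA : Module.finrank k A = l) (hX : Module.finrank k X = l + m) :
    ∃ t : CompositionSeries (Submodule R X), t.head = ⊥ ∧ t.last = ⊤ ∧
      seriesDims k t = {l, m} := by
  let t : CompositionSeries (Submodule R X) := ⟨2, ![⊥, A, ⊤], fun i => by
    fin_cases i
    exacts [h0, h1]⟩
  refine ⟨t, rfl, rfl, ?_⟩
  have hd : (fun i : Fin t.length =>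
      Module.finrank k (seriesFactor t i)) = ![l, m] := by
    funext i
    fin_cases i
    · exact finrank_factor k bot_le (finrank_bot' k R X) (hA.trans (zero_add _).symm)
    · exact finrank_factor k le_top hA ((finrank_top' k).trans hX)
  rw [seriesDims, hd]
  rfl

variable (k) in
/-- A composition series with three factors. -/
theorem exists_compositionSeries_three {A B : Submodule R X} {l m n : ℕ} (h0 : ⊥ ⋖ A) (h1 : A ⋖ B)
    (h2 : B ⋖ ⊤) (hA : Module.finrank k A = l) (hB : Module.finrank k B = l + m)
    (hX : Module.finrank k X = l + m + n) :
    ∃ t : CompositionSeries (Submodule R X), t.head = ⊥ ∧ t.last = ⊤ ∧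
      seriesDims k t = {l, m, n} := by
  let t : CompositionSeries (Submodule R X) := ⟨3, ![⊥, A, B, ⊤], fun i => by
    fin_cases i
    exacts [h0, h1, h2]⟩
  refine ⟨t, rfl, rfl, ?_⟩
  have hd : (fun i : Fin t.length =>
      Module.finrank k (seriesFactor t i)) = ![l, m, n] := by
    funext i
    fin_cases i
    · exact finrank_factor k bot_le (finrank_bot' k R X) (hA.trans (zero_add _).symm)
    · exact finrank_factor k h1.le hA hB
    · exact finrank_factor k le_top hB ((finrank_top' k).trans hX)
  rw [seriesDims, hd]
  rfl

variable (k) in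
theorem finrank_comap_add [FiniteDimensional k Y] {f : X →ₗ[R] Y} (hf : LinearMap.range f = ⊤)
    (K : Submodule R Y) :
    Module.finrank k (K.comap f) + Module.finrank k Y = Module.finrank k X + Module.finrank k K := by
  have h := finrank_range_add_finrank_ker' k (K.mkQ ∘ₗ f)
  have h1 := finrank_range_add_finrank_ker' k K.mkQ
  rw [LinearMap.range_comp, hf, Submodule.map_top, Submodule.range_mkQ, LinearMap.ker_comp,
    Submodule.ker_mkQ] at h
  rw [Submodule.range_mkQ, Submodule.ker_mkQ] at h1
  omega

variable (k) in
theorem seriesDims_compositionSeriesFour {A B C : Submodule R X} {l m n o : ℕ} (h0 : ⊥ ⋖ A)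
    (h1 : A ⋖ B) (h2 : B ⋖ C) (h3 : C ⋖ ⊤) (hA : Module.finrank k A = l)
    (hB : Module.finrank k B = l + m) (hC : Module.finrank k C = l + m + n)
    (hX : Module.finrank k X = l + m + n + o) :
    seriesDims k (compositionSeriesFour h0 h1 h2 h3) = {l, m, n, o} := by
  have hd : (fun i : Fin (compositionSeriesFour h0 h1 h2 h3).length =>
      Module.finrank k (seriesFactor (compositionSeriesFour h0 h1 h2 h3) i)) = ![l, m, n, o] := by
    funext i
    fin_cases i
    · exact finrank_factor k bot_le (finrank_bot' k R X) (hA.trans (zero_add _).symm)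
    · exact finrank_factor k h1.le hA hB
    · exact finrank_factor k h2.le hB hC
    · exact finrank_factor k le_top hC ((finrank_top' k).trans hX)
  rw [seriesDims, hd]
  rfl

end Dimensions

/-! ### Submodules of the twisted de Rham complex -/

section DeRham

variable {k : Type*} [Field k] {p : ℕ} [CharP k p] [Fact p.Prime]

omit [CharP k p] in
theorem one_ne_zero_truncPoly : (1 : TruncPoly k p) ≠ 0 := by
  have hp := (Fact.out : p.Prime).pos
  rw [← monom_zero_zero]
  exact monom_ne_zero hp hp

theorem castHom_ne_zero {c : ZMod p} (hc : c ≠ 0) : ZMod.castHom (dvd_refl p) k c ≠ 0 :=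
  (map_ne_zero _).2 hc

/-- The space of functions underlying a submodule. -/
def funSub {c : ZMod p} (N : Submodule (RestrictedEnv k p) (funRep k p c).Space) :
    Submodule k (TruncPoly k p) := N.restrictScalars k

theorem funStable {c : ZMod p} (N : Submodule (RestrictedEnv k p) (funRep k p c).Space) :
    FunStable (ZMod.castHom (dvd_refl p) k c) (funSub N) :=
  fun _ hD _ hh => RestrictedRep.act_mem _ N hD hh

theorem eq_top_of_funSub {c : ZMod p} {N : Submodule (RestrictedEnv k p) (funRep k p c).Space}
    (h : funSub N = ⊤) : N = ⊤ :=
  (Submodule.restrictScalars_eq_top_iff k _ _).1 h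

theorem eq_bot_of_funSub {c : ZMod p} {N : Submodule (RestrictedEnv k p) (funRep k p c).Space}
    (h : funSub N = ⊥) : N = ⊥ :=
  (Submodule.restrictScalars_eq_bot_iff k _ _).1 h

/-- The space of forms underlying a submodule. -/
def formSub {c : ZMod p} (N : Submodule (RestrictedEnv k p) (formRep k p c).Space) :
    Submodule k (TruncPoly k p × TruncPoly k p) := N.restrictScalars k

theorem eq_top_of_formSub {c : ZMod p} {N : Submodule (RestrictedEnv k p) (formRep k p c).Space}
    (h : formSub N = ⊤) : N = ⊤ :=
  (Submodule.restrictScalars_eq_top_iff k _ _).1 h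

theorem mem_ker_dFun {c : ZMod p} {h : TruncPoly k p} :
    h ∈ funSub (LinearMap.ker (dFun (k := k) c)) ↔ diffFun (twist k p c) h = 0 := Iff.rfl

theorem mem_ker_dForm {c : ZMod p} {w : TruncPoly k p × TruncPoly k p} :
    w ∈ formSub (LinearMap.ker (dForm (k := k) c)) ↔ diffForm (twist k p c) w = 0 := Iff.rfl

theorem mem_range_dFun {c : ZMod p} {w : TruncPoly k p × TruncPoly k p} :
    w ∈ formSub (LinearMap.range (dFun (k := k) c)) ↔ ∃ h, diffFun (twist k p c) h = w := Iff.rfl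

theorem mem_range_dForm {c : ZMod p} {h : TruncPoly k p} :
    h ∈ funSub (LinearMap.range (dForm (k := k) c)) ↔ ∃ w, diffForm (twist k p c) w = h := Iff.rfl

instance (c : ZMod p) : Nontrivial (funRep k p c).Space :=
  ⟨⟨(1 : TruncPoly k p), (0 : TruncPoly k p), one_ne_zero_truncPoly⟩⟩

theorem bot_covBy_top_funRep (hp : 3 ≤ p) {c : ZMod p} (h0 : c ≠ 0) (h1 : c ≠ 1) :
    (⊥ : Submodule (RestrictedEnv k p) (funRep k p c).Space) ⋖ ⊤ := by
  refine ⟨bot_lt_top, fun N hN hN' => hN'.ne ?_⟩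
  exact eq_top_of_funSub ((funStable N).eq_top hp (castHom_ne_zero h0)
    (fun h => h1 ((ZMod.castHom (dvd_refl p) k).injective (h.trans (map_one _).symm)))
    fun h => hN.ne' (eq_bot_of_funSub h))

/-- The twist changes the `dx` component only, and the `dy` component of the image is `1`. As every
sufficiently large submodule of functions contains `y`, this bounds the kernel of the differential.
-/
theorem diffFun_coord_one_ne_zero (c : ZMod p) : diffFun (twist k p c) (coord k p 1) ≠ 0 := by
  intro h
  have h2 : del k p 1 (coord k p 1) = 0 := congrArg Prod.snd h
  rw [del_coord, if_pos rfl] at h2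
  exact one_ne_zero_truncPoly h2

theorem twist_zero : twist k p 0 = 0 := by
  rw [twist, map_zero, map_zero, zero_mul, neg_zero]

theorem funStable_zero (N : Submodule (RestrictedEnv k p) (funRep k p 0).Space) :
    FunStable (0 : k) (funSub N) := by
  have h := funStable N
  rwa [map_zero] at h

theorem funStable_of_eq_one {c : ZMod p} (hc : c = 1)
    (N : Submodule (RestrictedEnv k p) (funRep k p c).Space) : FunStable (1 : k) (funSub N) := by
  subst hc
  have h := funStable N
  rwa [map_one] at h

theorem funSub_ker_dFun_zero (hp : 3 ≤ p) :
    funSub (LinearMap.ker (dFun (k := k) (p := p) 0)) = Submodule.span k {1} := by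
  refine le_antisymm ?_ ?_
  · by_contra h0
    have h1 := (funStable_zero (LinearMap.ker (dFun (k := k) (p := p) 0))).eq_top_of_zero hp h0
    have h2 : coord k p 1 ∈ funSub (LinearMap.ker (dFun (k := k) (p := p) 0)) := by
      rw [h1]
      trivial
    exact diffFun_coord_one_ne_zero 0 (mem_ker_dFun.1 h2)
  · rw [Submodule.span_singleton_le_iff_mem, mem_ker_dFun, twist_zero, diffFun_apply,
      Derivation.map_one_eq_zero, Derivation.map_one_eq_zero, zero_mul, sub_zero]
    rfl

theorem funRep_zero_eq_top (hp : 3 ≤ p) {N : Submodule (RestrictedEnv k p) (funRep k p 0).Space}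
    (h : ¬ N ≤ LinearMap.ker (dFun 0)) : N = ⊤ := by
  refine eq_top_of_funSub ((funStable_zero N).eq_top_of_zero hp fun hN => h ?_)
  rw [← funSub_ker_dFun_zero hp] at hN
  exact hN

theorem finrank_ker_dFun_zero (hp : 3 ≤ p) :
    Module.finrank k (LinearMap.ker (dFun (k := k) (p := p) 0)) = 1 := by
  have h := finrank_span_singleton (K := k) (one_ne_zero_truncPoly (k := k) (p := p))
  rw [← funSub_ker_dFun_zero hp] at h
  exact h

theorem finrank_funRep (c : ZMod p) : Module.finrank k (funRep k p c).Space = p ^ 2 :=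
  finrank_truncPoly

theorem finrank_formRep (c : ZMod p) : Module.finrank k (formRep k p c).Space = p ^ 2 + p ^ 2 := by
  change Module.finrank k (TruncPoly k p × TruncPoly k p) = _
  rw [Module.finrank_prod, finrank_truncPoly]

theorem ker_dFun_zero_covBy_top (hp : 3 ≤ p) : LinearMap.ker (dFun (k := k) (p := p) 0) ⋖ ⊤ :=
  ⟨lt_top_iff_ne_top.2 fun h => diffFun_coord_one_ne_zero (k := k) (p := p) 0
      (mem_ker_dFun.1 (by rw [h]; trivial)),
    fun _ hN hN' => hN'.ne (funRep_zero_eq_top hp hN.not_ge)⟩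

/-- The submodule consists of the constants. The twist is given by an equation because it will be of
the form `c + 1`. -/
theorem exists_chain_funRep_of_eq_zero (hp : 3 ≤ p) {c : ZMod p} (hc : c = 0) :
    ∃ K : Submodule (RestrictedEnv k p) (funRep k p c).Space,
      Module.finrank k K = 1 ∧ ⊥ ⋖ K ∧ K ⋖ ⊤ := by
  subst hc
  refine ⟨_, finrank_ker_dFun_zero hp, covBy_of_finrank k bot_le ?_, ker_dFun_zero_covBy_top hp⟩
  rw [finrank_ker_dFun_zero hp, finrank_bot']

/-- Differentiation lowers an exponent or gives zero, so the top monomial never occurs. The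
functional plays the role of an integral. -/
theorem topCoeff_del (i : Fin 2) (h : TruncPoly k p) : topCoeff k p (del k p i h) = 0 := by
  have hp := (Fact.out : p.Prime).two_le
  have hl : topCoeff k p ∘ₗ (del k p i).toLinearMap = 0 := by
    refine (monomBasis k p).ext fun ⟨a, b⟩ => ?_
    rw [LinearMap.comp_apply, monomBasis_apply]
    change topCoeff k p (del k p i (monom k p a b)) = 0
    fin_cases i
    · refine (congrArg _ (del_zero_monom _ _)).trans ?_
      rw [map_smul, topCoeff_monom (by omega) b.2, if_neg, smul_zero]
      rw [Prod.mk.injEq]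
      omega
    · refine (congrArg _ (del_one_monom _ _)).trans ?_
      rw [map_smul, topCoeff_monom a.2 (by omega), if_neg, smul_zero]
      rw [Prod.mk.injEq]
      omega
  exact LinearMap.congr_fun hl h

/-- With twist one, `D` acts by `h ↦ div(h D)`, a sum of partial derivatives. -/
theorem topCoeff_funAct_one (D : Witt k p) (h : TruncPoly k p) :
    topCoeff k p (funAct (1 : k) D h) = 0 := by
  have h1 : funAct (1 : k) D h =
      del k p 0 (D (coord k p 0) * h) + del k p 1 (D (coord k p 1) * h) := by
    rw [eq_vf D, funAct_vf, ← eq_vf D, Derivation.leibniz, Derivation.leibniz, RingHom.map_one]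
    simp only [smul_eq_mul]
    ring
  rw [h1, map_add, topCoeff_del, topCoeff_del, add_zero]

omit [CharP k p] in
theorem finrank_ker_topCoeff :
    Module.finrank k (LinearMap.ker (topCoeff k p)) + 1 = p ^ 2 := by
  have hp := (Fact.out : p.Prime).pos
  have h1 := LinearMap.finrank_range_add_finrank_ker (topCoeff k p)
  have h2 : LinearMap.range (topCoeff k p) = ⊤ := LinearMap.range_eq_top.2 fun r =>
    ⟨r • topMonom k p, by rw [map_smul, topCoeff_monom (by omega) (by omega), if_pos rfl,
      smul_eq_mul, mul_one]⟩
  rw [h2, finrank_top, Module.finrank_self, finrank_truncPoly] at h1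
  omega

theorem exists_chain_funRep_of_eq_one (hp : 3 ≤ p) {c : ZMod p} (hc : c = 1) :
    ∃ K : Submodule (RestrictedEnv k p) (funRep k p c).Space,
      Module.finrank k K + 1 = p ^ 2 ∧ ⊥ ⋖ K ∧ K ⋖ ⊤ := by
  subst hc
  let K : Submodule (RestrictedEnv k p) (funRep k p 1).Space :=
    submoduleOfStable (show Submodule k (funRep k p 1).Space from LinearMap.ker (topCoeff k p))
      fun D v _ => by
        rw [RestrictedRep.envι_smul_eq]
        have h := topCoeff_funAct_one (D : Witt k p) v
        rw [← map_one (ZMod.castHom (dvd_refl p) k)] at h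
        exact h
  have hd : Module.finrank k K + 1 = p ^ 2 := finrank_ker_topCoeff
  refine ⟨K, hd, ⟨bot_lt_iff_ne_bot.2 fun h => ?_, fun N hN hN' => hN'.not_ge ?_⟩,
    covBy_of_finrank k le_top ?_⟩
  · rw [h, finrank_bot'] at hd
    nlinarith
  · exact (funStable_of_eq_one rfl N).ker_topCoeff_le hp fun h => hN.ne' (eq_bot_of_funSub h)
  · rw [hd, finrank_top', finrank_funRep]

theorem ker_dFun (hp : 3 ≤ p) {c : ZMod p} (hc : c ≠ 0) :
    LinearMap.ker (dFun (k := k) c) = ⊥ := by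
  by_contra h
  exact diffFun_coord_one_ne_zero c (mem_ker_dFun.1 ((funStable _).coord_one_mem hp
    (castHom_ne_zero hc) fun h' => h (eq_bot_of_funSub h')))

omit [Fact p.Prime] in
-- The form `y^2 dx` is chosen because the twist only affects `dy` components: its image is a
-- multiple of `y` for every `c`, nonzero in odd characteristic.
theorem diffForm_sq_coord_one (c : ZMod p) :
    diffForm (twist k p c) (coord k p 1 ^ 2, 0) = (-2 : k) • coord k p 1 := by
  rw [diffForm_apply, del_pow_coord]
  simp

omit [Fact p.Prime] in
theorem neg_two_ne_zero (hp : 3 ≤ p) : (-2 : k) ≠ 0 := neg_ne_zero.2 (two_ne_zero_of_le hp)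

theorem coord_one_mem_range_dForm (hp : 3 ≤ p) (c : ZMod p) :
    coord k p 1 ∈ funSub (LinearMap.range (dForm (k := k) c)) := by
  rw [← Submodule.smul_mem_iff _ (neg_two_ne_zero (k := k) hp)]
  exact mem_range_dForm.2 ⟨_, diffForm_sq_coord_one c⟩

omit [CharP k p] [Fact p.Prime] in
theorem coord_one_ne_zero (hp : 3 ≤ p) : coord k p 1 ≠ 0 := by
  rw [← monom_zero_one]
  exact monom_ne_zero (by omega) (by omega)

/-- The range contains `y`, and the target has twist `c + 1 ≠ 1`, so `y` generates it. -/
theorem range_dForm (hp : 3 ≤ p) {c : ZMod p} (hc : c ≠ 0) :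
    LinearMap.range (dForm (k := k) c) = ⊤ := by
  have hs := funStable (LinearMap.range (dForm (k := k) c))
  refine eq_top_of_funSub (eq_top_of_monom_mem fun i j hi hj =>
    hs.monom_mem_of_coord_one_mem (coord_one_mem_range_dForm hp c) hi hj (Or.inl fun h => hc ?_))
  exact add_eq_right.1 ((ZMod.castHom (dvd_refl p) k).injective (h.trans (map_one _).symm))

theorem range_dFun_le_ker_dForm (c : ZMod p) :
    LinearMap.range (dFun (k := k) c) ≤ LinearMap.ker (dForm c) := by
  rintro _ ⟨h, rfl⟩
  exact diffForm_diffFun (del_one_twist c) h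

theorem finrank_range_dFun (hp : 3 ≤ p) {c : ZMod p} (hc : c ≠ 0) :
    Module.finrank k (LinearMap.range (dFun (k := k) c)) = p ^ 2 := by
  have h := finrank_range_add_finrank_ker' k (dFun (k := k) c)
  rwa [ker_dFun hp hc, finrank_bot', finrank_funRep, add_zero] at h

/-- Exactness by counting: the image of an injection from dimension `p^2` lies in the kernel of a
surjection from `2 p^2` onto `p^2`. -/
theorem range_dFun (hp : 3 ≤ p) {c : ZMod p} (hc : c ≠ 0) :
    LinearMap.range (dFun (k := k) c) = LinearMap.ker (dForm c) := by
  refine eq_of_le_of_finrank_eq' k (range_dFun_le_ker_dForm c) ?_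
  have h := finrank_range_add_finrank_ker' k (dForm (k := k) c)
  rw [range_dForm hp hc, finrank_top', finrank_funRep, finrank_formRep] at h
  rw [finrank_range_dFun hp hc]
  omega

theorem ker_dForm_ne_bot (c : ZMod p) : LinearMap.ker (dForm (k := k) c) ≠ ⊥ := fun h => by
  have h1 := range_dFun_le_ker_dForm (k := k) c ⟨coord k p 1, rfl⟩
  rw [h] at h1
  exact diffFun_coord_one_ne_zero (k := k) c h1

theorem ker_dForm_ne_top (hp : 3 ≤ p) (c : ZMod p) : LinearMap.ker (dForm (k := k) c) ≠ ⊤ := by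
  intro h
  have h1 : ((coord k p 1 ^ 2, 0) : TruncPoly k p × TruncPoly k p) ∈
      formSub (LinearMap.ker (dForm (k := k) c)) := by rw [h]; trivial
  have h2 : (-2 : k) • coord k p 1 = 0 := (diffForm_sq_coord_one c).symm.trans h1
  exact coord_one_ne_zero hp ((smul_eq_zero_iff_right (neg_two_ne_zero hp)).1 h2)

/-! ### The untwisted complex -/

theorem funSub_range_dForm_zero (hp : 3 ≤ p) :
    funSub (LinearMap.range (dForm (k := k) (p := p) 0)) = LinearMap.ker (topCoeff k p) := by
  refine le_antisymm ?_ ((funStable_of_eq_one (zero_add 1) _).ker_topCoeff_le hp fun h => ?_)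
  · intro h hh
    obtain ⟨⟨u, v⟩, rfl⟩ := mem_range_dForm.1 hh
    rw [LinearMap.mem_ker, twist_zero, diffForm_apply, zero_mul, sub_zero, map_sub,
      topCoeff_del, topCoeff_del, sub_zero]
  · have h1 := coord_one_mem_range_dForm (k := k) hp 0
    rw [h] at h1
    exact coord_one_ne_zero hp ((Submodule.mem_bot _).1 h1)

theorem finrank_range_dFun_zero (hp : 3 ≤ p) :
    Module.finrank k (LinearMap.range (dFun (k := k) (p := p) 0)) + 1 = p ^ 2 := by
  have h := finrank_range_add_finrank_ker' k (dFun (k := k) (p := p) 0)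
  rwa [finrank_ker_dFun_zero hp, finrank_funRep] at h

/-- The exact forms have dimension `p^2 - 1`, so the first cohomology has dimension two. -/
theorem finrank_ker_dForm_zero (hp : 3 ≤ p) :
    Module.finrank k (LinearMap.ker (dForm (k := k) (p := p) 0)) = p ^ 2 + 1 := by
  have h := finrank_range_add_finrank_ker' k (dForm (k := k) (p := p) 0)
  have h1 : Module.finrank k (LinearMap.range (dForm (k := k) (p := p) 0)) + 1 = p ^ 2 := by
    have h2 := finrank_ker_topCoeff (k := k) (p := p)
    rw [← funSub_range_dForm_zero hp] at h2
    exact h2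
  rw [finrank_formRep] at h
  omega

omit [Fact p.Prime] in
/-- Cartan's formula. -/
theorem formAct_zero_eq (f g u v : TruncPoly k p) :
    formAct (0 : k) (vf f g) (u, v) =
      diffFun 0 (f * u + g * v) + diffForm 0 (u, v) • (-g, f) := by
  rw [formAct_vf, diffFun_apply, diffForm_apply, RingHom.map_zero]
  ext <;> simp only [map_add, Derivation.leibniz, smul_eq_mul, Prod.fst_add, Prod.snd_add,
    Prod.smul_fst, Prod.smul_snd] <;> ring

/-- For closed `w`, Cartan's formula reduces the Lie derivative to `d` of the contraction of `w`
with `D`. So derivations act by zero on the first cohomology. -/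
theorem formAct_mem_range_dFun_zero (D : Witt k p) {w : TruncPoly k p × TruncPoly k p}
    (hw : w ∈ formSub (LinearMap.ker (dForm (k := k) 0))) :
    formAct (0 : k) D w ∈ formSub (LinearMap.range (dFun (k := k) (p := p) 0)) := by
  obtain ⟨u, v⟩ := w
  rw [mem_ker_dForm, twist_zero] at hw
  refine mem_range_dFun.2 ⟨D (coord k p 0) * u + D (coord k p 1) * v, ?_⟩
  conv_rhs => rw [eq_vf D]
  rw [formAct_zero_eq, hw, zero_smul, add_zero, twist_zero]

theorem envι_smul_formRep_zero (D : hamHat k p) (w : (formRep k p 0).Space) :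
    envι k p D • w = formAct (0 : k) (D : Witt k p) w := by
  rw [RestrictedRep.envι_smul_eq, ← map_zero (ZMod.castHom (dvd_refl p) k)]
  rfl

theorem envι_smul_mem_range_dFun_zero (D : hamHat k p) {w : (formRep k p 0).Space}
    (hw : w ∈ LinearMap.ker (dForm (k := k) 0)) :
    envι k p D • w ∈ LinearMap.range (dFun (k := k) (p := p) 0) := by
  rw [envι_smul_formRep_zero]
  exact formAct_mem_range_dFun_zero (D : Witt k p) hw

/-- Because `Ĥ` maps closed forms to exact ones, any subspace between the two is a submodule;
adjoining one closed form that is not exact splits the cohomology into two lines. -/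
theorem exists_chain_formRep_zero (hp : 3 ≤ p) :
    ∃ K : Submodule (RestrictedEnv k p) (formRep k p 0).Space,
      Module.finrank k K = p ^ 2 ∧ LinearMap.range (dFun 0) ⋖ K ∧ K ⋖ LinearMap.ker (dForm 0) := by
  have hd := finrank_range_dFun_zero (k := k) hp
  have hd' := finrank_ker_dForm_zero (k := k) hp
  have hle := range_dFun_le_ker_dForm (k := k) (p := p) 0
  obtain ⟨w, hw, hw'⟩ : ∃ w ∈ LinearMap.ker (dForm (k := k) (p := p) 0),
      w ∉ LinearMap.range (dFun (k := k) (p := p) 0) := by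
    by_contra! h
    have h1 := le_antisymm hle h
    rw [← h1] at hd'
    omega
  let P : Submodule k (formRep k p 0).Space :=
    (LinearMap.range (dFun (k := k) (p := p) 0)).restrictScalars k ⊔ Submodule.span k {w}
  have hP : P ≤ (LinearMap.ker (dForm (k := k) (p := p) 0)).restrictScalars k :=
    sup_le hle ((Submodule.span_singleton_le_iff_mem _ _).2 hw)
  have hdP : Module.finrank k P = p ^ 2 := by
    have h := Submodule.finrank_sup_span_singleton
      (p := (LinearMap.range (dFun (k := k) (p := p) 0)).restrictScalars k) (v := w) hw'
    exact h.trans hd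
  let K : Submodule (RestrictedEnv k p) (formRep k p 0).Space :=
    submoduleOfStable P fun D v hv =>
      Submodule.mem_sup_left (envι_smul_mem_range_dFun_zero D (hP hv))
  have hdK : Module.finrank k K = p ^ 2 := hdP
  refine ⟨K, hdK, covBy_of_finrank k ?_ ?_, covBy_of_finrank k hP ?_⟩
  · exact fun v hv => Submodule.mem_sup_left hv
  · rw [hdK, hd]
  · rw [hdK, hd']

/-- The image of `N` under `d` is a nonzero submodule of the functions of twist one, so it contains
`q = x^(p-1) y^(p-2)`; pick `u dx + v dy` in `N` with differential `q`. By Cartan's formula,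
applying `y ∂_y` gives `d(y v)` minus the top monomial times `dx`. Once `d(y v)` is known to be in
`N`, so are both top forms, and they generate everything. -/
theorem formRep_zero_eq_top (hp : 3 ≤ p) {N : Submodule (RestrictedEnv k p) (formRep k p 0).Space}
    (h : ¬ N ≤ LinearMap.ker (dForm 0)) : N = ⊤ := by
  have hact {D : Witt k p} (hD : D ∈ hamHat k p) {w : TruncPoly k p × TruncPoly k p}
      (hw : w ∈ formSub N) : formAct (0 : k) D w ∈ formSub N := by
    have h := N.smul_mem (envι k p ⟨D, hD⟩) hw
    exact (congrArg (· ∈ N) (envι_smul_formRep_zero ⟨D, hD⟩ w)).mp h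
  have hq : monom k p (p - 1) (p - 2) ∈ funSub (N.map (dForm 0)) := by
    refine (funStable_of_eq_one (zero_add 1) _).ker_topCoeff_le hp (fun h0 => h ?_) ?_
    · exact (LinearMap.le_ker_iff_map).2 (eq_bot_of_funSub h0)
    · rw [LinearMap.mem_ker, topCoeff_monom (by omega) (by omega), if_neg]
      rw [Prod.mk.injEq]
      omega
  obtain ⟨⟨u, v⟩, hn, hd⟩ : ∃ w ∈ formSub N, diffForm (twist k p 0) w = _ := hq
  rw [twist_zero] at hd
  -- The functions whose differential lies in `N` form a submodule, which either consists of
  -- constants or is everything.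
  have hex {g : TruncPoly k p} (hg : diffFun 0 g ∈ formSub N) :
      formSub (LinearMap.range (dFun (k := k) (p := p) 0)) ≤ formSub N ∨
        g ∈ Submodule.span k {(1 : TruncPoly k p)} := by
    by_cases hN : N.comap (dFun 0) ≤ LinearMap.ker (dFun 0)
    · right
      rw [← funSub_ker_dFun_zero hp]
      rw [← twist_zero] at hg
      exact hN hg
    · left
      intro w hw
      obtain ⟨g', rfl⟩ := mem_range_dFun.1 hw
      have hg' : g' ∈ funSub (N.comap (dFun 0)) := by
        rw [funRep_zero_eq_top hp hN]
        trivial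
      exact hg'
  have hxq : coord k p 0 * monom k p (p - 1) (p - 2) = 0 := by
    rw [← monom_one_zero, monom_mul_monom, monom_eq_zero_of_left_le (by omega)]
  have hyq : coord k p 1 * monom k p (p - 1) (p - 2) = topMonom k p := by
    rw [← monom_zero_one, monom_mul_monom, zero_add, show 1 + (p - 2) = p - 1 by omega]
  have hsmul (a b c : TruncPoly k p) : a • (b, c) = (a * b, a * c) := rfl
  -- For `x ∂_y`, and next for `x ∂_x`, the non-exact term in Cartan's formula contains `x q = 0`,
  -- so only the exact term is left.
  have hxv : diffFun 0 (coord k p 0 * v) ∈ formSub N := by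
    have h := hact (D := vf 0 (coord k p 0)) (by rw [← coe_elE hp]; exact (elE k p hp).2.1) hn
    rw [formAct_zero_eq, hd, hsmul, mul_neg, mul_comm _ (coord k p 0), hxq, neg_zero, mul_zero,
      Prod.mk_zero_zero, add_zero, zero_mul, zero_add] at h
    exact h
  have hxu : diffFun 0 (coord k p 0 * u) ∈ formSub N := by
    have h := hact xdx_mem hn
    rw [formAct_zero_eq, hd, hsmul, mul_comm _ (coord k p 0), hxq, neg_zero, mul_zero,
      Prod.mk_zero_zero, add_zero, zero_mul, add_zero] at h
    exact h
  have hspan {g : TruncPoly k p} (hg : coord k p 0 * g ∈ Submodule.span k {(1 : TruncPoly k p)}) :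
      coord k p 0 * g = 0 := by
    obtain ⟨r, hr⟩ := Submodule.mem_span_singleton.1 hg
    have h1 : monom k p (p - 1) 0 * (coord k p 0 * g) = 0 := by
      rw [← mul_assoc, ← monom_one_zero, monom_mul_monom, monom_eq_zero_of_left_le (by omega),
        zero_mul]
    rw [← hr, mul_smul_comm, mul_one, smul_eq_zero] at h1
    rw [← hr, h1.resolve_right (monom_ne_zero (by omega) (by omega)), zero_smul]
  -- If `x v` or `x u` is not constant, all exact forms lie in `N`. Otherwise both vanish, being
  -- multiples of `x`; then multiplying `∂_x v - ∂_y u = q` by `x` leaves `v = 0`.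
  have hyv : diffFun 0 (coord k p 1 * v) ∈ formSub N := by
    rcases hex hxv with h | h
    · rw [← twist_zero]
      exact h (mem_range_dFun.2 ⟨_, rfl⟩)
    rcases hex hxu with h' | h'
    · rw [← twist_zero]
      exact h' (mem_range_dFun.2 ⟨_, rfl⟩)
    have h1 := congrArg (del k p 0) (hspan h)
    have h2 := congrArg (del k p 1) (hspan h')
    have h3 := congrArg (coord k p 0 * ·) hd
    rw [hxq, diffForm_apply] at h3
    simp only [Derivation.leibniz, smul_eq_mul, del_coord, map_zero] at h1 h2
    simp only [Fin.isValue, if_true, one_ne_zero, if_false, mul_one, mul_zero, add_zero] at h1 h2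
    have hv : v = 0 := by linear_combination h1 - h2 - h3
    rw [hv, mul_zero, map_zero]
    exact zero_mem _
  have h0 : (topMonom k p, 0) ∈ formSub N := by
    have h := hact ydy_mem hn
    rw [formAct_zero_eq, hd, hsmul, mul_neg, mul_comm _ (coord k p 1), hyq, zero_mul, zero_add,
      mul_zero] at h
    have h1 := sub_mem hyv h
    rw [sub_add_cancel_left] at h1
    simpa using h1
  have h1 : (0, topMonom k p) ∈ formSub N := by
    have h := hact (hamA_mem k p 2 (by omega)) h0
    have hg2 := dpow_two_mem (k := k) (p := p) (p - 1)
    rw [hamA_two_eq, formAct_vf, ydx_topMonom, mul_del_top_monom 1 hg2, add_mul,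
      mul_top_monom (del_mem_maxIdeal 1 hg2)] at h
    simpa [del_coord] using h
  exact eq_top_of_formSub (eq_top_of_topForms_mem (0 : k)
    (fun w hw => hact (hamA_mem k p 1 (by omega)) hw)
    (fun w hw => hact (hamB_mem k p 1 0 le_rfl (by omega) (by omega)) hw) h0 h1)

end DeRham

/-! ### Composition series of modules of forms -/

section Series

variable {k : Type*} [Field k] {p : ℕ} [CharP k p] [Fact p.Prime]

theorem finrank_ker_dForm (hp : 3 ≤ p) {c : ZMod p} (hc : c ≠ 0) :
    Module.finrank k (LinearMap.ker (dForm (k := k) c)) = p ^ 2 := by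
  rw [← range_dFun hp hc, finrank_range_dFun hp hc]

theorem bot_covBy_ker_dForm (hp : 3 ≤ p) {c : ZMod p} (h0 : c ≠ 0) (h1 : c ≠ 1) :
    ⊥ ⋖ LinearMap.ker (dForm (k := k) c) := by
  have h := covBy_map (dFun (k := k) c) (by rw [ker_dFun hp h0]) (bot_covBy_top_funRep hp h0 h1)
  rwa [Submodule.map_bot, Submodule.map_top, range_dFun hp h0] at h

theorem ker_dForm_covBy_top (hp : 3 ≤ p) {c : ZMod p} (h0 : c ≠ 0) (h1 : c + 1 ≠ 0) :
    LinearMap.ker (dForm (k := k) c) ⋖ ⊤ :=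
  covBy_comap (dForm (k := k) c) (by rw [range_dForm hp h0])
    (bot_covBy_top_funRep hp h1 fun h => h0 (add_eq_right.1 h))

theorem exists_chain_ker_dForm (hp : 3 ≤ p) {c : ZMod p} (hc : c = 1) :
    ∃ K : Submodule (RestrictedEnv k p) (formRep k p c).Space,
      Module.finrank k K = p ^ 2 - 1 ∧ ⊥ ⋖ K ∧ K ⋖ LinearMap.ker (dForm (k := k) c) := by
  have h0 : c ≠ 0 := by rw [hc]; exact one_ne_zero
  obtain ⟨K, hK, h1, h2⟩ := exists_chain_funRep_of_eq_one (k := k) hp hc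
  have h1' := covBy_map (dFun (k := k) c) (by rw [ker_dFun hp h0]) h1
  have h2' := covBy_map (dFun (k := k) c) (by rw [ker_dFun hp h0]; exact bot_le) h2
  rw [Submodule.map_bot] at h1'
  rw [Submodule.map_top, range_dFun hp h0] at h2'
  refine ⟨_, ?_, h1', h2'⟩
  have h3 := ((Submodule.equivMapOfInjective (dFun (k := k) c)
    (LinearMap.ker_eq_bot.1 (ker_dFun hp h0)) K).restrictScalars k).finrank_eq
  rw [← h3]
  omega

theorem exists_chain_ker_dForm_top (hp : 3 ≤ p) {c : ZMod p} (h0 : c ≠ 0) (hc : c + 1 = 0) :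
    ∃ K : Submodule (RestrictedEnv k p) (formRep k p c).Space,
      Module.finrank k K = p ^ 2 + 1 ∧ LinearMap.ker (dForm (k := k) c) ⋖ K ∧ K ⋖ ⊤ := by
  obtain ⟨K, hK, h1, h2⟩ := exists_chain_funRep_of_eq_zero (k := k) hp hc
  have hr := range_dForm (k := k) hp h0
  refine ⟨_, ?_, covBy_comap (dForm (k := k) c) (by rw [hr]; exact le_top) h1,
    covBy_comap (dForm (k := k) c) (by rw [hr]) h2⟩
  have h3 := finrank_comap_add k hr K
  rw [finrank_funRep, finrank_formRep, hK] at h3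
  omega

theorem isTrivialOneDim_factor {X : Type*} [AddCommGroup X] [Module k X]
    [Module (RestrictedEnv k p) X] [IsScalarTower k (RestrictedEnv k p) X] [FiniteDimensional k X]
    {A B : Submodule (RestrictedEnv k p) X} (h : A ≤ B)
    (hd : Module.finrank k B = Module.finrank k A + 1)
    (hD : ∀ D : hamHat k p, ∀ v ∈ B, envι k p D • v ∈ A) :
    IsTrivialOneDim k p (↥B ⧸ A.submoduleOf B) := by
  refine ⟨finrank_factor k h rfl hd, fun D v => ?_⟩
  obtain ⟨v, rfl⟩ := Submodule.Quotient.mk_surjective _ v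
  rw [← Submodule.Quotient.mk_smul, Submodule.Quotient.mk_eq_zero]
  exact hD D v v.2

theorem IsTrivialOneDim.congr {X Y : Type*} [AddCommGroup X] [Module k X]
    [Module (RestrictedEnv k p) X] [IsScalarTower k (RestrictedEnv k p) X]
    [AddCommGroup Y] [Module k Y] [Module (RestrictedEnv k p) Y]
    [IsScalarTower k (RestrictedEnv k p) Y] (e : X ≃ₗ[RestrictedEnv k p] Y)
    (h : IsTrivialOneDim k p Y) : IsTrivialOneDim k p X :=
  ⟨(e.restrictScalars k).finrank_eq.trans h.1, fun D v => e.injective (by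
    rw [map_smul, h.2, map_zero])⟩

theorem bot_covBy_range_dFun_zero (hp : 3 ≤ p) :
    ⊥ ⋖ LinearMap.range (dFun (k := k) (p := p) 0) := by
  have h := covBy_map (dFun (k := k) (p := p) 0) le_rfl (ker_dFun_zero_covBy_top hp)
  rwa [Submodule.map_top, LinearMap.le_ker_iff_map.1 le_rfl] at h

theorem ker_dForm_zero_covBy_top (hp : 3 ≤ p) :
    LinearMap.ker (dForm (k := k) (p := p) 0) ⋖ ⊤ :=
  ⟨lt_top_iff_ne_top.2 (ker_dForm_ne_top hp 0),
    fun _ hN hN' => hN'.ne (formRep_zero_eq_top hp hN.not_ge)⟩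

/-- A composition series of the module of differential forms of degree one. -/
theorem exists_compositionSeries_formRep_zero (hp : 3 ≤ p) :
    ∃ t : CompositionSeries (Submodule (RestrictedEnv k p) (formRep k p 0).Space),
      t.head = ⊥ ∧ t.last = ⊤ ∧ seriesDims k t = {1, 1, p ^ 2 - 1, p ^ 2 - 1} ∧
      ∃ e : Fin 4 ≃ Fin t.length,
        IsTrivialOneDim k p (seriesFactor t (e 0)) ∧
        IsTrivialOneDim k p (seriesFactor t (e 1)) ∧
        Nonempty (seriesFactor t (e 2) ≃ₗ[RestrictedEnv k p]
          ((formRep k p 0).Space ⧸ LinearMap.ker (dForm (k := k) (p := p) 0))) ∧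
        Nonempty (seriesFactor t (e 3) ≃ₗ[RestrictedEnv k p]
          ((funRep k p 0).Space ⧸ LinearMap.ker (dFun (k := k) (p := p) 0))) := by
  obtain ⟨K, hK, h1, h2⟩ := exists_chain_formRep_zero (k := k) hp
  have hE := finrank_range_dFun_zero (k := k) hp
  have hC := finrank_ker_dForm_zero (k := k) hp
  have h0 := bot_covBy_range_dFun_zero (k := k) hp
  have h3 := ker_dForm_zero_covBy_top (k := k) hp
  have hr (D : hamHat k p) (w : (formRep k p 0).Space)
      (hw : w ∈ LinearMap.ker (dForm (k := k) 0)) := envι_smul_mem_range_dFun_zero D hw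
  have hf1 := isTrivialOneDim_factor h1.le (by omega) fun D v hv => hr D v (h2.le hv)
  have hf2 := isTrivialOneDim_factor h2.le (by omega) fun D v hv => h1.le (hr D v hv)
  -- The series runs through the exact forms, the two trivial factors and the head; the permutation
  -- lists the trivial factors first, then the head, then the exact forms.
  refine ⟨compositionSeriesFour h0 h1 h2 h3, rfl, rfl, ?_,
    (⟨![1, 2, 3, 0], ![3, 0, 1, 2], by decide, by decide⟩ : Fin 4 ≃ Fin 4), ?_, ?_, ?_, ?_⟩
  · rw [seriesDims_compositionSeriesFour k (l := p ^ 2 - 1) (m := 1) (n := 1) (o := p ^ 2 - 1)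
      h0 h1 h2 h3 (by omega) (by omega) (by omega) (by rw [finrank_formRep]; omega)]
    change (p ^ 2 - 1) ::ₘ 1 ::ₘ 1 ::ₘ {p ^ 2 - 1} = 1 ::ₘ 1 ::ₘ (p ^ 2 - 1) ::ₘ {p ^ 2 - 1}
    rw [Multiset.cons_swap, Multiset.cons_swap (p ^ 2 - 1)]
  · exact hf1
  · exact hf2
  · exact ⟨topFactorEquiv _⟩
  · exact ⟨(botFactorEquiv (LinearMap.range (dFun 0))).trans
      (LinearMap.quotKerEquivRange (dFun (k := k) (p := p) 0)).symm⟩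

/-- The dimensions of the composition factors of a module of twisted forms of degree one. -/
theorem exists_compositionSeries_formRep (hp : 3 ≤ p) {a : ZMod p} (h0 : a ≠ 0) :
    ∃ t : CompositionSeries (Submodule (RestrictedEnv k p) (formRep k p a).Space),
      t.head = ⊥ ∧ t.last = ⊤ ∧
      ((a = -1 ∨ a = 1) → seriesDims k t = {1, p ^ 2 - 1, p ^ 2}) ∧
      (a ≠ -1 → a ≠ 1 → seriesDims k t = {p ^ 2, p ^ 2}) := by
  have hpos : 0 < p ^ 2 := by positivity
  have h2 : (2 : ZMod p) ≠ 0 := two_ne_zero_of_le hp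
  have hK := finrank_ker_dForm (k := k) hp h0
  have hX := finrank_formRep (k := k) a
  -- For `a = 1` the submodule of twist one breaks up into dimensions `p^2 - 1` and `1`, while the
  -- quotient of twist `2` is simple.
  by_cases h1 : a = 1
  · have h3 : a + 1 ≠ 0 := by rwa [h1, one_add_one_eq_two]
    obtain ⟨L, hL, hL1, hL2⟩ := exists_chain_ker_dForm (k := k) hp h1
    obtain ⟨t, ht, ht', hd⟩ := exists_compositionSeries_three k (m := 1) (n := p ^ 2) hL1 hL2
      (ker_dForm_covBy_top hp h0 h3) hL (by omega) (by omega)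
    refine ⟨t, ht, ht', fun _ => hd.trans ?_, fun _ h => absurd h1 h⟩
    exact Multiset.cons_swap _ _ _
  -- For `a = -1` the submodule is simple, and the quotient of twist zero breaks up into the
  -- constants and a factor of dimension `p^2 - 1`.
  · by_cases h3 : a + 1 = 0
    · obtain ⟨L, hL, hL1, hL2⟩ := exists_chain_ker_dForm_top (k := k) hp h0 h3
      obtain ⟨t, ht, ht', hd⟩ := exists_compositionSeries_three k (m := 1) (n := p ^ 2 - 1)
        (bot_covBy_ker_dForm hp h0 h1) hL1 hL2 hK hL (by omega)
      refine ⟨t, ht, ht', fun _ => hd.trans ?_, fun h => absurd (eq_neg_of_add_eq_zero_left h3) h⟩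
      change p ^ 2 ::ₘ 1 ::ₘ {p ^ 2 - 1} = 1 ::ₘ (p ^ 2 - 1) ::ₘ {p ^ 2}
      rw [Multiset.cons_swap]
      exact congrArg _ (Multiset.cons_swap _ _ _)
    · obtain ⟨t, ht, ht', hd⟩ := exists_compositionSeries_two k
        (bot_covBy_ker_dForm hp h0 h1) (ker_dForm_covBy_top hp h0 h3) hK hX
      refine ⟨t, ht, ht', fun h => ?_, fun _ _ => hd⟩
      exact absurd h (by rintro (rfl | h); exacts [h3 (neg_add_cancel 1), h1 h])

theorem not_isSimpleModule_formRep (hp : 3 ≤ p) (a : ZMod p) :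
    ¬ IsSimpleModule (RestrictedEnv k p) (formRep k p a).Space := fun _ =>
  (eq_bot_or_eq_top (LinearMap.ker (dForm (k := k) a))).elim (ker_dForm_ne_bot a)
    (ker_dForm_ne_top hp a)

variable {X : Type*} [AddCommGroup X] [Module k X] [Module (RestrictedEnv k p) X]
  [IsScalarTower k (RestrictedEnv k p) X]

/-- The composition factors of a module isomorphic to the module of differential forms of degree
one. -/
theorem factors_of_equiv_formRep_zero (hp : 3 ≤ p)
    (e : X ≃ₗ[RestrictedEnv k p] (formRep k p 0).Space) :
    (∃ s : CompositionSeries (Submodule (RestrictedEnv k p) X), s.head = ⊥ ∧ s.last = ⊤) ∧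
    ∀ s : CompositionSeries (Submodule (RestrictedEnv k p) X), s.head = ⊥ → s.last = ⊤ →
      seriesDims k s = {1, 1, p ^ 2 - 1, p ^ 2 - 1} ∧
      ∃ τ : Fin 4 ≃ Fin s.length,
        IsTrivialOneDim k p (seriesFactor s (τ 0)) ∧
        IsTrivialOneDim k p (seriesFactor s (τ 1)) ∧
        Nonempty (seriesFactor s (τ 2) ≃ₗ[RestrictedEnv k p]
          (X ⧸ sSup {N : Submodule (RestrictedEnv k p) X | N ≠ ⊤})) ∧
        Nonempty (seriesFactor s (τ 3) ≃ₗ[RestrictedEnv k p]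
          ((funRep k p 0).Space ⧸ LinearMap.ker (dFun (k := k) (p := p) 0))) := by
  obtain ⟨t, ht, ht', hd, τ, h1, h2, h3, h4⟩ := exists_compositionSeries_formRep_zero (k := k) hp
  refine ⟨exists_compositionSeries e t ht ht', fun s hs hs' =>
    ⟨(seriesDims_eq k e s t hs hs' ht ht').trans hd, ?_⟩⟩
  obtain ⟨σ, hσ⟩ := exists_equiv_factors e s t hs hs' ht ht'
  obtain ⟨e'⟩ := nonempty_quotient_sSup_equiv e (ker_dForm_ne_top (k := k) hp 0)
    fun N hN => by_contra fun h => hN (formRep_zero_eq_top hp h)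
  exact ⟨τ.trans σ, h1.congr (hσ _).some, h2.congr (hσ _).some,
    ⟨((hσ _).some.trans h3.some).trans e'.symm⟩, ⟨(hσ _).some.trans h4.some⟩⟩

/-- The dimensions of the composition factors of a module isomorphic to a module of twisted
differential forms of degree one. -/
theorem seriesDims_of_equiv_formRep (hp : 3 ≤ p) {a : ZMod p} (h0 : a ≠ 0)
    (e : X ≃ₗ[RestrictedEnv k p] (formRep k p a).Space) :
    (∃ s : CompositionSeries (Submodule (RestrictedEnv k p) X), s.head = ⊥ ∧ s.last = ⊤) ∧
    ∀ s : CompositionSeries (Submodule (RestrictedEnv k p) X), s.head = ⊥ → s.last = ⊤ →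
      ((a = -1 ∨ a = 1) → seriesDims k s = {1, p ^ 2 - 1, p ^ 2}) ∧
      (a ≠ -1 → a ≠ 1 → seriesDims k s = {p ^ 2, p ^ 2}) := by
  obtain ⟨t, ht, ht', h⟩ := exists_compositionSeries_formRep (k := k) hp h0
  refine ⟨exists_compositionSeries e t ht ht', fun s hs hs' => ?_⟩
  rwa [seriesDims_eq k e s t hs hs' ht ht']

omit [Module k X] [IsScalarTower k (RestrictedEnv k p) X] in
theorem nonempty_quotient_sSup_equiv_funRep_zero (hp : 3 ≤ p)
    (h : Nonempty (X ≃ₗ[RestrictedEnv k p] (funRep k p 0).Space)) :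
    Nonempty ((X ⧸ sSup {N : Submodule (RestrictedEnv k p) X | N ≠ ⊤}) ≃ₗ[RestrictedEnv k p]
      ((funRep k p 0).Space ⧸ LinearMap.ker (dFun (k := k) (p := p) 0))) :=
  nonempty_quotient_sSup_equiv h.some (ker_dFun_zero_covBy_top hp).ne
    fun _ hN => by_contra fun h => hN (funRep_zero_eq_top hp h)

end Series

end

end HamiltonianLie

/-! ### The composition factors of `Z(a,b)` for `a - b = 1` -/

theorem mainTheorem3 (p : ℕ) [Fact p.Prime] (hp : 5 ≤ p)
    (k : Type*) [Field k] [IsAlgClosed k] [CharP k p]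
    (a b : ZMod p) (hab : a - b = 1)
    (M : Type*) [AddCommGroup M] [Module k M]
    [LieRingModule (hamFil k p 0) M] [LieModule k (hamFil k p 0) M]
    (hM : IsSimpleOfHighestWeight k p a b M) :
    ¬ IsSimpleModule (RestrictedEnv k p) (Induced k p M) ∧
    (∃ s : CompositionSeries (Submodule (RestrictedEnv k p) (Induced k p M)),
      s.head = ⊥ ∧ s.last = ⊤) ∧
    ∀ s : CompositionSeries (Submodule (RestrictedEnv k p) (Induced k p M)),
      s.head = ⊥ → s.last = ⊤ →
      (((a, b) = (-1, -2) ∨ (a, b) = (1, 0)) → factorDims k p s = {1, p ^ 2 - 1, p ^ 2}) ∧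
      ((a, b) = (0, -1) →
        factorDims k p s = {1, 1, p ^ 2 - 1, p ^ 2 - 1} ∧
        ∃ e : Fin 4 ≃ Fin s.length,
          IsTrivialOneDim k p (compFactor k p s (e 0)) ∧
          IsTrivialOneDim k p (compFactor k p s (e 1)) ∧
          Nonempty (compFactor k p s (e 2) ≃ₗ[RestrictedEnv k p] SimpleHead k p M) ∧
          ∀ (M' : Type*) [AddCommGroup M'] [Module k M']
            [LieRingModule (hamFil k p 0) M'] [LieModule k (hamFil k p 0) M'],
            IsSimpleOfHighestWeight k p (-1) (-1) M' →
            Nonempty (compFactor k p s (e 3) ≃ₗ[RestrictedEnv k p] SimpleHead k p M')) ∧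
      ((a, b) ≠ (-1, -2) → (a, b) ≠ (1, 0) → (a, b) ≠ (0, -1) →
        factorDims k p s = {p ^ 2, p ^ 2}) := by
  have hp3 : 3 ≤ p := by omega
  have e := hM.nonempty_equiv_formRep k p hp3 hab
  -- The weight is determined by `a`, so the cases of the theorem are the cases `a = -1`, `a = 1`,
  -- `a = 0` and the rest.
  have hb : b = a - 1 := by rw [← hab, sub_sub_cancel]
  refine ⟨fun h => not_isSimpleModule_formRep hp3 a (IsSimpleModule.congr e.some.symm), ?_⟩
  by_cases h0 : a = 0
  · rw [h0] at e
    have h := factors_of_equiv_formRep_zero hp3 e.some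
    refine ⟨h.1, fun s hs hs' => ⟨fun hab' => ?_, fun _ => ⟨(h.2 s hs hs').1, ?_⟩,
      fun _ _ h' => absurd (by rw [hb, h0, zero_sub]) h'⟩⟩
    · rw [Prod.mk.injEq, Prod.mk.injEq, h0, zero_eq_neg] at hab'
      exact absurd hab' (by simp)
    · refine (h.2 s hs hs').2.imp fun τ hτ => ⟨hτ.1, hτ.2.1, hτ.2.2.1, ?_⟩
      intro M' _ _ _ _ hM'
      -- The highest weight `(-1,-1)` corresponds to functions of twist zero, whose head is the
      -- quotient by the constants, isomorphic to the exact forms.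
      have h' := hM'.nonempty_equiv_funRep k p hp3
      rw [neg_add_cancel] at h'
      exact ⟨hτ.2.2.2.some.trans (nonempty_quotient_sSup_equiv_funRep_zero hp3 h').some.symm⟩
  · have h := seriesDims_of_equiv_formRep hp3 h0 e.some
    refine ⟨h.1, fun s hs hs' => ⟨fun hab' => (h.2 s hs hs').1 ?_,
      fun hab' => absurd (Prod.mk.inj hab').1 h0,
      fun h' h'' _ => (h.2 s hs hs').2 (fun ha => h' ?_) fun ha => h'' ?_⟩⟩
    · exact hab'.imp (fun h => (Prod.mk.inj h).1) fun h => (Prod.mk.inj h).1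
    · rw [hb, ha]
      norm_num
    · rw [hb, ha, sub_self]
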